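/- **Soundness of Deduction.** *Types and domains.* Pure types are the closed types over the grammar $\tau ::= 1 \mid \tau\times\tau \mid \tau\to\tau \mid \alpha \mid \mathrm{rec}\,\alpha.\tau \mid \tau+\tau$. A cpo is a poset with a least element and suprema of directed sets; a Scott domain is a bounded-complete algebraic cpo. Each type expression with $n$ free type variables is interpreted as a functor $(\mathbf{Scott}^{ep})^n\to\mathbf{Scott}^{ep}$ on Scott domains and embedding-projection pairs: variables are projections; $[\![1]\!]=\{\bot<\top\}$; $\times$ is the Cartesian product with componentwise order; $\sigma\to\tau$ is the set of Scott-continuous functions $[\![\sigma]\!]\to[\![\tau]\!]$ with pointwise order; $[\![\sigma+\tau]\!]=([\![\sigma]\!]\amalg[\![\tau]\!])_\bot$, with injections $\mathrm{in}_1,\mathrm{in}_2$; and $[\![\mathrm{rec}\,\alpha.\tau]\!]$ is the colimit of the chain $\{\bot\}\to G(\{\bot\})\to G^2(\{\bot\})\to\cdots$ of embedding-projection pairs with $G=[\![\tau]\!](-)$, that is, the set of all $(x_n)_n\in\prod_n G^n(\{\bot\})$ compatible with the projections, ordered pointwise. It comes with the canonical isomorphism $\mathrm{unfold}:[\![\mathrm{rec}\,\alpha.\tau]\!]\to[\![\tau[\mathrm{rec}\,\alpha.\tau/\alpha]]\!]$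 given by the universal property of the colimit. *Formulae.* Iteration terms are $t::=k\mid 0\mid t+1$ ($k$ an iteration variable). A fixpoint context $\Gamma$ is a list of distinct typed fixpoint variables. For a polarity $s\in\{\pm,+,-\}$ (with $-\pm=\pm$, $-+=-$, $--=+$) the sets $L^s(\Gamma;\tau)$ of neutral, positive and negative formulae of type $\tau$ are generated as follows (up to renaming of bound variables). $L^s(\Gamma;\tau)$ contains $\mathrm{True}$, $\mathrm{False}$ and each $X$ with $(X:\tau)\in\Gamma$, and is closed under $\wedge,\vee$; $\langle\langle\rangle\rangle\in L^s(\Gamma;1)$; if $\varphi\in L^s(\Gamma;\tau_i)$ then $\langle\pi_i\rangle\varphi\in L^s(\Gamma;\tau_1\times\tau_2)$ and $\langle\mathrm{in}_i\rangle\varphi\in L^s(\Gamma;\tau_1+\tau_2)$; if $\varphi\in L^s(\Gamma;\tau[\mathrm{rec}\,\alpha.\tau/\alpha])$ then $\langle\mathrm{fold}\rangle\varphi\in L^s(\Gamma;\mathrm{rec}\,\alpha.\tau)$; if $\varphi\in L^s(\Gamma,X{:}\tau;\tau)$ then $(\mu^tX)\varphi,(\nu^tX)\varphi\in L^s(\Gamma;\tau)$;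 if $\varphi\in L^+(\Gamma;\tau)$ and $k\,\mathrm{Pos}\,\varphi$ then $(\exists k)\varphi\in L^+(\Gamma;\tau)$; if $\varphi\in L^-(\Gamma;\tau)$ and $k\,\mathrm{Neg}\,\varphi$ then $(\forall k)\varphi\in L^-(\Gamma;\tau)$; if $\psi\in L^{-s}(\,;\sigma)$ and $\varphi\in L^{s}(\,;\tau)$ (empty fixpoint context) then $\psi\Rrightarrow\varphi\in L^s(\Gamma;\sigma\to\tau)$. Here $\mathrm{Pos}$ and $\mathrm{Neg}$ are the least relations such that: $k\,\mathrm{Pos}\,\varphi$ and $k\,\mathrm{Neg}\,\varphi$ if $k$ is not free in $\varphi$; both are preserved by $\wedge$, $\vee$ and the modalities $\langle\triangle\rangle$, $\triangle\in\{\pi_1,\pi_2,\mathrm{in}_1,\mathrm{in}_2,\mathrm{fold}\}$; $k\,\mathrm{Neg}\,\psi$ and $k\,\mathrm{Pos}\,\varphi$ imply $k\,\mathrm{Pos}\,(\psi\Rrightarrow\varphi)$, and dually; $k\,\mathrm{Pos}\,\varphi$ implies $k\,\mathrm{Pos}\,(\exists l)\varphi$, $k\,\mathrm{Pos}\,(\mu^tX)\varphi$,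 and, if $k$ is not in $t$, $k\,\mathrm{Pos}\,(\nu^tX)\varphi$; $k\,\mathrm{Neg}\,\varphi$ implies $k\,\mathrm{Neg}\,(\forall l)\varphi$, $k\,\mathrm{Neg}\,(\nu^tX)\varphi$, and, if $k$ is not in $t$, $k\,\mathrm{Neg}\,(\mu^tX)\varphi$. $L^\wedge(\tau)$ is the set of formulae built from $\mathrm{True},\mathrm{False},\langle\langle\rangle\rangle$ with $\wedge$, the modalities and $\Rrightarrow$ only. *Semantics.* A valuation $\rho$ of $\Gamma$ maps each $(X:\tau)\in\Gamma$ to a subset of $[\![\tau]\!]$ and each iteration variable to a natural number. $[\![\varphi]\!]\rho\subseteq[\![\tau]\!]$ is given by: $\wedge,\vee,\mathrm{True},\mathrm{False}$ are $\cap,\cup,[\![\tau]\!],\emptyset$; $[\![X]\!]\rho=\rho(X)$; $[\![\langle\langle\rangle\rangle]\!]\rho=\{\top\}$; $\langle\pi_i\rangle$ and $\langle\mathrm{fold}\rangle$ are the inverse images under $\pi_i$ and $\mathrm{unfold}$; $\langle\mathrm{in}_i\rangle$ is the direct image under $\mathrm{in}_i$; $[\![\psi\Rrightarrow\varphi]\!]\rho=\{f\mid\forall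 x\in[\![\psi]\!]\rho,\ f(x)\in[\![\varphi]\!]\rho\}$; $[\![(\mu^tX)\varphi]\!]\rho$ and $[\![(\nu^tX)\varphi]\!]\rho$ are the $[\![t]\!]\rho$-fold iterates of $S\mapsto[\![\varphi]\!]\rho[S/X]$ applied to $\emptyset$ and to $[\![\tau]\!]$; $(\exists k)$ and $(\forall k)$ are the union and the intersection over all values $n\in\mathbb N$ of $k$. *Deduction.* A sequent $\psi\vdash\varphi$ consists of $\psi,\varphi\in L^s(\Gamma;\tau)$ for some $s$, $\Gamma$, $\tau$. The derivable sequents and the predicate $C(\delta)$ on $\delta\in L^\wedge(\tau)$ are defined by mutual induction by the following rules, each restricted to instances all of whose sequents are sequents in this sense ("$A/B$" means that $B$ follows from $A$). Propositional: $\varphi\vdash\varphi$; $\psi\vdash\theta,\ \theta\vdash\varphi\,/\,\psi\vdash\varphi$; $\psi\wedge(\varphi\vee\theta)\vdash(\psi\wedge\varphi)\vee(\psi\wedge\theta)$; $\psi\vdash\varphi_1,\ \psi\vdash\varphi_2\,/\,\psi\vdash\varphi_1\wedge\varphi_2$; $\psi_i\vdash\varphi\,/\,\psi_1\wedge\psi_2\vdash\varphi$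 ($i=1,2$); $\psi\vdash\mathrm{True}$; $\psi\vdash\varphi_i\,/\,\psi\vdash\varphi_1\vee\varphi_2$ ($i=1,2$); $\psi_1\vdash\varphi,\ \psi_2\vdash\varphi\,/\,\psi_1\vee\psi_2\vdash\varphi$; $\mathrm{False}\vdash\varphi$. Modal: $\langle\mathrm{in}_1\rangle\varphi\wedge\langle\mathrm{in}_2\rangle\psi\vdash\mathrm{False}$; $\psi\vdash\varphi\,/\,\langle\triangle\rangle\psi\vdash\langle\triangle\rangle\varphi$; $\psi'\vdash\psi,\ \varphi\vdash\varphi'\,/\,\psi\Rrightarrow\varphi\vdash\psi'\Rrightarrow\varphi'$; $\langle\triangle\rangle\varphi_1\wedge\langle\triangle\rangle\varphi_2\vdash\langle\triangle\rangle(\varphi_1\wedge\varphi_2)$; $\mathrm{True}\vdash\langle\triangle\rangle\mathrm{True}$ for $\triangle\ne\mathrm{in}_1,\mathrm{in}_2$; $(\forall k)\langle\triangle\rangle\varphi\vdash\langle\triangle\rangle(\forall k)\varphi$; $\langle\triangle\rangle(\varphi_1\vee\varphi_2)\vdash\langle\triangle\rangle\varphi_1\vee\langle\triangle\rangle\varphi_2$;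 $\langle\triangle\rangle\mathrm{False}\vdash\mathrm{False}$; $\langle\triangle\rangle(\exists k)\varphi\vdash(\exists k)\langle\triangle\rangle\varphi$. Quantifiers: $\psi\vdash\varphi[t/k]\,/\,\psi\vdash(\exists k)\varphi$; $\theta\wedge\varphi\vdash\psi\,/\,\theta\wedge(\exists k)\varphi\vdash\psi$ if $k\notin FV(\psi,\theta)$; $(\exists k)(\exists l)\varphi\vdash(\exists k)\varphi[k/l]$; $\varphi[t/k]\vdash\psi\,/\,(\forall k)\varphi\vdash\psi$; $\psi\vdash\varphi\vee\theta\,/\,\psi\vdash(\forall k)\varphi\vee\theta$ if $k\notin FV(\psi,\theta)$; $(\forall k)\varphi[k/l]\vdash(\forall k)(\forall l)\varphi$; and, for $\kappa\in\{\mu,\nu\}$ and $k\notin FV(t)$, $(\kappa^tX)(\exists k)\varphi\vdash(\exists k)(\kappa^tX)\varphi$ and $(\forall k)(\kappa^tX)\varphi\vdash(\kappa^tX)(\forall k)\varphi$. Bounded iteration: $(\mu^0X)\varphi\vdash\mathrm{False}$; $(\mu^tX)\varphi\vdash\psi\,/\,(\mu^{t+1}X)\varphi\vdash\varphi[\psi/X]$;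 $\varphi[(\mu^tX)\varphi/X]\vdash(\mu^{t+1}X)\varphi$; $\psi\vdash\varphi\,/\,(\mu^tX)\psi\vdash(\mu^tX)\varphi$; $\mathrm{True}\vdash(\nu^0X)\varphi$; $\psi\vdash(\nu^tX)\varphi\,/\,\varphi[\psi/X]\vdash(\nu^{t+1}X)\varphi$; $(\nu^{t+1}X)\varphi\vdash\varphi[(\nu^tX)\varphi/X]$; $\psi\vdash\varphi\,/\,(\nu^tX)\psi\vdash(\nu^tX)\varphi$. Realizability implication: (WF) $(\forall k)\psi\Rrightarrow\varphi\vdash(\exists k)(\psi\Rrightarrow\varphi)$ if $k\notin FV(\varphi)$; (CC) $\psi\Rrightarrow(\exists k)\varphi\vdash(\exists k)(\psi\Rrightarrow\varphi)$ if $\psi\in L^\pm$ and $k\notin FV(\psi)$; $(\forall k)(\psi\Rrightarrow\varphi)\vdash(\exists k)\psi\Rrightarrow\varphi$ if $k\notin FV(\varphi)$; $(\forall k)(\psi\Rrightarrow\varphi)\vdash\psi\Rrightarrow(\forall k)\varphi$ if $k\notin FV(\psi)$; $(\psi\Rrightarrow\varphi_1)\wedge(\psi\Rrightarrow\varphi_2)\vdash\psi\Rrightarrow(\varphi_1\wedge\varphi_2)$;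 $\mathrm{True}\vdash\psi\Rrightarrow\mathrm{True}$; $(\psi_1\Rrightarrow\varphi)\wedge(\psi_2\Rrightarrow\varphi)\vdash(\psi_1\vee\psi_2)\Rrightarrow\varphi$; $\mathrm{True}\vdash\mathrm{False}\Rrightarrow\varphi$; ($\Rrightarrow/\vee$) $\delta\Rrightarrow(\varphi_1\vee\varphi_2)\vdash(\delta\Rrightarrow\varphi_1)\vee(\delta\Rrightarrow\varphi_2)$ if $\delta\in L^\wedge$; (C) $(\delta\Rrightarrow\mathrm{False})\vdash\mathrm{False}$ if $\delta\in L^\wedge$ and $C(\delta)$. Consistency: $C(\langle\langle\rangle\rangle)$; $C(\mathrm{True})$; $C(\varphi)\,/\,C(\langle\triangle\rangle\varphi)$ for $\triangle\in\{\mathrm{fold},\mathrm{in}_1,\mathrm{in}_2\}$; $C(\varphi),C(\psi)\,/\,C(\langle\pi_1\rangle\varphi\wedge\langle\pi_2\rangle\psi)$; $C(\psi),\ \psi\vdash\varphi\,/\,C(\varphi)$ if $\varphi\in L^\wedge$; and $C(\bigwedge_{i\in I}(\psi_i\Rrightarrow\varphi_i))$ whenever $I$ is finite, $C(\psi_i)$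 and $C(\varphi_i)$ for all $i\in I$, and for every $J\subseteq I$ either $\bigwedge_{j\in J}\psi_j\vdash\mathrm{False}$ or $C(\bigwedge_{j\in J}\varphi_j)$. *Theorem.* 1. For every pure type $\tau$ and every $\delta\in L^\wedge(\tau)$, if $C(\delta)$ is derivable then $[\![\delta]\!]\neq\emptyset$. 2. For every polarity $s$, fixpoint context $\Gamma$, pure type $\tau$ and $\varphi,\psi\in L^s(\Gamma;\tau)$, if $\psi\vdash\varphi$ is derivable then $[\![\psi]\!]\rho\subseteq[\![\varphi]\!]\rho$ for every valuation $\rho$ of $\Gamma$. -/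

import Mathlib

open CategoryTheory

namespace RefLogic

/-! ### Cpos and Scott-continuous functions -/

/-- A cpo: a partial order with a least element and suprema of all (non-empty) directed subsets.
Scott domains are the bounded-complete algebraic cpos. They form a full subcategory of the category
of cpos and Scott-continuous functions, closed under the constructions below, so that the
interpretation of types can be computed among cpos. -/
structure Cpo : Type 1 where
  carrier : Type
  [po : PartialOrder carrier]
  exists_bot : ∃ b : carrier, ∀ x, b ≤ x
  exists_lub : ∀ d : Set carrier, d.Nonempty → DirectedOn (· ≤ ·) d → ∃ a, IsLUB d a

instance : CoeSort Cpo Type := ⟨Cpo.carrier⟩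

instance (X : Cpo) : PartialOrder X := X.po

/-- Scott-continuous functions, ordered pointwise. -/
structure ScottHom (X Y : Cpo) : Type where
  toFun : X → Y
  continuous : ScottContinuous toFun

namespace ScottHom

instance (X Y : Cpo) : CoeFun (ScottHom X Y) (fun _ => X → Y) := ⟨ScottHom.toFun⟩

theorem ext {X Y : Cpo} {f g : ScottHom X Y} (h : ∀ x, f x = g x) : f = g := by
  cases f; cases g
  congr
  exact funext h

instance (X Y : Cpo) : PartialOrder (ScottHom X Y) :=
  PartialOrder.lift ScottHom.toFun fun _ _ h => ext (congrFun h)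

theorem mono {X Y : Cpo} (f : ScottHom X Y) {x y : X} (h : x ≤ y) : f x ≤ f y :=
  f.2.monotone h

theorem apply_le {X Y : Cpo} {f g : ScottHom X Y} (h : f ≤ g) (x : X) : f x ≤ g x :=
  (show f.1 ≤ g.1 from h) x

def id (X : Cpo) : ScottHom X X := ⟨_root_.id, ScottContinuous.id⟩

def comp {X Y Z : Cpo} (g : ScottHom Y Z) (f : ScottHom X Y) : ScottHom X Z :=
  ⟨fun x => g (f x), ScottContinuous.comp f.2 g.2⟩

end ScottHom

theorem directedOn_image {α β : Type} [PartialOrder α] [PartialOrder β] {f : α → β}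
    (hf : Monotone f) {d : Set α} (hd : DirectedOn (· ≤ ·) d) : DirectedOn (· ≤ ·) (f '' d) := by
  rintro _ ⟨x, hx, rfl⟩ _ ⟨y, hy, rfl⟩
  obtain ⟨z, hz, hxz, hyz⟩ := hd x hx y hy
  exact ⟨f z, ⟨z, hz, rfl⟩, hf hxz, hf hyz⟩

theorem scottContinuous_of_apply {X Y : Cpo} {F : Set (ScottHom X Y)} {s : X → Y}
    (hs : ∀ x, IsLUB ((fun f : ScottHom X Y => f x) '' F) (s x)) : ScottContinuous s := by
  intro d hd hdir a ha
  constructor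
  · rintro _ ⟨x, hx, rfl⟩
    refine (hs x).2 ?_
    rintro _ ⟨f, hf, rfl⟩
    exact (f.mono (ha.1 hx)).trans ((hs a).1 ⟨f, hf, rfl⟩)
  · intro b hb
    refine (hs a).2 ?_
    rintro _ ⟨f, hf, rfl⟩
    refine (f.2 hd hdir ha).2 ?_
    rintro _ ⟨x, hx, rfl⟩
    exact ((hs x).1 ⟨f, hf, rfl⟩).trans (hb ⟨x, hx, rfl⟩)

theorem isLUB_of_apply {X Y : Cpo} {F : Set (ScottHom X Y)} {s : X → Y}
    (hs : ∀ x, IsLUB ((fun f : ScottHom X Y => f x) '' F) (s x)) :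
    IsLUB F (⟨s, scottContinuous_of_apply hs⟩ : ScottHom X Y) := by
  refine ⟨fun f hf x => (hs x).1 ⟨f, hf, rfl⟩, fun g hg x => (hs x).2 ?_⟩
  rintro _ ⟨f, hf, rfl⟩
  exact ScottHom.apply_le (hg hf) x

theorem directedOn_apply {X Y : Cpo} {F : Set (ScottHom X Y)} (hF : DirectedOn (· ≤ ·) F) (x : X) :
    DirectedOn (· ≤ ·) ((fun f : ScottHom X Y => f x) '' F) :=
  directedOn_image (fun (f g : ScottHom X Y) (h : f ≤ g) => ScottHom.apply_le h x) hF

theorem exists_lub_apply {X Y : Cpo} {F : Set (ScottHom X Y)} (hn : F.Nonempty)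
    (hF : DirectedOn (· ≤ ·) F) :
    ∃ s : X → Y, ∀ x, IsLUB ((fun f : ScottHom X Y => f x) '' F) (s x) := by
  choose s hs using fun x => Y.exists_lub _ (hn.image _) (directedOn_apply hF x)
  exact ⟨s, hs⟩

/-- Directed suprema of Scott-continuous functions are pointwise. -/
theorem isLUB_fn {X Y : Cpo} {F : Set (ScottHom X Y)} (hn : F.Nonempty)
    (hF : DirectedOn (· ≤ ·) F) {a : ScottHom X Y} (ha : IsLUB F a) (x : X) :
    IsLUB ((fun f : ScottHom X Y => f x) '' F) (a x) := by
  obtain ⟨s, hs⟩ := exists_lub_apply hn hF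
  rw [ha.unique (isLUB_of_apply hs)]
  exact hs x

namespace Cpo

/-- The one-point cpo. -/
def one : Cpo where
  carrier := Unit
  exists_bot := ⟨(), fun _ => le_rfl⟩
  exists_lub := fun _ _ _ => ⟨(), fun _ _ => le_rfl, fun _ _ => le_rfl⟩

/-- The two-point cpo `{⊥ < ⊤}`, with `⊥ = false` and `⊤ = true`. -/
def two : Cpo where
  carrier := Bool
  exists_bot := ⟨false, fun _ => Bool.false_le _⟩
  exists_lub := fun d _ _ => ⟨sSup d, isLUB_sSup d⟩

/-- Cartesian product with the component-wise order. -/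
def prod (X Y : Cpo) : Cpo where
  carrier := X × Y
  exists_bot := by
    obtain ⟨a, ha⟩ := X.exists_bot
    obtain ⟨b, hb⟩ := Y.exists_bot
    exact ⟨(a, b), fun x => ⟨ha _, hb _⟩⟩
  exists_lub := by
    intro d hn hd
    obtain ⟨a, ha⟩ := X.exists_lub _ (hn.image _) (directedOn_image monotone_fst hd)
    obtain ⟨b, hb⟩ := Y.exists_lub _ (hn.image _) (directedOn_image monotone_snd hd)
    exact ⟨(a, b), isLUB_prod.2 ⟨ha, hb⟩⟩

/-- The function space, with the pointwise order. -/
def fn (X Y : Cpo) : Cpo where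
  carrier := ScottHom X Y
  exists_bot := by
    obtain ⟨b, hb⟩ := Y.exists_bot
    exact ⟨⟨Function.const X b, ScottContinuous.const b⟩, fun f x => hb _⟩
  exists_lub := by
    intro d hn hd
    obtain ⟨s, hs⟩ := exists_lub_apply hn hd
    exact ⟨_, isLUB_of_apply hs⟩

end Cpo

/-- Directed sets meeting an order-embedded, upward closed part of a partial order. -/
theorem preimage_directed {Z S : Type} [PartialOrder Z] [PartialOrder S] {i : Z → S}
    (hi : ∀ a b, i a ≤ i b ↔ a ≤ b) (hup : ∀ a s, i a ≤ s → ∃ b, s = i b) {d : Set S}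
    (hd : DirectedOn (· ≤ ·) d) {z : Z} (hz : i z ∈ d) :
    DirectedOn (· ≤ ·) (i ⁻¹' d) ∧ ∀ w ∈ d, ∃ x, i x ∈ d ∧ w ≤ i x := by
  have key : ∀ w ∈ d, ∃ x, i x ∈ d ∧ w ≤ i x := by
    intro w hw
    obtain ⟨v, hv, h1, h2⟩ := hd _ hz _ hw
    obtain ⟨b, rfl⟩ := hup _ _ h1
    exact ⟨b, hv, h2⟩
  refine ⟨?_, key⟩
  intro a ha b hb
  obtain ⟨v, hv, h1, h2⟩ := hd _ ha _ hb
  obtain ⟨c, hc, h3⟩ := key v hv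
  exact ⟨c, hc, (hi _ _).1 (h1.trans h3), (hi _ _).1 (h2.trans h3)⟩

theorem isLUB_preimage {Z S : Type} [PartialOrder Z] [PartialOrder S] {i : Z → S}
    (hi : ∀ a b, i a ≤ i b ↔ a ≤ b) (hup : ∀ a s, i a ≤ s → ∃ b, s = i b) {d : Set S}
    (hd : DirectedOn (· ≤ ·) d) {z : Z} (hz : i z ∈ d) {a : Z} :
    IsLUB d (i a) ↔ IsLUB (i ⁻¹' d) a := by
  obtain ⟨-, key⟩ := preimage_directed hi hup hd hz
  constructor
  · intro h
    refine ⟨fun x hx => (hi _ _).1 (h.1 hx), fun b hb => (hi _ _).1 (h.2 fun w hw => ?_)⟩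
    obtain ⟨x, hx, hwx⟩ := key w hw
    exact hwx.trans ((hi _ _).2 (hb hx))
  · intro h
    refine ⟨fun w hw => ?_, fun s hs => ?_⟩
    · obtain ⟨x, hx, hwx⟩ := key w hw
      exact hwx.trans ((hi _ _).2 (h.1 hx))
    · obtain ⟨b, rfl⟩ := hup _ _ (hs hz)
      exact (hi _ _).2 (h.2 fun x hx => (hi _ _).1 (hs hx))

section Sum

variable {X Y : Type} [PartialOrder X] [PartialOrder Y]

/-- The injections into the weak coproduct `(X ⨿ Y)_⊥`. -/
def inl (x : X) : WithBot (X ⊕ Y) := ((Sum.inl x : X ⊕ Y) : WithBot (X ⊕ Y))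

def inr (y : Y) : WithBot (X ⊕ Y) := ((Sum.inr y : X ⊕ Y) : WithBot (X ⊕ Y))

theorem inl_le (a b : X) : (inl a : WithBot (X ⊕ Y)) ≤ inl b ↔ a ≤ b := by simp [inl]

theorem inr_le (a b : Y) : (inr a : WithBot (X ⊕ Y)) ≤ inr b ↔ a ≤ b := by simp [inr]

theorem inl_up (a : X) (s : WithBot (X ⊕ Y)) (h : inl a ≤ s) : ∃ b, s = inl b := by
  rcases s with _ | (b | b)
  · exact absurd h (WithBot.not_coe_le_bot _)
  · exact ⟨b, rfl⟩
  · exact absurd (WithBot.coe_le_coe.1 h) Sum.not_inl_le_inr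

theorem inr_up (a : Y) (s : WithBot (X ⊕ Y)) (h : inr a ≤ s) : ∃ b, s = inr b := by
  rcases s with _ | (b | b)
  · exact absurd h (WithBot.not_coe_le_bot _)
  · exact absurd (WithBot.coe_le_coe.1 h) Sum.not_inr_le_inl
  · exact ⟨b, rfl⟩

theorem sum_cases {X Y : Type} (d : Set (WithBot (X ⊕ Y))) :
    (∃ x, inl x ∈ d) ∨ (∃ y, inr y ∈ d) ∨ ∀ w ∈ d, w = ⊥ := by
  by_contra! h
  obtain ⟨h1, h2, w, hw, hne⟩ := h
  rcases w with _ | (b | b)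
  · exact hne rfl
  · exact h1 b hw
  · exact h2 b hw

theorem isLUB_image_of_cofinal {Z S T : Type} [PartialOrder Z] [PartialOrder S] [PartialOrder T]
    {i : Z → S} (hi : ∀ a b, i a ≤ i b ↔ a ≤ b) (hup : ∀ a s, i a ≤ s → ∃ b, s = i b) {h : S → T}
    (hm : Monotone h) (hc : ScottContinuous (fun z => h (i z))) {d : Set S}
    (hd : DirectedOn (· ≤ ·) d) {z : Z} (hz : i z ∈ d) {s : S} (hs : IsLUB d s) :
    IsLUB (h '' d) (h s) := by
  obtain ⟨a, rfl⟩ := hup _ _ (hs.1 hz)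
  refine ⟨?_, fun b hb => ?_⟩
  · rintro _ ⟨w, hw, rfl⟩
    exact hm (hs.1 hw)
  · refine (hc ⟨z, hz⟩ (preimage_directed hi hup hd hz).1
      ((isLUB_preimage hi hup hd hz).1 hs)).2 ?_
    rintro _ ⟨x, hx, rfl⟩
    exact hb ⟨i x, hx, rfl⟩

end Sum

namespace Cpo

/-- The weak coproduct `(X ⨿ Y)_⊥`: the disjoint union with a new least element. -/
def sum (X Y : Cpo) : Cpo where
  carrier := WithBot (X ⊕ Y)
  exists_bot := ⟨⊥, fun _ => bot_le⟩
  exists_lub := by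
    intro d hn hd
    rcases sum_cases d with ⟨x, hx⟩ | ⟨y, hy⟩ | h
    · obtain ⟨a, ha⟩ := X.exists_lub _ ⟨x, hx⟩ (preimage_directed inl_le inl_up hd hx).1
      exact ⟨inl a, (isLUB_preimage inl_le inl_up hd hx).2 ha⟩
    · obtain ⟨a, ha⟩ := Y.exists_lub _ ⟨y, hy⟩ (preimage_directed inr_le inr_up hd hy).1
      exact ⟨inr a, (isLUB_preimage inr_le inr_up hd hy).2 ha⟩
    · exact ⟨⊥, fun w hw => (h w hw).le, fun _ _ => bot_le⟩

end Cpo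

namespace ScottHom

variable {X X' Y Y' : Cpo}

/-- The map `f + g` between weak coproducts. -/
def sumFun (f : X → X') (g : Y → Y') : WithBot (X ⊕ Y) → WithBot (X' ⊕ Y') :=
  WithBot.map (Sum.map f g)

theorem sumFun_mono {f : X → X'} {g : Y → Y'} (hf : Monotone f) (hg : Monotone g) :
    Monotone (sumFun f g) :=
  WithBot.monotone_map_iff.2 (by
    rintro (a | a) (b | b) h
    · exact Sum.inl_le_inl_iff.2 (hf (Sum.inl_le_inl_iff.1 h))
    · exact absurd h Sum.not_inl_le_inr
    · exact absurd h Sum.not_inr_le_inl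
    · exact Sum.inr_le_inr_iff.2 (hg (Sum.inr_le_inr_iff.1 h)))

theorem inl_continuous : ScottContinuous (inl : X → WithBot (X ⊕ Y)) := by
  intro d hd hdir a ha
  refine ⟨?_, fun s hs => ?_⟩
  · rintro _ ⟨x, hx, rfl⟩
    exact (inl_le _ _).2 (ha.1 hx)
  · obtain ⟨x, hx⟩ := hd
    obtain ⟨b, rfl⟩ := inl_up _ _ (hs ⟨x, hx, rfl⟩)
    exact (inl_le _ _).2 (ha.2 fun y hy => (inl_le _ _).1 (hs ⟨y, hy, rfl⟩))

theorem inr_continuous : ScottContinuous (inr : Y → WithBot (X ⊕ Y)) := by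
  intro d hd hdir a ha
  refine ⟨?_, fun s hs => ?_⟩
  · rintro _ ⟨x, hx, rfl⟩
    exact (inr_le _ _).2 (ha.1 hx)
  · obtain ⟨x, hx⟩ := hd
    obtain ⟨b, rfl⟩ := inr_up _ _ (hs ⟨x, hx, rfl⟩)
    exact (inr_le _ _).2 (ha.2 fun y hy => (inr_le _ _).1 (hs ⟨y, hy, rfl⟩))

def sumMap (f : ScottHom X X') (g : ScottHom Y Y') : ScottHom (X.sum Y) (X'.sum Y') :=
  ⟨sumFun f.1 g.1, by
    have hm : Monotone (sumFun f.1 g.1) := sumFun_mono f.2.monotone g.2.monotone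
    intro d hd hdir a ha
    rcases sum_cases d with ⟨x, hx⟩ | ⟨y, hy⟩ | h
    · exact isLUB_image_of_cofinal inl_le inl_up hm (f.2.comp inl_continuous) hdir hx ha
    · exact isLUB_image_of_cofinal inr_le inr_up hm (g.2.comp inr_continuous) hdir hy ha
    · have ha' : a = (⊥ : WithBot (X ⊕ Y)) := 
        le_antisymm (ha.2 fun w hw => (h w hw).le) (bot_le (α := WithBot (X ⊕ Y)))
      subst ha'
      refine ⟨?_, fun u _ => bot_le (α := WithBot (X' ⊕ Y'))⟩
      rintro _ ⟨w, hw, rfl⟩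
      exact hm (h w hw).le⟩

def prodMap (f : ScottHom X X') (g : ScottHom Y Y') : ScottHom (X.prod Y) (X'.prod Y') :=
  ⟨fun p => (f p.1, g p.2),
    ScottContinuous.prodMk (ScottContinuous.comp ScottContinuous.fst f.2)
      (ScottContinuous.comp ScottContinuous.snd g.2)⟩

/-- The map `h ↦ g ∘ h ∘ f` between function spaces. -/
def fnMap (f : ScottHom X' X) (g : ScottHom Y Y') : ScottHom (X.fn Y) (X'.fn Y') :=
  ⟨fun h => g.comp (ScottHom.comp h f), by
    intro d hd hdir a ha
    have ptw := isLUB_fn hd hdir ha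
    refine ⟨?_, fun u hu x => ?_⟩
    · rintro _ ⟨h, hh, rfl⟩
      exact fun x => g.mono (ScottHom.apply_le (ha.1 hh) (f x))
    · refine (g.2 (hd.image _) (directedOn_apply hdir _) (ptw (f x))).2 ?_
      rintro _ ⟨_, ⟨h, hh, rfl⟩, rfl⟩
      exact ScottHom.apply_le (hu ⟨h, hh, rfl⟩) x⟩

end ScottHom

/-! ### Embedding-projection pairs -/

/-- An embedding-projection pair from `X` to `Y`. -/
structure EP (X Y : Cpo) where
  L : ScottHom X Y
  R : ScottHom Y X
  RL : ∀ x, R (L x) = x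
  LR : ∀ y, L (R y) ≤ y

/-- The embedding is determined by the projection. -/
theorem EP.ext {X Y : Cpo} {e f : EP X Y} (h : ∀ y, e.R y = f.R y) : e = f := by
  have hL : ∀ (e f : EP X Y), (∀ y, e.R y = f.R y) → ∀ x, e.L x ≤ f.L x := by
    intro e f h x
    have := e.LR (f.L x)
    rwa [h, f.RL] at this
  have h1 : e.L = f.L := ScottHom.ext fun x =>
    le_antisymm (hL e f h x) (hL f e (fun y => (h y).symm) x)
  have h2 : e.R = f.R := ScottHom.ext h
  cases e; cases f
  simp only at h1 h2
  subst h1; subst h2; rfl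

/-- The category of cpos and embedding-projection pairs. -/
instance : Category.{0} Cpo where
  Hom := EP
  id X := ⟨ScottHom.id X, ScottHom.id X, fun _ => rfl, fun _ => le_rfl⟩
  comp e f := ⟨f.L.comp e.L, e.R.comp f.R,
    fun x => (congrArg e.R (f.RL (e.L x))).trans (e.RL x),
    fun y => (f.L.mono (e.LR (f.R y))).trans (f.LR y)⟩
  id_comp _ := rfl
  comp_id _ := rfl
  assoc _ _ _ := rfl

namespace EP

variable {X Y Z X' Y' : Cpo}

theorem hom_ext {e f : X ⟶ Y} (h : ∀ y, e.R y = f.R y) : e = f := EP.ext h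

theorem comp_R (e : X ⟶ Y) (f : Y ⟶ Z) (z : Z) : (e ≫ f).R z = e.R (f.R z) := rfl

theorem comp_L (e : X ⟶ Y) (f : Y ⟶ Z) (x : X) : (e ≫ f).L x = f.L (e.L x) := rfl

theorem id_R (x : X) : EP.R (𝟙 X) x = x := rfl

theorem id_L (x : X) : EP.L (𝟙 X) x = x := rfl

/-- The one-point cpo is initial for embedding-projection pairs. -/
noncomputable def init (X : Cpo) : Cpo.one ⟶ X :=
  EP.mk (X := Cpo.one) (Y := X)
    ⟨Function.const _ X.exists_bot.choose, ScottContinuous.const _⟩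
    ⟨Function.const _ (), ScottContinuous.const _⟩ (fun _ => rfl)
    (fun y => X.exists_bot.choose_spec y)

theorem init_comp (e : X ⟶ Y) : init X ≫ e = init Y := hom_ext fun _ => rfl

def prod (e : X ⟶ X') (f : Y ⟶ Y') : X.prod Y ⟶ X'.prod Y' :=
  EP.mk (X := X.prod Y) (Y := X'.prod Y') (e.L.prodMap f.L) (e.R.prodMap f.R)
    (fun _ => Prod.ext (e.RL _) (f.RL _)) (fun _ => ⟨e.LR _, f.LR _⟩)

def sum (e : X ⟶ X') (f : Y ⟶ Y') : X.sum Y ⟶ X'.sum Y' :=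
  EP.mk (X := X.sum Y) (Y := X'.sum Y') (e.L.sumMap f.L) (e.R.sumMap f.R)
    (by
      rintro (_ | (x | y))
      · rfl
      · exact congrArg inl (e.RL x)
      · exact congrArg inr (f.RL y))
    (by
      rintro (_ | (x | y))
      · exact le_rfl
      · exact (inl_le _ _).2 (e.LR x)
      · exact (inr_le _ _).2 (f.LR y))

def fn (e : X ⟶ X') (f : Y ⟶ Y') : X.fn Y ⟶ X'.fn Y' :=
  EP.mk (X := X.fn Y) (Y := X'.fn Y') (ScottHom.fnMap e.R f.L) (ScottHom.fnMap e.L f.R)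
    (fun h => ScottHom.ext fun x => by
      change f.R (f.L (ScottHom.comp h (ScottHom.comp e.R e.L) x)) = _
      rw [f.RL]
      exact congrArg h.1 (e.RL x))
    (fun h x => (f.LR _).trans (ScottHom.mono h (e.LR x)))

end EP

section Functors

variable {E : Type 1} [Category.{0} E]

def prodF (F G : E ⥤ Cpo) : E ⥤ Cpo where
  obj B := (F.obj B).prod (G.obj B)
  map f := EP.prod (F.map f) (G.map f)
  map_id B := by rw [F.map_id, G.map_id]; rfl
  map_comp f g := by rw [F.map_comp, G.map_comp]; rfl

def sumF (F G : E ⥤ Cpo) : E ⥤ Cpo where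
  obj B := (F.obj B).sum (G.obj B)
  map f := EP.sum (F.map f) (G.map f)
  map_id B := by
    rw [F.map_id, G.map_id]
    refine EP.hom_ext ?_
    rintro (_ | (x | y)) <;> rfl
  map_comp f g := by
    rw [F.map_comp, G.map_comp]
    refine EP.hom_ext ?_
    rintro (_ | (x | y)) <;> rfl

def fnF (F G : E ⥤ Cpo) : E ⥤ Cpo where
  obj B := (F.obj B).fn (G.obj B)
  map f := EP.fn (F.map f) (G.map f)
  map_id B := by rw [F.map_id, G.map_id]; rfl
  map_comp f g := by rw [F.map_comp, G.map_comp]; rfl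

end Functors

/-! ### Colimits of `ω`-chains of embedding-projection pairs -/

section Lim

variable (K : ℕ ⥤ Cpo)

/-- Threads of a chain of projections, ordered pointwise. -/
structure Thread : Type where
  seq : ∀ n, K.obj n
  compat : ∀ n m (h : n ≤ m), (K.map (homOfLE h)).R (seq m) = seq n

variable {K}

theorem Thread.ext {x y : Thread K} (h : ∀ n, x.seq n = y.seq n) : x = y := by
  cases x; cases y
  congr
  exact funext h

instance : PartialOrder (Thread K) :=
  PartialOrder.lift Thread.seq fun _ _ h => Thread.ext (congrFun h)

theorem Thread.isLUB {d : Set (Thread K)} (hn : d.Nonempty) (hd : DirectedOn (· ≤ ·) d) :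
    ∃ a : Thread K, IsLUB d a ∧ ∀ n, IsLUB ((fun x : Thread K => x.1 n) '' d) (a.1 n) := by
  have hdn : ∀ n, DirectedOn (· ≤ ·) ((fun x : Thread K => x.1 n) '' d) := fun n =>
    directedOn_image (fun (x y : Thread K) (h : x ≤ y) => (show x.1 ≤ y.1 from h) n) hd
  choose a ha using fun n => (K.obj n).exists_lub _ (hn.image fun x : Thread K => x.1 n) (hdn n)
  refine ⟨⟨a, fun n m h => ?_⟩, ⟨fun x hx n => (ha n).1 ⟨x, hx, rfl⟩, fun y hy n => ?_⟩, ha⟩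
  · have h1 := (K.map (homOfLE h)).R.2 (hn.image _) (hdn m) (ha m)
    rw [Set.image_image] at h1
    refine h1.unique ?_
    convert ha n using 1
    exact Set.image_congr fun x _ => x.2 n m h
  · refine (ha n).2 ?_
    rintro _ ⟨x, hx, rfl⟩
    exact (show x.1 ≤ y.1 from hy hx) n

theorem Thread.isLUB_apply {d : Set (Thread K)} (hn : d.Nonempty) (hd : DirectedOn (· ≤ ·) d)
    {a : Thread K} (ha : IsLUB d a) (n : ℕ) :
    IsLUB ((fun x : Thread K => x.1 n) '' d) (a.1 n) := by
  obtain ⟨b, hb, h⟩ := Thread.isLUB hn hd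
  rw [ha.unique hb]
  exact h n

variable (K)

/-- The limit of the projections of a chain of embedding-projection pairs. -/
def Lim : Cpo where
  carrier := Thread K
  exists_bot := by
    choose b hb using fun n => (K.obj n).exists_bot
    refine ⟨⟨b, fun n m h => le_antisymm ?_ (hb _ _)⟩, fun _ n => hb n _⟩
    calc (K.map (homOfLE h)).R (b m) ≤ (K.map (homOfLE h)).R ((K.map (homOfLE h)).L (b n)) :=
          ScottHom.mono _ (hb _ _)
      _ = b n := EP.RL _ _
  exists_lub := fun d hn hd => (Thread.isLUB hn hd).imp fun _ h => h.1

variable {K}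

theorem map_R_map_R {n m l : ℕ} (h : n ≤ m) (h' : m ≤ l) (x : K.obj l) :
    (K.map (homOfLE h)).R ((K.map (homOfLE h')).R x) = (K.map (homOfLE (h.trans h'))).R x := by
  rw [← EP.comp_R, ← K.map_comp]; rfl

theorem map_L_map_L {n m l : ℕ} (h : n ≤ m) (h' : m ≤ l) (x : K.obj n) :
    (K.map (homOfLE h')).L ((K.map (homOfLE h)).L x) = (K.map (homOfLE (h.trans h'))).L x := by
  rw [← EP.comp_L, ← K.map_comp]; rfl

theorem map_RL_indep {n m a b : ℕ} (hna : n ≤ a) (hma : m ≤ a) (hab : a ≤ b) (x : K.obj n) :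
    (K.map (homOfLE (hma.trans hab))).R ((K.map (homOfLE (hna.trans hab))).L x) =
      (K.map (homOfLE hma)).R ((K.map (homOfLE hna)).L x) := by
  rw [← map_R_map_R hma hab, ← map_L_map_L hna hab, EP.RL]

variable (K)

/-- The components of the colimiting cocone: the projections are the set-theoretic ones. -/
def cocone (n : ℕ) : K.obj n ⟶ Lim K :=
  EP.mk (X := K.obj n) (Y := Lim K)
    ⟨fun x => ⟨fun m => (K.map (homOfLE (le_max_right n m))).R
        ((K.map (homOfLE (le_max_left n m))).L x), fun m l h =>
          (map_R_map_R h (le_max_right n l) _).trans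
            (map_RL_indep (le_max_left n m) (le_max_right n m) (max_le_max_left n h) x)⟩,
      by
        intro d hd hdir a ha
        refine ⟨?_, fun y hy m => ?_⟩
        · rintro _ ⟨x, hx, rfl⟩
          exact fun m => ScottHom.mono _ (ScottHom.mono _ (ha.1 hx))
        · refine ((ScottHom.comp _ _).2 hd hdir ha :
            IsLUB _ (((K.map (homOfLE (le_max_right n m))).R.comp
              (K.map (homOfLE (le_max_left n m))).L) a)).2 ?_
          rintro _ ⟨x, hx, rfl⟩
          exact (show _ ≤ y.1 from hy ⟨x, hx, rfl⟩) m⟩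
    ⟨fun x => x.1 n, fun _ hd hdir _ ha => Thread.isLUB_apply hd hdir ha n⟩
    (fun x => by
      have h := map_RL_indep (K := K) (le_refl n) (le_refl n) (le_max_left n n) x
      exact h.trans (EP.RL _ _))
    (fun y m => by
      change (K.map (homOfLE (le_max_right n m))).R
        ((K.map (homOfLE (le_max_left n m))).L (y.1 n)) ≤ y.1 m
      rw [← y.2 n _ (le_max_left n m), ← y.2 m _ (le_max_right n m)]
      exact ScottHom.mono _ (EP.LR _ _))

theorem cocone_w {n m : ℕ} (h : n ≤ m) : K.map (homOfLE h) ≫ cocone K m = cocone K n :=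
  EP.hom_ext fun y => y.2 n m h

variable {K}

theorem cocone_of_succ {Y : Cpo} (c : ∀ n, K.obj n ⟶ Y)
    (hc : ∀ n, K.map (homOfLE (Nat.le_add_right n 1)) ≫ c (n + 1) = c n) (n m : ℕ) (h : n ≤ m) :
    K.map (homOfLE h) ≫ c m = c n := by
  induction m, h using Nat.le_induction with
  | base => exact (congrArg (· ≫ c n) (K.map_id n)).trans (Category.id_comp _)
  | succ m h ih =>
    rw [← ih, ← hc m, ← Category.assoc, ← Functor.map_comp]
    rfl

theorem desc_mono {Y : Cpo} (c : ∀ n, K.obj n ⟶ Y)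
    (hc : ∀ n m (h : n ≤ m), K.map (homOfLE h) ≫ c m = c n) (x : Thread K) :
    Monotone fun n => (c n).L (x.1 n) := by
  intro n m h
  change (c n).L (x.1 n) ≤ (c m).L (x.1 m)
  rw [← hc n m h, EP.comp_L, ← x.2 n m h]
  exact ScottHom.mono _ (EP.LR _ _)

theorem exists_desc {Y : Cpo} (c : ∀ n, K.obj n ⟶ Y)
    (hc : ∀ n m (h : n ≤ m), K.map (homOfLE h) ≫ c m = c n) (x : Thread K) :
    ∃ y, IsLUB (Set.range fun n => (c n).L (x.1 n)) y :=
  Y.exists_lub _ (Set.range_nonempty _)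
    (directedOn_range.2 (desc_mono c hc x).directed_le)

/-- The mediating morphism out of the colimit of a chain: the embedding takes a thread `x` to the
supremum of the `(c n).L (x n)`, and the projection takes `y` to the thread of the `(c n).R y`. -/
noncomputable def desc {Y : Cpo} (c : ∀ n, K.obj n ⟶ Y)
    (hc : ∀ n m (h : n ≤ m), K.map (homOfLE h) ≫ c m = c n) : Lim K ⟶ Y :=
  EP.mk (X := Lim K) (Y := Y)
    ⟨fun x => (exists_desc c hc x).choose, by
      intro d hd hdir a ha
      have hs := fun x : Thread K => (exists_desc c hc x).choose_spec
      refine ⟨?_, fun y hy => ?_⟩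
      · rintro _ ⟨x, hx, rfl⟩
        refine (hs x).2 ?_
        rintro _ ⟨n, rfl⟩
        exact (ScottHom.mono _ ((show x.1 ≤ a.1 from ha.1 hx) n)).trans ((hs a).1 ⟨n, rfl⟩)
      · refine (hs a).2 ?_
        rintro _ ⟨n, rfl⟩
        refine ((c n).L.2 (hd.image _) (directedOn_image
          (fun (x y : Thread K) (h : x ≤ y) => (show x.1 ≤ y.1 from h) n) hdir)
          (Thread.isLUB_apply hd hdir ha n)).2 ?_
        rintro _ ⟨_, ⟨x, hx, rfl⟩, rfl⟩
        exact ((hs x).1 ⟨n, rfl⟩).trans (hy ⟨x, hx, rfl⟩)⟩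
    ⟨fun y => ⟨fun n => (c n).R y, fun n m h => by rw [← hc n m h, EP.comp_R]⟩, by
      intro d hd hdir a ha
      refine ⟨?_, fun y hy n => ?_⟩
      · rintro _ ⟨x, hx, rfl⟩
        exact fun n => ScottHom.mono _ (ha.1 hx)
      · refine ((c n).R.2 hd hdir ha).2 ?_
        rintro _ ⟨x, hx, rfl⟩
        exact (show _ ≤ y.1 from hy ⟨x, hx, rfl⟩) n⟩
    (fun x => by
      refine Thread.ext fun n => ?_
      have hs := (exists_desc c hc x).choose_spec
      refine ((c n).R.2 (Set.range_nonempty _)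
        (directedOn_range.2 (desc_mono c hc x).directed_le) hs).unique ⟨?_, fun b hb => ?_⟩
      · rintro _ ⟨_, ⟨m, rfl⟩, rfl⟩
        refine (ScottHom.mono _ (desc_mono c hc x (le_max_right n m))).trans (le_of_eq ?_)
        change (c n).R ((c (max n m)).L (x.1 (max n m))) = x.1 n
        rw [← hc n _ (le_max_left n m), EP.comp_R, EP.RL, x.2]
      · have := hb ⟨_, ⟨n, rfl⟩, rfl⟩
        rwa [EP.RL] at this)
    (fun y => (exists_desc c hc _).choose_spec.2 (by
      rintro _ ⟨n, rfl⟩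
      exact EP.LR _ _))

end Lim

/-! ### Solutions of domain equations -/

section Fix

/-- The objects `G^n(1)`. -/
def chainObj (G : Cpo ⥤ Cpo) : ℕ → Cpo
  | 0 => Cpo.one
  | n + 1 => G.obj (chainObj G n)

noncomputable def chainMap (G : Cpo ⥤ Cpo) : ∀ n, chainObj G n ⟶ chainObj G (n + 1)
  | 0 => EP.init _
  | n + 1 => G.map (chainMap G n)

/-- The chain `1 ⟶ G(1) ⟶ G²(1) ⟶ ⋯`. -/
noncomputable def chain (G : Cpo ⥤ Cpo) : ℕ ⥤ Cpo := Functor.ofSequence (chainMap G)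

theorem chain_map_succ (G : Cpo ⥤ Cpo) (n : ℕ) :
    (chain G).map (homOfLE (Nat.le_add_right n 1)) = chainMap G n :=
  Functor.ofSequence_map_homOfLE_succ (chainMap G) n

def chainTransApp {G H : Cpo ⥤ Cpo} (α : G ⟶ H) : ∀ n, chainObj G n ⟶ chainObj H n
  | 0 => 𝟙 _
  | n + 1 => α.app _ ≫ H.map (chainTransApp α n)

theorem chainTransApp_w {G H : Cpo ⥤ Cpo} (α : G ⟶ H) : ∀ n,
    chainMap G n ≫ chainTransApp α (n + 1) = chainTransApp α n ≫ chainMap H n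
  | 0 => EP.hom_ext fun _ => rfl
  | n + 1 => by
    change G.map (chainMap G n) ≫ α.app _ ≫ H.map (chainTransApp α (n + 1)) =
      (α.app _ ≫ H.map (chainTransApp α n)) ≫ H.map (chainMap H n)
    rw [← Category.assoc, α.naturality, Category.assoc, Category.assoc, ← H.map_comp,
      chainTransApp_w α n, H.map_comp]

theorem chainTransApp_comp {G H J : Cpo ⥤ Cpo} (α : G ⟶ H) (β : H ⟶ J) (n : ℕ) :
    chainTransApp (α ≫ β) n = chainTransApp α n ≫ chainTransApp β n := by
  have key : ∀ {A B C : Cpo} (f : A ⟶ B) (g : B ⟶ C), (α ≫ β).app A ≫ J.map (f ≫ g) =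
      (α.app A ≫ H.map f) ≫ β.app B ≫ J.map g := by
    intro A B C f g
    simp
  induction n with
  | zero => rfl
  | succ n ih => exact (congrArg (fun e => (α ≫ β).app _ ≫ J.map e) ih).trans (key _ _)

noncomputable def chainTrans {G H : Cpo ⥤ Cpo} (α : G ⟶ H) : chain G ⟶ chain H :=
  NatTrans.ofSequence (F := chain G) (G := chain H) (chainTransApp α) (fun n =>
    ((congrArg (· ≫ chainTransApp α (n + 1)) (chain_map_succ G n)).trans
      (chainTransApp_w α n)).trans (congrArg (chainTransApp α n ≫ ·) (chain_map_succ H n).symm))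

variable {E : Type 1} [Category.{0} E]

/-- `Fix G` takes `B` to the colimit of the chain `1 ⟶ G_B(1) ⟶ G_B²(1) ⟶ ⋯`. -/
noncomputable def Fix (G : E ⥤ Cpo ⥤ Cpo) : E ⥤ Cpo where
  obj B := Lim (chain (G.obj B))
  map f := desc (fun n => (chainTrans (G.map f)).app n ≫ cocone _ n) (fun n m h => by
    rw [← Category.assoc, NatTrans.naturality, Category.assoc, cocone_w])
  map_id B := by
    have h : ∀ n, chainTransApp (𝟙 (G.obj B)) n = 𝟙 _ := by
      intro n
      induction n with
      | zero => rfl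
      | succ n ih => simp only [chainTransApp, ih]; simp; rfl
    refine EP.hom_ext fun y => Thread.ext fun n => ?_
    change (chainTransApp (G.map (𝟙 B)) n).R (y.1 n) = y.1 n
    rw [G.map_id, h]
    rfl
  map_comp {B B' B''} f g := by
    refine EP.hom_ext fun y => Thread.ext fun n => ?_
    change (chainTransApp (G.map (f ≫ g)) n).R (y.1 n) =
      (chainTransApp (G.map f) n).R ((chainTransApp (G.map g) n).R (y.1 n))
    rw [G.map_comp, chainTransApp_comp]
    rfl

/-- The cocone `1 ⟶ G(Fix G)`, `G(γ_n) : G^{n+1}(1) ⟶ G(Fix G)`. -/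
noncomputable def unfoldCocone (G : Cpo ⥤ Cpo) : ∀ n, (chain G).obj n ⟶ G.obj (Lim (chain G))
  | 0 => EP.init _
  | n + 1 => G.map (cocone (chain G) n)

theorem unfoldCocone_w (G : Cpo ⥤ Cpo) : ∀ n m (h : n ≤ m),
    (chain G).map (homOfLE h) ≫ unfoldCocone G m = unfoldCocone G n :=
  cocone_of_succ _ fun n => by
    refine (congrArg (· ≫ unfoldCocone G (n + 1)) (chain_map_succ G n)).trans ?_
    cases n with
    | zero => exact EP.hom_ext fun _ => rfl
    | succ n =>
      exact (G.map_comp (chainMap G n) (cocone (chain G) (n + 1))).symm.trans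
        (congrArg G.map ((congrArg (· ≫ cocone (chain G) (n + 1)) (chain_map_succ G n).symm).trans
          (cocone_w (chain G) (Nat.le_add_right n 1))))

/-- The canonical morphism `Fix G ⟶ G(Fix G)`, from the universal property of the colimit. -/
noncomputable def unfoldEP (G : Cpo ⥤ Cpo) : Lim (chain G) ⟶ G.obj (Lim (chain G)) :=
  desc (unfoldCocone G) (unfoldCocone_w G)

end Fix

/-! ### Pure types -/

/-- Type expressions with free type variables among `0, …, n - 1` (de Bruijn indices). -/
inductive Ty : ℕ → Type
  | var {n : ℕ} (i : Fin n) : Ty n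
  | unit {n : ℕ} : Ty n
  | prod {n : ℕ} (σ τ : Ty n) : Ty n
  | sum {n : ℕ} (σ τ : Ty n) : Ty n
  | arr {n : ℕ} (σ τ : Ty n) : Ty n
  | recT {n : ℕ} (τ : Ty (n + 1)) : Ty n

namespace Ty

def rename : {n m : ℕ} → (Fin n → Fin m) → Ty n → Ty m
  | _, _, r, var i => var (r i)
  | _, _, _, unit => unit
  | _, _, r, prod σ τ => prod (rename r σ) (rename r τ)
  | _, _, r, sum σ τ => sum (rename r σ) (rename r τ)
  | _, _, r, arr σ τ => arr (rename r σ) (rename r τ)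
  | _, _, r, recT τ => recT (rename (Fin.cons 0 fun i => (r i).succ) τ)

def subst : {n m : ℕ} → (Fin n → Ty m) → Ty n → Ty m
  | _, _, s, var i => s i
  | _, _, _, unit => unit
  | _, _, s, prod σ τ => prod (subst s σ) (subst s τ)
  | _, _, s, sum σ τ => sum (subst s σ) (subst s τ)
  | _, _, s, arr σ τ => arr (subst s σ) (subst s τ)
  | _, _, s, recT τ => recT (subst (Fin.cons (var 0) fun i => rename Fin.succ (s i)) τ)

/-- `τ[recT τ / 0]`. -/
def unroll {n : ℕ} (τ : Ty (n + 1)) : Ty n := subst (Fin.cons (recT τ) var) τ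

/-- The interpretation of a type expression as a functor, given functors for its free variables;
`recT` is interpreted by `Fix`. -/
noncomputable def interp : {n : ℕ} → Ty n → {E : Type 1} → [Category.{0} E] →
    (Fin n → (E ⥤ Cpo)) → (E ⥤ Cpo)
  | _, var i, _, _, ρ => ρ i
  | _, unit, E, _, _ => (Functor.const E).obj Cpo.two
  | _, prod σ τ, _, _, ρ => prodF (interp σ ρ) (interp τ ρ)
  | _, sum σ τ, _, _, ρ => sumF (interp σ ρ) (interp τ ρ)
  | _, arr σ τ, _, _, ρ => fnF (interp σ ρ) (interp τ ρ)
  | _, recT τ, E, _, ρ => Fix (Functor.curry.obj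
      (interp τ (E := E × Cpo) (Fin.cons (CategoryTheory.Prod.snd E Cpo) fun i => CategoryTheory.Prod.fst E Cpo ⋙ ρ i)))

theorem curry_prod {E E' : Type 1} [Category.{0} E] [Category.{0} E'] (H : E ⥤ E')
    (F : E' × Cpo ⥤ Cpo) :
    Functor.curry.obj (H.prod (𝟭 Cpo) ⋙ F) = H ⋙ Functor.curry.obj F := by
  refine CategoryTheory.Functor.ext (fun B => ?_) (fun B B' f => ?_)
  · refine CategoryTheory.Functor.ext (fun X => rfl) (fun X Y g => ?_)
    simp
  · ext X : 2
    simp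

theorem interp_comp : ∀ {n : ℕ} (τ : Ty n) {E E' : Type 1} [Category.{0} E] [Category.{0} E']
    (H : E ⥤ E') (ρ : Fin n → (E' ⥤ Cpo)), interp τ (fun i => H ⋙ ρ i) = H ⋙ interp τ ρ
  | _, var _, _, _, _, _, _, _ => rfl
  | _, unit, _, _, _, _, _, _ => rfl
  | _, prod σ τ, _, _, _, _, H, ρ => by
    simp only [interp, interp_comp σ H ρ, interp_comp τ H ρ]; rfl
  | _, sum σ τ, _, _, _, _, H, ρ => by
    simp only [interp, interp_comp σ H ρ, interp_comp τ H ρ]; rfl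
  | _, arr σ τ, _, _, _, _, H, ρ => by
    simp only [interp, interp_comp σ H ρ, interp_comp τ H ρ]; rfl
  | n, recT τ, E, E', _, _, H, ρ => by
    have h := interp_comp τ (H.prod (𝟭 Cpo))
      (Fin.cons (CategoryTheory.Prod.snd E' Cpo) fun i => CategoryTheory.Prod.fst E' Cpo ⋙ ρ i)
    have h' : (Fin.cons (CategoryTheory.Prod.snd E Cpo) fun i => CategoryTheory.Prod.fst E Cpo ⋙ H ⋙ ρ i :
        Fin (n + 1) → (E × Cpo ⥤ Cpo)) = fun i => H.prod (𝟭 Cpo) ⋙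
          (Fin.cons (CategoryTheory.Prod.snd E' Cpo) fun i => CategoryTheory.Prod.fst E' Cpo ⋙ ρ i :
            Fin (n + 1) → (E' × Cpo ⥤ Cpo)) i := by
      funext i
      refine Fin.cases ?_ (fun j => ?_) i <;> rfl
    simp only [interp]
    rw [h', h, curry_prod]
    rfl

theorem interp_rename : ∀ {n m : ℕ} (τ : Ty n) (r : Fin n → Fin m) {E : Type 1} [Category.{0} E]
    (ρ : Fin m → (E ⥤ Cpo)), interp (rename r τ) ρ = interp τ (fun i => ρ (r i))
  | _, _, var _, _, _, _, _ => rfl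
  | _, _, unit, _, _, _, _ => rfl
  | _, _, prod σ τ, r, _, _, ρ => by
    simp only [interp, rename, interp_rename σ r ρ, interp_rename τ r ρ]
  | _, _, sum σ τ, r, _, _, ρ => by
    simp only [interp, rename, interp_rename σ r ρ, interp_rename τ r ρ]
  | _, _, arr σ τ, r, _, _, ρ => by
    simp only [interp, rename, interp_rename σ r ρ, interp_rename τ r ρ]
  | n, _, recT τ, r, E, _, ρ => by
    simp only [interp, rename]
    rw [interp_rename τ]
    congr 3
    funext i
    refine Fin.cases ?_ (fun j => ?_) i <;> rfl

theorem interp_subst : ∀ {n m : ℕ} (τ : Ty n) (s : Fin n → Ty m) {E : Type 1} [Category.{0} E]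
    (ρ : Fin m → (E ⥤ Cpo)), interp (subst s τ) ρ = interp τ (fun i => interp (s i) ρ)
  | _, _, var _, _, _, _, _ => rfl
  | _, _, unit, _, _, _, _ => rfl
  | _, _, prod σ τ, s, _, _, ρ => by
    simp only [interp, subst, interp_subst σ s ρ, interp_subst τ s ρ]
  | _, _, sum σ τ, s, _, _, ρ => by
    simp only [interp, subst, interp_subst σ s ρ, interp_subst τ s ρ]
  | _, _, arr σ τ, s, _, _, ρ => by
    simp only [interp, subst, interp_subst σ s ρ, interp_subst τ s ρ]
  | n, _, recT τ, s, E, _, ρ => by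
    simp only [interp, subst]
    rw [interp_subst τ]
    congr 3
    funext i
    refine Fin.cases rfl (fun j => ?_) i
    exact (interp_rename (s j) Fin.succ _).trans (interp_comp (s j) (CategoryTheory.Prod.fst E Cpo) ρ)

/-- The category `(Cpo^ep)^0` of parameters of closed types. -/
abbrev NoParams : Type 1 := Fin 0 → Cpo

/-- The functor `X ↦ ⟦τ⟧(X)` of a type expression with one free variable. -/
noncomputable def bodyFunctor (τ : Ty 1) : Cpo ⥤ Cpo :=
  (Functor.curry.obj (interp τ (E := NoParams × Cpo)
    (Fin.cons (CategoryTheory.Prod.snd _ Cpo) fun i => CategoryTheory.Prod.fst _ Cpo ⋙ Fin.elim0 i))).obj (Fin.elim0 : NoParams)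

/-- The interpretation `⟦τ⟧` of a closed type. -/
noncomputable def dom (τ : Ty 0) : Cpo :=
  (interp τ (E := NoParams) Fin.elim0).obj (Fin.elim0 : NoParams)

theorem bodyFunctor_rec (τ : Ty 1) : (bodyFunctor τ).obj (dom (recT τ)) = dom (unroll τ) := by
  have h := interp_comp τ (E := NoParams)
    (Functor.prod' (𝟭 _) (interp (recT τ) (E := NoParams) Fin.elim0))
    (Fin.cons (CategoryTheory.Prod.snd _ Cpo) fun i => CategoryTheory.Prod.fst _ Cpo ⋙ Fin.elim0 i)
  have h2 := interp_subst τ (Fin.cons (recT τ) var) (E := NoParams) Fin.elim0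
  have h3 : (fun i => interp ((Fin.cons (recT τ) var : Fin 1 → Ty 0) i) (E := NoParams)
      Fin.elim0) = fun i => (Functor.prod' (𝟭 _)
        (interp (recT τ) (E := NoParams) Fin.elim0)) ⋙
        (Fin.cons (CategoryTheory.Prod.snd (NoParams) Cpo) fun i => CategoryTheory.Prod.fst _ Cpo ⋙ Fin.elim0 i :
          Fin 1 → (NoParams × Cpo ⥤ Cpo)) i := by
    funext i
    refine Fin.cases rfl (fun j => j.elim0) i
  rw [h3, h] at h2
  exact (congrArg (fun F => F.obj (Fin.elim0 : NoParams)) h2).symm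

/-- The canonical isomorphism `⟦unfold⟧ : ⟦recT τ⟧ → ⟦τ[recT τ]⟧`. -/
noncomputable def unfold (τ : Ty 1) : ScottHom (dom (recT τ)) (dom (unroll τ)) :=
  EP.L (X := dom (recT τ)) (unfoldEP (bodyFunctor τ) ≫ eqToHom (bodyFunctor_rec τ))

end Ty

/-! ### Formulae -/

/-- Iteration terms, with iteration variables as de Bruijn indices. -/
inductive ITerm : Type
  | var (k : ℕ) : ITerm
  | zero : ITerm
  | succ (t : ITerm) : ITerm

namespace ITerm

def subst (s : ℕ → ITerm) : ITerm → ITerm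
  | var k => s k
  | zero => zero
  | succ t => succ (subst s t)

def shift (t : ITerm) : ITerm := t.subst fun k => var (k + 1)

/-- `k` occurs in the term. -/
def Free (k : ℕ) : ITerm → Prop
  | var l => k = l
  | zero => False
  | succ t => t.Free k

def eval (ν : ℕ → ℕ) : ITerm → ℕ
  | var k => ν k
  | zero => 0
  | succ t => t.eval ν + 1

/-- The substitution replacing the variable `0` by `t` and lowering the other variables. -/
def inst (t : ITerm) : ℕ → ITerm
  | 0 => t
  | k + 1 => var k

/-- A substitution carried under a binder. -/
def lift (s : ℕ → ITerm) : ℕ → ITerm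
  | 0 => var 0
  | k + 1 => (s k).shift

end ITerm

/-- Fixpoint contexts: the list of the types of the fixpoint variables. -/
abbrev Ctx : Type := List (Ty 0)

/-- `Var Γ τ` is the type of fixpoint variables of type `τ` in `Γ`. -/
inductive Var : Ctx → Ty 0 → Type
  | here {Γ : Ctx} {τ : Ty 0} : Var (τ :: Γ) τ
  | there {Γ : Ctx} {σ τ : Ty 0} (x : Var Γ τ) : Var (σ :: Γ) τ

/-- The modalities; a `Modality σ τ` takes formulae of type `σ` to formulae of type `τ`. -/
inductive Modality : Ty 0 → Ty 0 → Type
  | pi1 {σ τ : Ty 0} : Modality σ (σ.prod τ)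
  | pi2 {σ τ : Ty 0} : Modality τ (σ.prod τ)
  | inj1 {σ τ : Ty 0} : Modality σ (σ.sum τ)
  | inj2 {σ τ : Ty 0} : Modality τ (σ.sum τ)
  | fold {τ : Ty 1} : Modality τ.unroll τ.recT

/-- The modality is neither `inj1` nor `inj2`. -/
def Modality.NotInj : {σ τ : Ty 0} → Modality σ τ → Prop
  | _, _, pi1 => True
  | _, _, pi2 => True
  | _, _, inj1 => False
  | _, _, inj2 => False
  | _, _, fold => True

/-- Formulae of a given type in a fixpoint context, before polarities are taken into account.
`mu t φ` and `nu t φ` bind a fixpoint variable (the head of the context), `ex φ` and `all φ` bind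
the iteration variable `0`. Realizability implications have no free fixpoint variables. -/
inductive Form : Ctx → Ty 0 → Type
  | tru {Γ : Ctx} {τ : Ty 0} : Form Γ τ
  | fls {Γ : Ctx} {τ : Ty 0} : Form Γ τ
  | and {Γ : Ctx} {τ : Ty 0} (φ ψ : Form Γ τ) : Form Γ τ
  | or {Γ : Ctx} {τ : Ty 0} (φ ψ : Form Γ τ) : Form Γ τ
  | unit {Γ : Ctx} : Form Γ Ty.unit
  | mod {Γ : Ctx} {σ τ : Ty 0} (m : Modality σ τ) (φ : Form Γ σ) : Form Γ τ
  | var {Γ : Ctx} {τ : Ty 0} (x : Var Γ τ) : Form Γ τ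
  | mu {Γ : Ctx} {τ : Ty 0} (t : ITerm) (φ : Form (τ :: Γ) τ) : Form Γ τ
  | nu {Γ : Ctx} {τ : Ty 0} (t : ITerm) (φ : Form (τ :: Γ) τ) : Form Γ τ
  | ex {Γ : Ctx} {τ : Ty 0} (φ : Form Γ τ) : Form Γ τ
  | all {Γ : Ctx} {τ : Ty 0} (φ : Form Γ τ) : Form Γ τ
  | imp {Γ : Ctx} {σ τ : Ty 0} (ψ : Form [] σ) (φ : Form [] τ) : Form Γ (σ.arr τ)

namespace Form

/-- The iteration variable `k` is free in the formula. -/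
def Free : {Γ : Ctx} → {τ : Ty 0} → ℕ → Form Γ τ → Prop
  | _, _, _, tru => False
  | _, _, _, fls => False
  | _, _, k, and φ ψ => Free k φ ∨ Free k ψ
  | _, _, k, or φ ψ => Free k φ ∨ Free k ψ
  | _, _, _, unit => False
  | _, _, k, mod _ φ => Free k φ
  | _, _, _, var _ => False
  | _, _, k, mu t φ => t.Free k ∨ Free k φ
  | _, _, k, nu t φ => t.Free k ∨ Free k φ
  | _, _, k, ex φ => Free (k + 1) φ
  | _, _, k, all φ => Free (k + 1) φ
  | _, _, k, imp ψ φ => Free k ψ ∨ Free k φ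

/-- Substitution of iteration terms for iteration variables. -/
def isubst : {Γ : Ctx} → {τ : Ty 0} → (ℕ → ITerm) → Form Γ τ → Form Γ τ
  | _, _, _, tru => tru
  | _, _, _, fls => fls
  | _, _, s, and φ ψ => and (isubst s φ) (isubst s ψ)
  | _, _, s, or φ ψ => or (isubst s φ) (isubst s ψ)
  | _, _, _, unit => unit
  | _, _, s, mod m φ => mod m (isubst s φ)
  | _, _, _, var x => var x
  | _, _, s, mu t φ => mu (t.subst s) (isubst s φ)
  | _, _, s, nu t φ => nu (t.subst s) (isubst s φ)
  | _, _, s, ex φ => ex (isubst (ITerm.lift s) φ)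
  | _, _, s, all φ => all (isubst (ITerm.lift s) φ)
  | _, _, s, imp ψ φ => imp (isubst s ψ) (isubst s φ)

/-- Weakening by a new iteration variable `0`; a formula in which a bound iteration variable does
not occur is one of the form `φ.shift`. -/
def shift {Γ : Ctx} {τ : Ty 0} (φ : Form Γ τ) : Form Γ τ := φ.isubst fun k => ITerm.var (k + 1)

/-- `φ[t / k]`, for `k` the iteration variable `0` bound by a quantifier on `φ`. -/
def inst {Γ : Ctx} {τ : Ty 0} (φ : Form Γ τ) (t : ITerm) : Form Γ τ := φ.isubst t.inst

/-- A renaming of fixpoint variables carried under a binder. -/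
def liftRen {Γ Δ : Ctx} (r : ∀ τ, Var Γ τ → Var Δ τ) (σ : Ty 0) :
    ∀ τ, Var (σ :: Γ) τ → Var (σ :: Δ) τ
  | _, Var.here => Var.here
  | _, Var.there x => Var.there (r _ x)

/-- Renaming of fixpoint variables. -/
def frename : {Γ Δ : Ctx} → {τ : Ty 0} → (∀ σ, Var Γ σ → Var Δ σ) → Form Γ τ → Form Δ τ
  | _, _, _, _, tru => tru
  | _, _, _, _, fls => fls
  | _, _, _, r, and φ ψ => and (frename r φ) (frename r ψ)
  | _, _, _, r, or φ ψ => or (frename r φ) (frename r ψ)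
  | _, _, _, _, unit => unit
  | _, _, _, r, mod m φ => mod m (frename r φ)
  | _, _, _, r, var x => var (r _ x)
  | _, _, _, r, mu t φ => mu t (frename (liftRen r _) φ)
  | _, _, _, r, nu t φ => nu t (frename (liftRen r _) φ)
  | _, _, _, r, ex φ => ex (frename r φ)
  | _, _, _, r, all φ => all (frename r φ)
  | _, _, _, _, imp ψ φ => imp ψ φ

/-- A substitution for fixpoint variables carried under a fixpoint binder. -/
def liftSub {Γ Δ : Ctx} (s : ∀ τ, Var Γ τ → Form Δ τ) (σ : Ty 0) :
    ∀ τ, Var (σ :: Γ) τ → Form (σ :: Δ) τ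
  | _, Var.here => var Var.here
  | _, Var.there x => (s _ x).frename fun _ => Var.there

/-- (Capture-avoiding) substitution of formulae for fixpoint variables. -/
def fsubst : {Γ Δ : Ctx} → {τ : Ty 0} → (∀ σ, Var Γ σ → Form Δ σ) → Form Γ τ → Form Δ τ
  | _, _, _, _, tru => tru
  | _, _, _, _, fls => fls
  | _, _, _, s, and φ ψ => and (fsubst s φ) (fsubst s ψ)
  | _, _, _, s, or φ ψ => or (fsubst s φ) (fsubst s ψ)
  | _, _, _, _, unit => unit
  | _, _, _, s, mod m φ => mod m (fsubst s φ)
  | _, _, _, s, var x => s _ x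
  | _, _, _, s, mu t φ => mu t (fsubst (liftSub s _) φ)
  | _, _, _, s, nu t φ => nu t (fsubst (liftSub s _) φ)
  | _, _, _, s, ex φ => ex (fsubst (fun σ x => (s σ x).shift) φ)
  | _, _, _, s, all φ => all (fsubst (fun σ x => (s σ x).shift) φ)
  | _, _, _, _, imp ψ φ => imp ψ φ

/-- The substitution replacing the head fixpoint variable by `ψ`. -/
def instSub {Γ : Ctx} {σ : Ty 0} (ψ : Form Γ σ) : ∀ τ, Var (σ :: Γ) τ → Form Γ τ
  | _, Var.here => ψ
  | _, Var.there x => var x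

/-- `φ[ψ / X]`, for `X` the head fixpoint variable of the context of `φ`. -/
def finst {Γ : Ctx} {σ τ : Ty 0} (φ : Form (σ :: Γ) τ) (ψ : Form Γ σ) : Form Γ τ :=
  φ.fsubst (instSub ψ)

/-- Finite conjunctions. -/
def bigAnd {Γ : Ctx} {τ : Ty 0} : List (Form Γ τ) → Form Γ τ
  | [] => tru
  | φ :: l => and φ (bigAnd l)

end Form

mutual

/-- `Pos k φ`: the iteration variable `k` occurs only positively in `φ`. -/
inductive Pos : {Γ : Ctx} → {τ : Ty 0} → ℕ → Form Γ τ → Prop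
  | notFree {Γ : Ctx} {τ : Ty 0} {k : ℕ} {φ : Form Γ τ} : ¬ φ.Free k → Pos k φ
  | and {Γ : Ctx} {τ : Ty 0} {k : ℕ} {φ ψ : Form Γ τ} : Pos k φ → Pos k ψ → Pos k (φ.and ψ)
  | or {Γ : Ctx} {τ : Ty 0} {k : ℕ} {φ ψ : Form Γ τ} : Pos k φ → Pos k ψ → Pos k (φ.or ψ)
  | mod {Γ : Ctx} {σ τ : Ty 0} {k : ℕ} {m : Modality σ τ} {φ : Form Γ σ} :
      Pos k φ → Pos k (φ.mod m)
  | imp {Γ : Ctx} {σ τ : Ty 0} {k : ℕ} {ψ : Form [] σ} {φ : Form [] τ} :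
      Neg k ψ → Pos k φ → Pos k (Form.imp (Γ := Γ) ψ φ)
  | ex {Γ : Ctx} {τ : Ty 0} {k : ℕ} {φ : Form Γ τ} : Pos (k + 1) φ → Pos k φ.ex
  | mu {Γ : Ctx} {τ : Ty 0} {k : ℕ} {t : ITerm} {φ : Form (τ :: Γ) τ} :
      Pos k φ → Pos k (Form.mu t φ)
  | nu {Γ : Ctx} {τ : Ty 0} {k : ℕ} {t : ITerm} {φ : Form (τ :: Γ) τ} :
      Pos k φ → ¬ t.Free k → Pos k (Form.nu t φ)

/-- `Neg k φ`: the iteration variable `k` occurs only negatively in `φ`. -/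
inductive Neg : {Γ : Ctx} → {τ : Ty 0} → ℕ → Form Γ τ → Prop
  | notFree {Γ : Ctx} {τ : Ty 0} {k : ℕ} {φ : Form Γ τ} : ¬ φ.Free k → Neg k φ
  | and {Γ : Ctx} {τ : Ty 0} {k : ℕ} {φ ψ : Form Γ τ} : Neg k φ → Neg k ψ → Neg k (φ.and ψ)
  | or {Γ : Ctx} {τ : Ty 0} {k : ℕ} {φ ψ : Form Γ τ} : Neg k φ → Neg k ψ → Neg k (φ.or ψ)
  | mod {Γ : Ctx} {σ τ : Ty 0} {k : ℕ} {m : Modality σ τ} {φ : Form Γ σ} :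
      Neg k φ → Neg k (φ.mod m)
  | imp {Γ : Ctx} {σ τ : Ty 0} {k : ℕ} {ψ : Form [] σ} {φ : Form [] τ} :
      Pos k ψ → Neg k φ → Neg k (Form.imp (Γ := Γ) ψ φ)
  | all {Γ : Ctx} {τ : Ty 0} {k : ℕ} {φ : Form Γ τ} : Neg (k + 1) φ → Neg k φ.all
  | nu {Γ : Ctx} {τ : Ty 0} {k : ℕ} {t : ITerm} {φ : Form (τ :: Γ) τ} :
      Neg k φ → Neg k (Form.nu t φ)
  | mu {Γ : Ctx} {τ : Ty 0} {k : ℕ} {t : ITerm} {φ : Form (τ :: Γ) τ} :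
      Neg k φ → ¬ t.Free k → Neg k (Form.mu t φ)

end

/-- Polarities: neutral, positive, negative. -/
inductive Sign : Type
  | neutral
  | pos
  | neg

def Sign.opp : Sign → Sign
  | neutral => neutral
  | pos => neg
  | neg => pos

/-- `Lang s φ`: the formula `φ` belongs to the language `L^s`. -/
inductive Lang : {Γ : Ctx} → {τ : Ty 0} → Sign → Form Γ τ → Prop
  | tru {Γ : Ctx} {τ : Ty 0} {s : Sign} : Lang s (Form.tru (Γ := Γ) (τ := τ))
  | fls {Γ : Ctx} {τ : Ty 0} {s : Sign} : Lang s (Form.fls (Γ := Γ) (τ := τ))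
  | and {Γ : Ctx} {τ : Ty 0} {s : Sign} {φ ψ : Form Γ τ} :
      Lang s φ → Lang s ψ → Lang s (φ.and ψ)
  | or {Γ : Ctx} {τ : Ty 0} {s : Sign} {φ ψ : Form Γ τ} :
      Lang s φ → Lang s ψ → Lang s (φ.or ψ)
  | unit {Γ : Ctx} {s : Sign} : Lang s (Form.unit (Γ := Γ))
  | mod {Γ : Ctx} {σ τ : Ty 0} {s : Sign} {m : Modality σ τ} {φ : Form Γ σ} :
      Lang s φ → Lang s (φ.mod m)
  | var {Γ : Ctx} {τ : Ty 0} {s : Sign} {x : Var Γ τ} : Lang s (Form.var x)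
  | mu {Γ : Ctx} {τ : Ty 0} {s : Sign} {t : ITerm} {φ : Form (τ :: Γ) τ} :
      Lang s φ → Lang s (Form.mu t φ)
  | nu {Γ : Ctx} {τ : Ty 0} {s : Sign} {t : ITerm} {φ : Form (τ :: Γ) τ} :
      Lang s φ → Lang s (Form.nu t φ)
  | ex {Γ : Ctx} {τ : Ty 0} {φ : Form Γ τ} : Lang Sign.pos φ → Pos 0 φ → Lang Sign.pos φ.ex
  | all {Γ : Ctx} {τ : Ty 0} {φ : Form Γ τ} : Lang Sign.neg φ → Neg 0 φ → Lang Sign.neg φ.all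
  | imp {Γ : Ctx} {σ τ : Ty 0} {s : Sign} {ψ : Form [] σ} {φ : Form [] τ} :
      Lang s.opp ψ → Lang s φ → Lang s (Form.imp (Γ := Γ) ψ φ)

/-- `LangAnd φ`: the formula `φ` belongs to the language `L^∧` (no disjunctions, fixpoint
variables, bounded iterations or quantifiers). -/
inductive LangAnd : {τ : Ty 0} → Form [] τ → Prop
  | tru {τ : Ty 0} : LangAnd (Form.tru (τ := τ))
  | fls {τ : Ty 0} : LangAnd (Form.fls (τ := τ))
  | and {τ : Ty 0} {φ ψ : Form [] τ} : LangAnd φ → LangAnd ψ → LangAnd (φ.and ψ)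
  | unit : LangAnd Form.unit
  | mod {σ τ : Ty 0} {m : Modality σ τ} {φ : Form [] σ} : LangAnd φ → LangAnd (φ.mod m)
  | imp {σ τ : Ty 0} {ψ : Form [] σ} {φ : Form [] τ} :
      LangAnd ψ → LangAnd φ → LangAnd (Form.imp ψ φ)

/-! ### Semantics of formulae -/

/-- Semantic modalities. -/
def Modality.sem : {σ τ : Ty 0} → Modality σ τ → Set σ.dom → Set τ.dom
  | _, _, pi1 (σ := σ) (τ := τ), S => {x : σ.dom × τ.dom | x.1 ∈ S}
  | _, _, pi2 (σ := σ) (τ := τ), S => {x : σ.dom × τ.dom | x.2 ∈ S}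
  | _, _, inj1 (σ := σ) (τ := τ), S => (inl : σ.dom → WithBot (σ.dom ⊕ τ.dom)) '' S
  | _, _, inj2 (σ := σ) (τ := τ), S => (inr : τ.dom → WithBot (σ.dom ⊕ τ.dom)) '' S
  | _, _, fold (τ := τ), S => {x | Ty.unfold τ x ∈ S}

/-- Valuations of the fixpoint variables of a context. -/
abbrev FVal (Γ : Ctx) : Type := ∀ τ : Ty 0, Var Γ τ → Set τ.dom

/-- `ρ[S / X]`, for a new head variable `X`. -/
def FVal.cons {Γ : Ctx} {σ : Ty 0} (S : Set σ.dom) (ρ : FVal Γ) : FVal (σ :: Γ)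
  | _, Var.here => S
  | _, Var.there x => ρ _ x

def FVal.nil : FVal [] := fun _ x => nomatch x

/-- `ν[n / k]`, for a new iteration variable `k = 0`. -/
def iCons (n : ℕ) (ν : ℕ → ℕ) : ℕ → ℕ
  | 0 => n
  | k + 1 => ν k

/-- The interpretation of formulae, under a valuation `ρ` of fixpoint variables and a valuation `ν`
of iteration variables. The bounded iterations `mu t φ` and `nu t φ` are the iterates, `⟦t⟧` times,
of `S ↦ ⟦φ⟧[S / X]`, from the empty set and the whole space respectively. -/
def Form.sem : {Γ : Ctx} → {τ : Ty 0} → Form Γ τ → FVal Γ → (ℕ → ℕ) → Set τ.dom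
  | _, _, tru, _, _ => Set.univ
  | _, _, fls, _, _ => ∅
  | _, _, and φ ψ, ρ, ν => φ.sem ρ ν ∩ ψ.sem ρ ν
  | _, _, or φ ψ, ρ, ν => φ.sem ρ ν ∪ ψ.sem ρ ν
  | _, _, unit, _, _ => ({true} : Set Bool)
  | _, _, mod m φ, ρ, ν => m.sem (φ.sem ρ ν)
  | _, _, var x, ρ, _ => ρ _ x
  | _, _, mu t φ, ρ, ν => (fun S => φ.sem (FVal.cons S ρ) ν)^[t.eval ν] ∅
  | _, _, nu t φ, ρ, ν => (fun S => φ.sem (FVal.cons S ρ) ν)^[t.eval ν] Set.univ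
  | _, _, ex φ, ρ, ν => ⋃ n : ℕ, φ.sem ρ (iCons n ν)
  | _, _, all φ, ρ, ν => ⋂ n : ℕ, φ.sem ρ (iCons n ν)
  | _, _, imp (σ := σ) (τ := τ) ψ φ, _, ν =>
    {f : ScottHom σ.dom τ.dom | ∀ x ∈ ψ.sem FVal.nil ν, f x ∈ φ.sem FVal.nil ν}

/-! ### Deduction -/

/-- `ψ ⊢ φ` is a sequent: both formulae belong to `L^s` for some polarity `s`. -/
def IsSequent {Γ : Ctx} {τ : Ty 0} (ψ φ : Form Γ τ) : Prop := ∃ s, Lang s ψ ∧ Lang s φ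

mutual

/-- `Ded ψ φ`: the sequent `ψ ⊢ φ` is derivable. All formulae are in the same fixpoint context and
of the same type, and the conclusion of each rule is required to be a sequent. -/
inductive Ded : {Γ : Ctx} → {τ : Ty 0} → Form Γ τ → Form Γ τ → Prop
  -- propositional rules
  | refl {Γ : Ctx} {τ : Ty 0} {φ : Form Γ τ} : IsSequent φ φ → Ded φ φ
  | cut {Γ : Ctx} {τ : Ty 0} {ψ θ φ : Form Γ τ} : IsSequent ψ φ → Ded ψ θ → Ded θ φ → Ded ψ φ
  | distr {Γ : Ctx} {τ : Ty 0} {ψ φ θ : Form Γ τ} :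
      IsSequent (ψ.and (φ.or θ)) ((ψ.and φ).or (ψ.and θ)) →
      Ded (ψ.and (φ.or θ)) ((ψ.and φ).or (ψ.and θ))
  | andR {Γ : Ctx} {τ : Ty 0} {ψ φ₁ φ₂ : Form Γ τ} : IsSequent ψ (φ₁.and φ₂) →
      Ded ψ φ₁ → Ded ψ φ₂ → Ded ψ (φ₁.and φ₂)
  | andL₁ {Γ : Ctx} {τ : Ty 0} {ψ₁ ψ₂ φ : Form Γ τ} : IsSequent (ψ₁.and ψ₂) φ →
      Ded ψ₁ φ → Ded (ψ₁.and ψ₂) φ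
  | andL₂ {Γ : Ctx} {τ : Ty 0} {ψ₁ ψ₂ φ : Form Γ τ} : IsSequent (ψ₁.and ψ₂) φ →
      Ded ψ₂ φ → Ded (ψ₁.and ψ₂) φ
  | truR {Γ : Ctx} {τ : Ty 0} {ψ : Form Γ τ} : IsSequent ψ .tru → Ded ψ .tru
  | orR₁ {Γ : Ctx} {τ : Ty 0} {ψ φ₁ φ₂ : Form Γ τ} : IsSequent ψ (φ₁.or φ₂) →
      Ded ψ φ₁ → Ded ψ (φ₁.or φ₂)
  | orR₂ {Γ : Ctx} {τ : Ty 0} {ψ φ₁ φ₂ : Form Γ τ} : IsSequent ψ (φ₁.or φ₂) →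
      Ded ψ φ₂ → Ded ψ (φ₁.or φ₂)
  | orL {Γ : Ctx} {τ : Ty 0} {ψ₁ ψ₂ φ : Form Γ τ} : IsSequent (ψ₁.or ψ₂) φ →
      Ded ψ₁ φ → Ded ψ₂ φ → Ded (ψ₁.or ψ₂) φ
  | flsL {Γ : Ctx} {τ : Ty 0} {φ : Form Γ τ} : IsSequent .fls φ → Ded .fls φ
  -- modal rules
  | injDisj {Γ : Ctx} {σ τ : Ty 0} {φ : Form Γ σ} {ψ : Form Γ τ} :
      IsSequent ((φ.mod (.inj1 (σ := σ) (τ := τ))).and (ψ.mod .inj2)) .fls →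
      Ded ((φ.mod (.inj1 (σ := σ) (τ := τ))).and (ψ.mod .inj2)) .fls
  | modMono {Γ : Ctx} {σ τ : Ty 0} {m : Modality σ τ} {ψ φ : Form Γ σ} :
      IsSequent (ψ.mod m) (φ.mod m) → Ded ψ φ → Ded (ψ.mod m) (φ.mod m)
  | impMono {Γ : Ctx} {σ τ : Ty 0} {ψ ψ' : Form [] σ} {φ φ' : Form [] τ} :
      IsSequent (Form.imp (Γ := Γ) ψ φ) (Form.imp ψ' φ') → Ded ψ' ψ → Ded φ φ' →
      Ded (Form.imp (Γ := Γ) ψ φ) (Form.imp ψ' φ')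
  | modAnd {Γ : Ctx} {σ τ : Ty 0} {m : Modality σ τ} {φ₁ φ₂ : Form Γ σ} :
      IsSequent ((φ₁.mod m).and (φ₂.mod m)) ((φ₁.and φ₂).mod m) →
      Ded ((φ₁.mod m).and (φ₂.mod m)) ((φ₁.and φ₂).mod m)
  | modTru {Γ : Ctx} {σ τ : Ty 0} {m : Modality σ τ} : m.NotInj →
      IsSequent (Γ := Γ) .tru (Form.tru.mod m) → Ded (Γ := Γ) .tru (Form.tru.mod m)
  | modAll {Γ : Ctx} {σ τ : Ty 0} {m : Modality σ τ} {φ : Form Γ σ} :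
      IsSequent (φ.mod m).all (φ.all.mod m) → Ded (φ.mod m).all (φ.all.mod m)
  | modOr {Γ : Ctx} {σ τ : Ty 0} {m : Modality σ τ} {φ₁ φ₂ : Form Γ σ} :
      IsSequent ((φ₁.or φ₂).mod m) ((φ₁.mod m).or (φ₂.mod m)) →
      Ded ((φ₁.or φ₂).mod m) ((φ₁.mod m).or (φ₂.mod m))
  | modFls {Γ : Ctx} {σ τ : Ty 0} {m : Modality σ τ} :
      IsSequent (Γ := Γ) (Form.fls.mod m) .fls → Ded (Γ := Γ) (Form.fls.mod m) .fls
  | modEx {Γ : Ctx} {σ τ : Ty 0} {m : Modality σ τ} {φ : Form Γ σ} :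
      IsSequent (φ.ex.mod m) (φ.mod m).ex → Ded (φ.ex.mod m) (φ.mod m).ex
  -- quantifier rules
  | exR {Γ : Ctx} {τ : Ty 0} {ψ φ : Form Γ τ} {t : ITerm} : IsSequent ψ φ.ex →
      Ded ψ (φ.inst t) → Ded ψ φ.ex
  | exL {Γ : Ctx} {τ : Ty 0} {θ φ ψ : Form Γ τ} : IsSequent (θ.and φ.ex) ψ →
      Ded (θ.shift.and φ) ψ.shift → Ded (θ.and φ.ex) ψ
  | exM {Γ : Ctx} {τ : Ty 0} {φ : Form Γ τ} :
      IsSequent φ.ex.ex (φ.inst (.var 0)).ex → Ded φ.ex.ex (φ.inst (.var 0)).ex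
  | allL {Γ : Ctx} {τ : Ty 0} {φ ψ : Form Γ τ} {t : ITerm} : IsSequent φ.all ψ →
      Ded (φ.inst t) ψ → Ded φ.all ψ
  | allR {Γ : Ctx} {τ : Ty 0} {ψ φ θ : Form Γ τ} : IsSequent ψ (φ.all.or θ) →
      Ded ψ.shift (φ.or θ.shift) → Ded ψ (φ.all.or θ)
  | allM {Γ : Ctx} {τ : Ty 0} {φ : Form Γ τ} :
      IsSequent (φ.inst (.var 0)).all φ.all.all → Ded (φ.inst (.var 0)).all φ.all.all
  | muEx {Γ : Ctx} {τ : Ty 0} {t : ITerm} {φ : Form (τ :: Γ) τ} :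
      IsSequent (Form.mu t φ.ex) (Form.mu t.shift φ).ex →
      Ded (Form.mu t φ.ex) (Form.mu t.shift φ).ex
  | nuEx {Γ : Ctx} {τ : Ty 0} {t : ITerm} {φ : Form (τ :: Γ) τ} :
      IsSequent (Form.nu t φ.ex) (Form.nu t.shift φ).ex →
      Ded (Form.nu t φ.ex) (Form.nu t.shift φ).ex
  | allMu {Γ : Ctx} {τ : Ty 0} {t : ITerm} {φ : Form (τ :: Γ) τ} :
      IsSequent (Form.mu t.shift φ).all (Form.mu t φ.all) →
      Ded (Form.mu t.shift φ).all (Form.mu t φ.all)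
  | allNu {Γ : Ctx} {τ : Ty 0} {t : ITerm} {φ : Form (τ :: Γ) τ} :
      IsSequent (Form.nu t.shift φ).all (Form.nu t φ.all) →
      Ded (Form.nu t.shift φ).all (Form.nu t φ.all)
  -- bounded iteration
  | muZero {Γ : Ctx} {τ : Ty 0} {φ : Form (τ :: Γ) τ} :
      IsSequent (Form.mu .zero φ) .fls → Ded (Form.mu .zero φ) .fls
  | muSuccL {Γ : Ctx} {τ : Ty 0} {t : ITerm} {φ : Form (τ :: Γ) τ} {ψ : Form Γ τ} :
      IsSequent (Form.mu t.succ φ) (φ.finst ψ) → Ded (Form.mu t φ) ψ →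
      Ded (Form.mu t.succ φ) (φ.finst ψ)
  | muSuccR {Γ : Ctx} {τ : Ty 0} {t : ITerm} {φ : Form (τ :: Γ) τ} :
      IsSequent (φ.finst (Form.mu t φ)) (Form.mu t.succ φ) →
      Ded (φ.finst (Form.mu t φ)) (Form.mu t.succ φ)
  | muMono {Γ : Ctx} {τ : Ty 0} {t : ITerm} {ψ φ : Form (τ :: Γ) τ} :
      IsSequent (Form.mu t ψ) (Form.mu t φ) → Ded ψ φ → Ded (Form.mu t ψ) (Form.mu t φ)
  | nuZero {Γ : Ctx} {τ : Ty 0} {φ : Form (τ :: Γ) τ} :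
      IsSequent .tru (Form.nu .zero φ) → Ded .tru (Form.nu .zero φ)
  | nuSuccR {Γ : Ctx} {τ : Ty 0} {t : ITerm} {φ : Form (τ :: Γ) τ} {ψ : Form Γ τ} :
      IsSequent (φ.finst ψ) (Form.nu t.succ φ) → Ded ψ (Form.nu t φ) →
      Ded (φ.finst ψ) (Form.nu t.succ φ)
  | nuSuccL {Γ : Ctx} {τ : Ty 0} {t : ITerm} {φ : Form (τ :: Γ) τ} :
      IsSequent (Form.nu t.succ φ) (φ.finst (Form.nu t φ)) →
      Ded (Form.nu t.succ φ) (φ.finst (Form.nu t φ))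
  | nuMono {Γ : Ctx} {τ : Ty 0} {t : ITerm} {ψ φ : Form (τ :: Γ) τ} :
      IsSequent (Form.nu t ψ) (Form.nu t φ) → Ded ψ φ → Ded (Form.nu t ψ) (Form.nu t φ)
  -- realizability implication
  | wf {Γ : Ctx} {σ τ : Ty 0} {ψ : Form [] σ} {φ : Form [] τ} :
      IsSequent (Form.imp (Γ := Γ) ψ.all φ) (Form.imp ψ φ.shift).ex →
      Ded (Form.imp (Γ := Γ) ψ.all φ) (Form.imp ψ φ.shift).ex
  | cc {Γ : Ctx} {σ τ : Ty 0} {ψ : Form [] σ} {φ : Form [] τ} : Lang .neutral ψ →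
      IsSequent (Form.imp (Γ := Γ) ψ φ.ex) (Form.imp ψ.shift φ).ex →
      Ded (Form.imp (Γ := Γ) ψ φ.ex) (Form.imp ψ.shift φ).ex
  | exImp {Γ : Ctx} {σ τ : Ty 0} {ψ : Form [] σ} {φ : Form [] τ} :
      IsSequent (Form.imp (Γ := Γ) ψ φ.shift).all (Form.imp ψ.ex φ) →
      Ded (Form.imp (Γ := Γ) ψ φ.shift).all (Form.imp ψ.ex φ)
  | impAll {Γ : Ctx} {σ τ : Ty 0} {ψ : Form [] σ} {φ : Form [] τ} :
      IsSequent (Form.imp (Γ := Γ) ψ.shift φ).all (Form.imp ψ φ.all) →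
      Ded (Form.imp (Γ := Γ) ψ.shift φ).all (Form.imp ψ φ.all)
  | impAnd {Γ : Ctx} {σ τ : Ty 0} {ψ : Form [] σ} {φ₁ φ₂ : Form [] τ} :
      IsSequent ((Form.imp (Γ := Γ) ψ φ₁).and (Form.imp ψ φ₂)) (Form.imp ψ (φ₁.and φ₂)) →
      Ded ((Form.imp (Γ := Γ) ψ φ₁).and (Form.imp ψ φ₂)) (Form.imp ψ (φ₁.and φ₂))
  | impTru {Γ : Ctx} {σ τ : Ty 0} {ψ : Form [] σ} :
      IsSequent (Γ := Γ) .tru (Form.imp ψ (Form.tru (τ := τ))) →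
      Ded (Γ := Γ) .tru (Form.imp ψ (Form.tru (τ := τ)))
  | orImp {Γ : Ctx} {σ τ : Ty 0} {ψ₁ ψ₂ : Form [] σ} {φ : Form [] τ} :
      IsSequent ((Form.imp (Γ := Γ) ψ₁ φ).and (Form.imp ψ₂ φ)) (Form.imp (ψ₁.or ψ₂) φ) →
      Ded ((Form.imp (Γ := Γ) ψ₁ φ).and (Form.imp ψ₂ φ)) (Form.imp (ψ₁.or ψ₂) φ)
  | flsImp {Γ : Ctx} {σ τ : Ty 0} {φ : Form [] τ} :
      IsSequent (Γ := Γ) .tru (Form.imp (Form.fls (τ := σ)) φ) →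
      Ded (Γ := Γ) .tru (Form.imp (Form.fls (τ := σ)) φ)
  | impOr {Γ : Ctx} {σ τ : Ty 0} {δ : Form [] σ} {φ₁ φ₂ : Form [] τ} : LangAnd δ →
      IsSequent (Form.imp (Γ := Γ) δ (φ₁.or φ₂)) ((Form.imp δ φ₁).or (Form.imp δ φ₂)) →
      Ded (Form.imp (Γ := Γ) δ (φ₁.or φ₂)) ((Form.imp δ φ₁).or (Form.imp δ φ₂))
  | impFls {Γ : Ctx} {σ τ : Ty 0} {δ : Form [] σ} : Cons δ → LangAnd δ →
      IsSequent (Γ := Γ) (Form.imp δ (Form.fls (τ := τ))) .fls →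
      Ded (Γ := Γ) (Form.imp δ (Form.fls (τ := τ))) .fls

/-- The consistency predicate `C(δ)`. -/
inductive Cons : {τ : Ty 0} → Form [] τ → Prop
  | unit : Cons Form.unit
  | fold {τ : Ty 1} {φ : Form [] τ.unroll} : Cons φ → Cons (φ.mod .fold)
  | pair {σ τ : Ty 0} {φ : Form [] σ} {ψ : Form [] τ} : Cons φ → Cons ψ →
      Cons ((φ.mod (.pi1 (σ := σ) (τ := τ))).and (ψ.mod .pi2))
  | inj1 {σ τ : Ty 0} {φ : Form [] σ} : Cons φ → Cons (φ.mod (.inj1 (σ := σ) (τ := τ)))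
  | inj2 {σ τ : Ty 0} {φ : Form [] τ} : Cons φ → Cons (φ.mod (.inj2 (σ := σ) (τ := τ)))
  | tru {τ : Ty 0} : Cons (Form.tru (τ := τ))
  | up {τ : Ty 0} {ψ φ : Form [] τ} : Cons ψ → Ded ψ φ → LangAnd φ → Cons φ
  /-- A finite family of pairs `(ψ_i, φ_i)` is given as a list `l`, its subfamilies as the sublists
  of `l`; the alternative `⋀ ψ_j ⊢ False` or `C(⋀ φ_j)` is made according to membership in `A`. -/
  | imp {σ τ : Ty 0} (l : List (Form [] σ × Form [] τ)) (A : Set (List (Form [] σ × Form [] τ))) :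
      (∀ p ∈ l, Cons p.1) → (∀ p ∈ l, Cons p.2) →
      (∀ l', List.Sublist l' l → l' ∈ A → Ded (Form.bigAnd (l'.map Prod.fst)) .fls) →
      (∀ l', List.Sublist l' l → l' ∉ A → Cons (Form.bigAnd (l'.map Prod.snd))) →
      Cons (Form.bigAnd (l.map fun p => Form.imp p.1 p.2))

end

end RefLogic

namespace RefLogic

/-! ### Scott open sets, compact elements and Scott domains -/

/-- Scott open subsets of a cpo. -/
structure ScottOpen {X : Cpo} (U : Set X) : Prop where
  upper : IsUpperSet U
  inacc : ∀ d : Set X, d.Nonempty → DirectedOn (· ≤ ·) d → ∀ a, IsLUB d a → a ∈ U → ∃ x ∈ d, x ∈ U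

/-- An element is compact if its principal filter is Scott open. -/
def CompactElt {X : Cpo} (d : X) : Prop := ScottOpen (Set.Ici d)

theorem compactElt_iff {X : Cpo} {d : X} : CompactElt d ↔
    ∀ s : Set X, s.Nonempty → DirectedOn (· ≤ ·) s → ∀ a, IsLUB s a → d ≤ a → ∃ x ∈ s, d ≤ x :=
  ⟨fun h => h.inacc, fun h => ⟨isUpperSet_Ici d, h⟩⟩

/-- Bounded-complete algebraic cpos. -/
structure IsScottDomain (X : Cpo) : Prop where
  exists_lub : ∀ s : Set X, BddAbove s → ∃ a, IsLUB s a
  exists_compact : ∀ U : Set X, ScottOpen U → ∀ x ∈ U, ∃ d, CompactElt d ∧ d ≤ x ∧ d ∈ U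

theorem ScottOpen.preimage {X Y : Cpo} (f : ScottHom X Y) {U : Set Y} (hU : ScottOpen U) :
    ScottOpen {x | f x ∈ U} := by
  refine ⟨fun x y h hx => hU.upper (f.mono h) hx, fun d hn hd a ha haU => ?_⟩
  obtain ⟨_, ⟨x, hx, rfl⟩, hxU⟩ := hU.inacc _ (hn.image f.1) (directedOn_image f.2.monotone hd) _
    (f.2 hn hd ha) haU
  exact ⟨x, hx, hxU⟩

theorem scottOpen_not_le {X : Cpo} (y : X) : ScottOpen {x : X | ¬ x ≤ y} := by
  refine ⟨fun a b h ha hb => ha (h.trans hb), fun d _ _ a ha haU => ?_⟩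
  by_contra! h
  exact haU (ha.2 fun x hx => not_not.1 (h x hx))

theorem compactElt_of_isLeast {X : Cpo} {b : X} (hb : ∀ x, b ≤ x) : CompactElt b :=
  compactElt_iff.2 fun _ ⟨x, hx⟩ _ _ _ _ => ⟨x, hx, hb x⟩

theorem CompactElt.of_isLUB {X : Cpo} {a b c : X} (ha : CompactElt a) (hb : CompactElt b)
    (hc : IsLUB {a, b} c) : CompactElt c := by
  refine compactElt_iff.2 fun s hs hd x hx hcx => ?_
  obtain ⟨u, hu, hau⟩ := compactElt_iff.1 ha s hs hd x hx ((hc.1 (by simp)).trans hcx)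
  obtain ⟨v, hv, hbv⟩ := compactElt_iff.1 hb s hs hd x hx ((hc.1 (by simp)).trans hcx)
  obtain ⟨w, hw, huw, hvw⟩ := hd u hu v hv
  refine ⟨w, hw, hc.2 ?_⟩
  rintro y (rfl | rfl)
  exacts [hau.trans huw, hbv.trans hvw]

/-- Elements of an algebraic cpo are determined by the compact elements below them. -/
theorem IsScottDomain.le_of_compact {X : Cpo} (hX : IsScottDomain X) {x y : X}
    (h : ∀ d, CompactElt d → d ≤ x → d ≤ y) : x ≤ y := by
  by_contra hxy
  obtain ⟨d, hd, hdx, hdy⟩ := hX.exists_compact _ (scottOpen_not_le y) x hxy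
  exact hdy (h d hd hdx)

theorem EP.L_le_iff {X Y : Cpo} (e : EP X Y) {x : X} {y : Y} : e.L x ≤ y ↔ x ≤ e.R y :=
  ⟨fun h => by simpa only [e.RL] using e.R.mono h, fun h => (e.L.mono h).trans (e.LR y)⟩

/-- Embeddings preserve compact elements. -/
theorem EP.compactElt_L {X Y : Cpo} (e : EP X Y) {d : X} (hd : CompactElt d) :
    CompactElt (e.L d) := by
  refine compactElt_iff.2 fun s hs hdir a ha h => ?_
  obtain ⟨x, hx, hxd⟩ := (ScottOpen.preimage e.R hd).inacc s hs hdir a ha (e.L_le_iff.1 h)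
  exact ⟨x, hx, e.L_le_iff.2 hxd⟩

theorem isScottDomain_one : IsScottDomain Cpo.one :=
  ⟨fun _ _ => ⟨(), fun _ _ => le_rfl, fun _ _ => le_rfl⟩, fun _ _ x hx =>
    ⟨x, compactElt_of_isLeast (X := Cpo.one) fun _ => le_rfl, le_rfl, hx⟩⟩

theorem compactElt_two (b : Cpo.two) : CompactElt b := by
  refine compactElt_iff.2 fun s hs _ a ha hba => ?_
  by_contra! h
  have hb : (b : Bool) = true := by
    obtain ⟨x, hx⟩ := hs
    rcases (b : Bool).eq_false_or_eq_true with h' | h'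
    · exact h'
    · exact absurd (h' ▸ Bool.false_le x : (b : Bool) ≤ x) (h x hx)
  have : a ≤ (false : Bool) := ha.2 fun x hx => by
    rcases (x : Bool).eq_false_or_eq_true with h' | h'
    · exact absurd (le_of_eq (hb.trans h'.symm)) (h x hx)
    · exact le_of_eq h'
  have h3 : (true : Bool) ≤ false := hb ▸ (hba.trans this)
  exact absurd h3 (by decide)

theorem isScottDomain_two : IsScottDomain Cpo.two :=
  ⟨fun s _ => ⟨sSup (α := Bool) s, isLUB_sSup (α := Bool) s⟩,
    fun _ _ x hx => ⟨x, compactElt_two x, le_rfl, hx⟩⟩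

namespace ScottHom

def fst (X Y : Cpo) : ScottHom (X.prod Y) X := ⟨Prod.fst, ScottContinuous.fst⟩

def snd (X Y : Cpo) : ScottHom (X.prod Y) Y := ⟨Prod.snd, ScottContinuous.snd⟩

def inlHom (X Y : Cpo) : ScottHom X (X.sum Y) := ⟨inl, inl_continuous⟩

def inrHom (X Y : Cpo) : ScottHom Y (X.sum Y) := ⟨inr, inr_continuous⟩

def pairLeft {X Y : Cpo} (y : Y) : ScottHom X (X.prod Y) :=
  ⟨fun x => (x, y), ScottContinuous.prodMk ScottContinuous.id (ScottContinuous.const y)⟩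

def pairRight {X Y : Cpo} (x : X) : ScottHom Y (X.prod Y) :=
  ⟨fun y => (x, y), ScottContinuous.prodMk (ScottContinuous.const x) ScottContinuous.id⟩

def eval {X Y : Cpo} (x : X) : ScottHom (X.fn Y) Y :=
  ⟨fun f => ScottHom.toFun f x, fun _ hn hd _ ha => isLUB_fn hn hd ha x⟩

end ScottHom

theorem CompactElt.prodMk {X Y : Cpo} {x : X} {y : Y} (hx : CompactElt x) (hy : CompactElt y) :
    CompactElt (X := X.prod Y) (x, y) := by
  refine compactElt_iff.2 fun s hs hd a ha h => ?_
  obtain ⟨u, hu, hxu⟩ := (hx.preimage (ScottHom.fst X Y)).inacc s hs hd a ha h.1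
  obtain ⟨v, hv, hyv⟩ := (hy.preimage (ScottHom.snd X Y)).inacc s hs hd a ha h.2
  obtain ⟨w, hw, huw, hvw⟩ := hd u hu v hv
  exact ⟨w, hw, ⟨le_trans hxu huw.1, le_trans hyv hvw.2⟩⟩

theorem IsScottDomain.prod {X Y : Cpo} (hX : IsScottDomain X) (hY : IsScottDomain Y) :
    IsScottDomain (X.prod Y) := by
  refine ⟨fun s hs => ?_, fun U hU p hp => ?_⟩
  · obtain ⟨b, hb⟩ := hs
    obtain ⟨x, hx⟩ := hX.exists_lub ((ScottHom.fst X Y).1 '' s)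
      ⟨(b : X × Y).1, by rintro _ ⟨p, hp, rfl⟩; exact (hb hp).1⟩
    obtain ⟨y, hy⟩ := hY.exists_lub ((ScottHom.snd X Y).1 '' s)
      ⟨(b : X × Y).2, by rintro _ ⟨p, hp, rfl⟩; exact (hb hp).2⟩
    exact ⟨(x, y), isLUB_prod.2 ⟨hx, hy⟩⟩
  · obtain ⟨x, y⟩ := p
    obtain ⟨d, hd, hdx, hdU⟩ := hX.exists_compact _ (hU.preimage (ScottHom.pairLeft y)) x hp
    obtain ⟨e, he, hey, heU⟩ := hY.exists_compact _ (hU.preimage (ScottHom.pairRight d)) y hdU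
    exact ⟨(d, e), hd.prodMk he, ⟨hdx, hey⟩, heU⟩

theorem CompactElt.inl {X Y : Cpo} {x : X} (hx : CompactElt x) :
    CompactElt (X := X.sum Y) (inl x) := by
  refine compactElt_iff.2 fun s hs hd a ha h => ?_
  obtain ⟨a, rfl⟩ := inl_up _ _ h
  rcases sum_cases s with ⟨z, hz⟩ | ⟨z, hz⟩ | hz
  · obtain ⟨u, hu, hxu⟩ := hx.inacc _ ⟨z, hz⟩ (preimage_directed inl_le inl_up hd hz).1 a
      ((isLUB_preimage inl_le inl_up hd hz).1 ha) ((inl_le _ _).1 h)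
    exact ⟨RefLogic.inl u, hu, (inl_le _ _).2 hxu⟩
  · obtain ⟨b, hb⟩ := inr_up _ _ (ha.1 hz)
    cases hb
  · have : (RefLogic.inl a : WithBot (X ⊕ Y)) ≤ ⊥ := ha.2 fun w hw => (hz w hw).le
    exact absurd this (WithBot.not_coe_le_bot _)

theorem CompactElt.inr {X Y : Cpo} {y : Y} (hy : CompactElt y) :
    CompactElt (X := X.sum Y) (inr y) := by
  refine compactElt_iff.2 fun s hs hd a ha h => ?_
  obtain ⟨a, rfl⟩ := inr_up _ _ h
  rcases sum_cases s with ⟨z, hz⟩ | ⟨z, hz⟩ | hz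
  · obtain ⟨b, hb⟩ := inl_up _ _ (ha.1 hz)
    cases hb
  · obtain ⟨u, hu, hxu⟩ := hy.inacc _ ⟨z, hz⟩ (preimage_directed inr_le inr_up hd hz).1 a
      ((isLUB_preimage inr_le inr_up hd hz).1 ha) ((inr_le _ _).1 h)
    exact ⟨RefLogic.inr u, hu, (inr_le _ _).2 hxu⟩
  · have : (RefLogic.inr a : WithBot (X ⊕ Y)) ≤ ⊥ := ha.2 fun w hw => (hz w hw).le
    exact absurd this (WithBot.not_coe_le_bot _)

/-- Bounded sets lying below an order-embedded, upward closed part have suprema if those of the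
part do. -/
theorem exists_lub_of_le_image {Z S : Type} [PartialOrder Z] [PartialOrder S] [OrderBot S]
    {i : Z → S} (hi : ∀ a b, i a ≤ i b ↔ a ≤ b) (hup : ∀ a s, i a ≤ s → ∃ b, s = i b)
    (hZ : ∀ s : Set Z, BddAbove s → ∃ a, IsLUB s a) {s : Set S} {c : Z}
    (hlow : ∀ w ≤ i c, w = ⊥ ∨ ∃ z, w = i z) (hs : ∀ w ∈ s, w ≤ i c) : ∃ a, IsLUB s a := by
  obtain ⟨a, ha⟩ := hZ (i ⁻¹' s) ⟨c, fun z hz => (hi _ _).1 (hs _ hz)⟩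
  by_cases h : ∃ z, i z ∈ s
  · obtain ⟨z, hz⟩ := h
    refine ⟨i a, fun w hw => ?_, fun u hu => ?_⟩
    · rcases hlow w (hs w hw) with rfl | ⟨v, rfl⟩
      · exact bot_le
      · exact (hi _ _).2 (ha.1 hw)
    · obtain ⟨u, rfl⟩ := hup _ _ (hu hz)
      exact (hi _ _).2 (ha.2 fun v hv => (hi _ _).1 (hu hv))
  · refine ⟨⊥, fun w hw => ?_, fun u _ => bot_le⟩
    rcases hlow w (hs w hw) with rfl | ⟨v, rfl⟩
    · exact le_rfl
    · exact absurd ⟨v, hw⟩ h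

theorem IsScottDomain.sum {X Y : Cpo} (hX : IsScottDomain X) (hY : IsScottDomain Y) :
    IsScottDomain (X.sum Y) := by
  refine ⟨fun s hs => ?_, fun U hU w hw => ?_⟩
  · obtain ⟨b, hb⟩ := hs
    rcases b with _ | (c | c)
    · exact ⟨(⊥ : WithBot (X ⊕ Y)), hb, fun _ _ => bot_le (α := WithBot (X ⊕ Y))⟩
    · refine exists_lub_of_le_image (S := WithBot (X ⊕ Y)) (c := c) inl_le inl_up hX.exists_lub
        (fun w hw => ?_) (fun w hw => hb hw)
      rcases w with _ | (z | z)
      · exact Or.inl rfl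
      · exact Or.inr ⟨z, rfl⟩
      · exact absurd (WithBot.coe_le_coe.1 hw) Sum.not_inr_le_inl
    · refine exists_lub_of_le_image (S := WithBot (X ⊕ Y)) (c := c) inr_le inr_up hY.exists_lub
        (fun w hw => ?_) (fun w hw => hb hw)
      rcases w with _ | (z | z)
      · exact Or.inl rfl
      · exact absurd (WithBot.coe_le_coe.1 hw) Sum.not_inl_le_inr
      · exact Or.inr ⟨z, rfl⟩
  · rcases w with _ | (x | y)
    · exact ⟨(⊥ : WithBot (X ⊕ Y)), compactElt_of_isLeast (X := X.sum Y)
        fun _ => bot_le (α := WithBot (X ⊕ Y)), bot_le (α := WithBot (X ⊕ Y)), hw⟩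
    · obtain ⟨d, hd, hdx, hdU⟩ := hX.exists_compact _ (hU.preimage (ScottHom.inlHom X Y)) x hw
      exact ⟨RefLogic.inl d, hd.inl, (inl_le _ _).2 hdx, hdU⟩
    · obtain ⟨d, hd, hdx, hdU⟩ := hY.exists_compact _ (hU.preimage (ScottHom.inrHom X Y)) y hw
      exact ⟨RefLogic.inr d, hd.inr, (inr_le _ _).2 hdx, hdU⟩

/-! ### Step functions -/

section Step

variable {X Y : Cpo}

open Classical in
/-- The step function with value `e` above `d` and `⊥` elsewhere. -/
noncomputable def stepHom (d : X) (hd : CompactElt d) (e : Y) : ScottHom X Y :=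
  ⟨fun x => if d ≤ x then e else Y.exists_bot.choose, by
    intro s hs hdir a ha
    have hb := Y.exists_bot.choose_spec
    refine ⟨?_, fun u hu => ?_⟩
    · rintro _ ⟨x, hx, rfl⟩
      change (if d ≤ x then e else _) ≤ (if d ≤ a then e else _)
      split_ifs with h1 h2
      · exact le_rfl
      · exact absurd (h1.trans (ha.1 hx)) h2
      · exact hb _
      · exact le_rfl
    · change (if d ≤ a then e else _) ≤ u
      split_ifs with h
      · obtain ⟨x, hx, hdx⟩ := compactElt_iff.1 hd s hs hdir a ha h
        exact (if_pos hdx).symm.trans_le (hu ⟨x, hx, rfl⟩)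
      · exact hb _⟩

theorem stepHom_apply_of_le {d : X} (hd : CompactElt d) (e : Y) {x : X} (h : d ≤ x) :
    stepHom d hd e x = e := if_pos h

theorem stepHom_apply_of_not_le {d : X} (hd : CompactElt d) (e : Y) {x : X} (h : ¬ d ≤ x) (y : Y) :
    stepHom d hd e x ≤ y := (if_neg h).trans_le (Y.exists_bot.choose_spec y)

theorem stepHom_le_iff {d : X} (hd : CompactElt d) {e : Y} {f : ScottHom X Y} :
    stepHom d hd e ≤ f ↔ e ≤ f d := by
  constructor
  · intro h
    have := ScottHom.apply_le h d
    rwa [stepHom_apply_of_le hd e le_rfl] at this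
  · intro h x
    by_cases hx : d ≤ x
    · exact (stepHom_apply_of_le hd e hx).trans_le (h.trans (f.mono hx))
    · exact stepHom_apply_of_not_le hd e hx _

theorem compactElt_stepHom {d : X} (hd : CompactElt d) {e : Y} (he : CompactElt e) :
    CompactElt (X := X.fn Y) (stepHom d hd e) := by
  refine compactElt_iff.2 fun s hs hdir a ha h => ?_
  obtain ⟨f, hf, hef⟩ := (he.preimage (ScottHom.eval d)).inacc s hs hdir a ha
    ((stepHom_le_iff hd).1 h)
  exact ⟨f, hf, (stepHom_le_iff hd).2 hef⟩

theorem IsScottDomain.fn (hX : IsScottDomain X) (hY : IsScottDomain Y) :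
    IsScottDomain (X.fn Y) := by
  have bc : ∀ s : Set (X.fn Y), BddAbove s → ∃ a, IsLUB s a := by
    rintro s ⟨b, hb⟩
    choose t ht using fun x => hY.exists_lub ((fun f : ScottHom X Y => f x) '' s)
      ⟨ScottHom.toFun b x, by
        rintro _ ⟨f, hf, rfl⟩
        exact ScottHom.apply_le (hb hf) x⟩
    exact ⟨_, isLUB_of_apply ht⟩
  refine ⟨bc, fun U hU f hf => ?_⟩
  let D : Set (X.fn Y) := {g | CompactElt g ∧ g ≤ f}
  have hn : D.Nonempty := by
    obtain ⟨b, hb⟩ := (X.fn Y).exists_bot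
    exact ⟨b, compactElt_of_isLeast hb, hb f⟩
  have hdir : DirectedOn (· ≤ ·) D := by
    rintro g ⟨hg, hgf⟩ h ⟨hh, hhf⟩
    have hbd : f ∈ upperBounds ({g, h} : Set (X.fn Y)) := by
      rintro u (rfl | rfl)
      exacts [hgf, hhf]
    obtain ⟨c, hc⟩ := bc {g, h} ⟨f, hbd⟩
    exact ⟨c, ⟨hg.of_isLUB hh hc, hc.2 hbd⟩, hc.1 (by simp), hc.1 (by simp)⟩
  have hlub : IsLUB D f := by
    refine ⟨fun g hg => hg.2, fun g hg x => hY.le_of_compact fun e he hex => ?_⟩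
    obtain ⟨d, hd, hdx, hed⟩ := hX.exists_compact _
      (he.preimage (show ScottHom X Y from f)) x hex
    have := ScottHom.apply_le (hg ⟨compactElt_stepHom hd he, (stepHom_le_iff hd).2 hed⟩) x
    rwa [stepHom_apply_of_le hd e hdx] at this
  obtain ⟨g, ⟨hg, hgf⟩, hgU⟩ := hU.inacc D hn hdir f hlub hf
  exact ⟨g, hg, hgf, hgU⟩

end Step

/-! ### Limits of chains of Scott domains -/

theorem cocone_L_mono (K : ℕ ⥤ Cpo) (x : Lim K) :
    Monotone fun n => (cocone K n).L ((cocone K n).R x) :=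
  desc_mono (cocone K) (fun _ _ h => cocone_w K h) x

theorem isLUB_cocone (K : ℕ ⥤ Cpo) (x : Lim K) :
    IsLUB (Set.range fun n => (cocone K n).L ((cocone K n).R x)) x := by
  refine ⟨?_, fun y hy n => ?_⟩
  · rintro _ ⟨n, rfl⟩
    exact (cocone K n).LR x
  · have := (cocone K n).R.mono (hy ⟨n, rfl⟩)
    rwa [(cocone K n).RL] at this

theorem IsScottDomain.lim {K : ℕ ⥤ Cpo} (hK : ∀ n, IsScottDomain (K.obj n)) :
    IsScottDomain (Lim K) := by
  refine ⟨fun s hs => ?_, fun U hU x hx => ?_⟩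
  · obtain ⟨b, hb⟩ := hs
    choose t ht using fun n => (hK n).exists_lub ((cocone K n).R.1 '' s)
      ⟨(cocone K n).R b, by
        rintro _ ⟨x, hx, rfl⟩
        exact (cocone K n).R.mono (hb hx)⟩
    have hle : ∀ n m (h : n ≤ m), t n ≤ (K.map (homOfLE h)).R (t m) := by
      intro n m h
      refine (ht n).2 ?_
      rintro _ ⟨x, hx, rfl⟩
      rw [← cocone_w K h]
      exact ScottHom.mono _ ((ht m).1 ⟨x, hx, rfl⟩)
    have hmono : Monotone fun n => (cocone K n).L (t n) := by
      intro n m h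
      change (cocone K n).L (t n) ≤ (cocone K m).L (t m)
      rw [← cocone_w K h]
      exact (cocone K m).L.mono ((ScottHom.mono _ (hle n m h)).trans (EP.LR _ _))
    obtain ⟨a, ha⟩ := (Lim K).exists_lub _ (Set.range_nonempty _)
      (directedOn_range.2 hmono.directed_le)
    refine ⟨a, fun x hx => ?_, fun u hu => ha.2 ?_⟩
    · refine (isLUB_cocone K x).2 ?_
      rintro _ ⟨n, rfl⟩
      exact ((cocone K n).L.mono ((ht n).1 ⟨x, hx, rfl⟩)).trans (ha.1 ⟨n, rfl⟩)
    · rintro _ ⟨n, rfl⟩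
      refine ((cocone K n).L.mono ((ht n).2 ?_)).trans ((cocone K n).LR u)
      rintro _ ⟨x, hx, rfl⟩
      exact (cocone K n).R.mono (hu hx)
  · obtain ⟨_, ⟨n, rfl⟩, hn⟩ := hU.inacc _ (Set.range_nonempty _)
      (directedOn_range.2 (cocone_L_mono K x).directed_le) x (isLUB_cocone K x) hx
    obtain ⟨d, hd, hdx, hdU⟩ := (hK n).exists_compact _ (hU.preimage (cocone K n).L) _ hn
    exact ⟨(cocone K n).L d, EP.compactElt_L _ hd,
      ((cocone K n).L.mono hdx).trans ((cocone K n).LR x), hdU⟩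

theorem isScottDomain_chainObj {G : Cpo ⥤ Cpo}
    (hG : ∀ X, IsScottDomain X → IsScottDomain (G.obj X)) : ∀ n, IsScottDomain (chainObj G n)
  | 0 => isScottDomain_one
  | n + 1 => hG _ (isScottDomain_chainObj hG n)

theorem Ty.isScottDomain_interp : ∀ {n : ℕ} (τ : Ty n) {E : Type 1} [Category.{0} E]
    (ρ : Fin n → (E ⥤ Cpo)) (B : E), (∀ i, IsScottDomain ((ρ i).obj B)) →
      IsScottDomain ((interp τ ρ).obj B)
  | _, var i, _, _, _, _, h => h i
  | _, unit, _, _, _, _, _ => isScottDomain_two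
  | _, prod σ τ, _, _, ρ, B, h =>
    (isScottDomain_interp σ ρ B h).prod (isScottDomain_interp τ ρ B h)
  | _, sum σ τ, _, _, ρ, B, h =>
    (isScottDomain_interp σ ρ B h).sum (isScottDomain_interp τ ρ B h)
  | _, arr σ τ, _, _, ρ, B, h =>
    (isScottDomain_interp σ ρ B h).fn (isScottDomain_interp τ ρ B h)
  | _, recT τ, _, _, _, B, h =>
    IsScottDomain.lim (isScottDomain_chainObj fun X hX =>
      isScottDomain_interp τ _ (B, X) (Fin.cases hX h))

theorem Ty.isScottDomain_dom (τ : Ty 0) : IsScottDomain τ.dom :=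
  isScottDomain_interp τ _ _ fun i => i.elim0

/-! ### Local continuity of the interpretation of types -/

/-- A family of embedding-projection pairs into `Y` whose images exhaust `Y`. -/
structure Exhausts {X : ℕ → Cpo} {Y : Cpo} (e : ∀ n, X n ⟶ Y) : Prop where
  mono : ∀ y, Monotone fun n => (e n).L ((e n).R y)
  isLUB : ∀ y, IsLUB (Set.range fun n => (e n).L ((e n).R y)) y

namespace Exhausts

variable {X X' : ℕ → Cpo} {Y Y' : Cpo}

theorem le {e : ∀ n, X n ⟶ Y} (he : Exhausts e) {y z : Y}
    (h : ∀ n, (e n).L ((e n).R y) ≤ z) : y ≤ z :=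
  (he.isLUB y).2 (by rintro _ ⟨n, rfl⟩; exact h n)

theorem of_le {e : ∀ n, X n ⟶ Y} (hm : ∀ y, Monotone fun n => (e n).L ((e n).R y))
    (h : ∀ y z : Y, (∀ n, (e n).L ((e n).R y) ≤ z) → y ≤ z) : Exhausts e :=
  ⟨hm, fun y => ⟨by rintro _ ⟨n, rfl⟩; exact (e n).LR y, fun z hz => h y z fun n => hz ⟨n, rfl⟩⟩⟩

theorem congr {e e' : ∀ n, X n ⟶ Y} (he : Exhausts e) (h : ∀ n, e n = e' n) : Exhausts e' :=
  funext h ▸ he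

theorem id (Y : Cpo) : Exhausts (fun _ : ℕ => 𝟙 Y) :=
  of_le (fun _ _ _ _ => le_rfl) fun _ _ h => h 0

theorem cocone (K : ℕ ⥤ Cpo) : Exhausts (cocone K) := ⟨cocone_L_mono K, isLUB_cocone K⟩

theorem prod {e : ∀ n, X n ⟶ Y} {f : ∀ n, X' n ⟶ Y'} (he : Exhausts e) (hf : Exhausts f) :
    Exhausts (fun n => EP.prod (e n) (f n)) :=
  of_le (fun _ _ _ h => ⟨he.mono _ h, hf.mono _ h⟩)
    fun _ _ h => ⟨he.le fun n => (h n).1, hf.le fun n => (h n).2⟩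

theorem sum {e : ∀ n, X n ⟶ Y} {f : ∀ n, X' n ⟶ Y'} (he : Exhausts e) (hf : Exhausts f) :
    Exhausts (fun n => EP.sum (e n) (f n)) := by
  refine of_le ?_ ?_
  · rintro (_ | (y | y)) n m h
    · exact le_rfl
    · exact (inl_le _ _).2 (he.mono y h)
    · exact (inr_le _ _).2 (hf.mono y h)
  · rintro (_ | (y | y)) z h
    · exact bot_le (α := WithBot (Y ⊕ Y'))
    · obtain ⟨z, rfl⟩ := inl_up _ _ (h 0)
      exact (inl_le _ _).2 (he.le fun n => (inl_le _ _).1 (h n))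
    · obtain ⟨z, rfl⟩ := inr_up _ _ (h 0)
      exact (inr_le _ _).2 (hf.le fun n => (inr_le _ _).1 (h n))

theorem fn {e : ∀ n, X n ⟶ Y} {f : ∀ n, X' n ⟶ Y'} (he : Exhausts e) (hf : Exhausts f) :
    Exhausts (fun n => EP.fn (e n) (f n)) := by
  have key : ∀ (g : ScottHom Y Y') n m k, n ≤ k → m ≤ k → ∀ y,
      (f m).L ((f m).R (g ((e n).L ((e n).R y)))) ≤ (f k).L ((f k).R (g ((e k).L ((e k).R y)))) :=
    fun g n m k hn hm y => (hf.mono _ hm).trans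
      (ScottHom.mono _ (ScottHom.mono _ (g.mono (he.mono y hn))))
  refine of_le (fun g n m h y => key g n n m h h y) fun g z h y => ?_
  refine ((ScottHom.continuous g) (Set.range_nonempty _)
    (directedOn_range.2 (he.mono y).directed_le) (he.isLUB y)).2 ?_
  rintro _ ⟨_, ⟨n, rfl⟩, rfl⟩
  refine hf.le fun m => ?_
  exact (key g n m (max n m) (le_max_left _ _) (le_max_right _ _) y).trans (h (max n m) y)

end Exhausts

theorem isLUB_desc {K : ℕ ⥤ Cpo} {Y : Cpo} (c : ∀ n, K.obj n ⟶ Y)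
    (hc : ∀ n m (h : n ≤ m), K.map (homOfLE h) ≫ c m = c n) (x : Lim K) :
    IsLUB (Set.range fun n => (c n).L ((cocone K n).R x)) ((desc c hc).L x) :=
  (exists_desc c hc x).choose_spec

theorem Ty.exhausts_interp : ∀ {n : ℕ} (τ : Ty n) {E : Type 1} [Category.{0} E]
    (ρ : Fin n → (E ⥤ Cpo)) (A : ℕ → E) (B : E) (f : ∀ n, A n ⟶ B),
    (∀ i, Exhausts fun n => (ρ i).map (f n)) → Exhausts fun n => (interp τ ρ).map (f n)
  | _, var i, _, _, _, _, _, _, h => h i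
  | _, unit, _, _, _, _, _, _, _ => Exhausts.id _
  | _, prod σ τ, _, _, ρ, A, B, f, h =>
    (exhausts_interp σ ρ A B f h).prod (exhausts_interp τ ρ A B f h)
  | _, sum σ τ, _, _, ρ, A, B, f, h =>
    (exhausts_interp σ ρ A B f h).sum (exhausts_interp τ ρ A B f h)
  | _, arr σ τ, _, _, ρ, A, B, f, h =>
    (exhausts_interp σ ρ A B f h).fn (exhausts_interp τ ρ A B f h)
  | _, recT τ, E, _, ρ, A, B, f, h => by
    let F := interp τ (E := E × Cpo)
      (Fin.cons (CategoryTheory.Prod.snd E Cpo) fun i => CategoryTheory.Prod.fst E Cpo ⋙ ρ i)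
    let G := Functor.curry.obj F
    have hT : ∀ m, Exhausts fun n => chainTransApp (G.map (f n)) m := by
      intro m
      induction m with
      | zero => exact Exhausts.id _
      | succ m ih =>
        have := exhausts_interp τ (E := E × Cpo)
          (Fin.cons (CategoryTheory.Prod.snd E Cpo) fun i => CategoryTheory.Prod.fst E Cpo ⋙ ρ i)
          (fun n => (A n, chainObj (G.obj (A n)) m)) (B, chainObj (G.obj B) m)
          (fun n => (f n, chainTransApp (G.map (f n)) m)) (Fin.cases ih h)
        refine this.congr fun n => ?_
        change F.map (X := (A n, chainObj (G.obj (A n)) m)) (Y := (B, chainObj (G.obj B) m))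
          (f n, chainTransApp (G.map (f n)) m) =
          F.map (X := (A n, chainObj (G.obj (A n)) m)) (Y := (B, chainObj (G.obj (A n)) m))
            (f n, 𝟙 _) ≫ F.map (X := (B, chainObj (G.obj (A n)) m))
              (Y := (B, chainObj (G.obj B) m)) (𝟙 _, chainTransApp (G.map (f n)) m)
        rw [← F.map_comp]
        exact congrArg F.map (Prod.ext (Category.comp_id _).symm (Category.id_comp _).symm)
    have key : ∀ n (y : Lim (chain (G.obj B))), IsLUB (Set.range fun m =>
        (cocone (chain (G.obj B)) m).L ((chainTransApp (G.map (f n)) m).L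
          ((chainTransApp (G.map (f n)) m).R (y.1 m)))) (((Fix G).map (f n)).L
            (((Fix G).map (f n)).R y)) := fun n y =>
      isLUB_desc (K := chain (G.obj (A n)))
        (fun m => (chainTrans (G.map (f n))).app m ≫ cocone (chain (G.obj B)) m)
        (fun k m h => by rw [← Category.assoc, NatTrans.naturality, Category.assoc, cocone_w])
        (((Fix G).map (f n)).R y)
    refine Exhausts.of_le (fun y n n' hn => ?_) fun y z hz => ?_
    · refine (key n y).2 ?_
      rintro _ ⟨m, rfl⟩
      exact ((cocone _ m).L.mono ((hT m).mono _ hn)).trans ((key n' y).1 ⟨m, rfl⟩)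
    · refine (isLUB_cocone _ y).2 ?_
      rintro _ ⟨m, rfl⟩
      refine (ScottHom.continuous _ (Set.range_nonempty _)
        (directedOn_range.2 ((hT m).mono _).directed_le) ((hT m).isLUB _)).2 ?_
      rintro _ ⟨_, ⟨n, rfl⟩, rfl⟩
      exact ((key n y).1 ⟨m, rfl⟩).trans (hz n)

theorem Ty.exhausts_bodyFunctor (τ : Ty 1) (K : ℕ ⥤ Cpo) :
    Exhausts fun n => (bodyFunctor τ).map (cocone K n) :=
  exhausts_interp τ _ (fun n => ((Fin.elim0 : NoParams), K.obj n)) ((Fin.elim0 : NoParams), Lim K)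
    (fun n => (𝟙 _, cocone K n)) (Fin.cases (Exhausts.cocone K) fun i => i.elim0)

theorem unfoldEP_LR {G : Cpo ⥤ Cpo} (hG : Exhausts fun n => G.map (cocone (chain G) n))
    (y : G.obj (Lim (chain G))) : (unfoldEP G).L ((unfoldEP G).R y) = y := by
  refine le_antisymm ((unfoldEP G).LR y) (hG.le fun n => ?_)
  exact (isLUB_desc (unfoldCocone G) (unfoldCocone_w G) ((unfoldEP G).R y)).1 ⟨n + 1, rfl⟩

theorem eqToHom_LR {X Y : Cpo} (h : X = Y) (y : Y) : (eqToHom h).L ((eqToHom h).R y) = y := by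
  subst h
  rfl

/-- `unfold` is the projection of an embedding-projection pair, the embedding being its inverse. -/
theorem Ty.exists_unfold_eq_R (τ : Ty 1) : ∃ e : EP (dom (unroll τ)) (dom (recT τ)),
    e.R = unfold τ := by
  let e : dom (recT τ) ⟶ dom (unroll τ) := unfoldEP (bodyFunctor τ) ≫ eqToHom (bodyFunctor_rec τ)
  refine ⟨⟨e.R, e.L, fun y => ?_, fun x => (e.RL x).le⟩, rfl⟩
  refine (congrArg (eqToHom (bodyFunctor_rec τ)).L
    (unfoldEP_LR (exhausts_bodyFunctor τ _) _)).trans ?_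
  exact eqToHom_LR _ _

/-! ### Compact saturated sets -/

/-- Intersections of finitely generated upper sets of compact elements. -/
def CompactSat {X : Cpo} (Q : Set X) : Prop :=
  ∀ x, x ∉ Q → ∃ F : Set X, F.Finite ∧ (∀ d ∈ F, CompactElt d) ∧ (∀ y ∈ Q, ∃ d ∈ F, d ≤ y) ∧
    ∀ d ∈ F, ¬ d ≤ x

theorem CompactSat.upper {X : Cpo} {Q : Set X} (hQ : CompactSat Q) : IsUpperSet Q := by
  intro x y hxy hx
  by_contra hy
  obtain ⟨F, -, -, h1, h2⟩ := hQ y hy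
  obtain ⟨d, hd, hdx⟩ := h1 x hx
  exact h2 d hd (hdx.trans hxy)

section Closure

variable {X Y : Cpo}

theorem ScottOpen.univ : ScottOpen (Set.univ : Set X) :=
  ⟨isUpperSet_univ, fun _ ⟨x, hx⟩ _ _ _ _ => ⟨x, hx, trivial⟩⟩

theorem ScottOpen.empty : ScottOpen (∅ : Set X) :=
  ⟨isUpperSet_empty, fun _ _ _ _ _ h => h.elim⟩

theorem ScottOpen.inter {U V : Set X} (hU : ScottOpen U) (hV : ScottOpen V) :
    ScottOpen (U ∩ V) := by
  refine ⟨hU.upper.inter hV.upper, fun d hn hd a ha h => ?_⟩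
  obtain ⟨x, hx, hxU⟩ := hU.inacc d hn hd a ha h.1
  obtain ⟨y, hy, hyV⟩ := hV.inacc d hn hd a ha h.2
  obtain ⟨z, hz, hxz, hyz⟩ := hd x hx y hy
  exact ⟨z, hz, hU.upper hxz hxU, hV.upper hyz hyV⟩

theorem ScottOpen.iUnion {ι : Type} {U : ι → Set X} (hU : ∀ i, ScottOpen (U i)) :
    ScottOpen (⋃ i, U i) := by
  refine ⟨isUpperSet_iUnion fun i => (hU i).upper, fun d hn hd a ha h => ?_⟩
  obtain ⟨i, hi⟩ := Set.mem_iUnion.1 h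
  obtain ⟨x, hx, hxU⟩ := (hU i).inacc d hn hd a ha hi
  exact ⟨x, hx, Set.mem_iUnion.2 ⟨i, hxU⟩⟩

theorem ScottOpen.union {U V : Set X} (hU : ScottOpen U) (hV : ScottOpen V) :
    ScottOpen (U ∪ V) := by
  rw [Set.union_eq_iUnion]
  exact ScottOpen.iUnion fun b => by cases b <;> assumption

theorem CompactSat.empty : CompactSat (∅ : Set X) := fun _ _ =>
  ⟨∅, Set.finite_empty, fun _ h => h.elim, fun _ h => h.elim, fun _ h => h.elim⟩

theorem CompactSat.iInter {ι : Type} {Q : ι → Set X} (hQ : ∀ i, CompactSat (Q i)) :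
    CompactSat (⋂ i, Q i) := by
  intro x hx
  obtain ⟨i, hi⟩ := not_forall.1 (Set.mem_iInter.not.1 hx)
  obtain ⟨F, h1, h2, h3, h4⟩ := hQ i x hi
  exact ⟨F, h1, h2, fun y hy => h3 y (Set.mem_iInter.1 hy i), h4⟩

theorem CompactSat.univ : CompactSat (Set.univ : Set X) := fun _ h => (h trivial).elim

theorem CompactSat.inter {P Q : Set X} (hP : CompactSat P) (hQ : CompactSat Q) :
    CompactSat (P ∩ Q) := by
  rw [Set.inter_eq_iInter]
  exact CompactSat.iInter fun b => by cases b <;> assumption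

theorem CompactSat.union {P Q : Set X} (hP : CompactSat P) (hQ : CompactSat Q) :
    CompactSat (P ∪ Q) := by
  intro x hx
  obtain ⟨hxP, hxQ⟩ := not_or.1 hx
  obtain ⟨F, h1, h2, h3, h4⟩ := hP x hxP
  obtain ⟨G, k1, k2, k3, k4⟩ := hQ x hxQ
  refine ⟨F ∪ G, h1.union k1, ?_, ?_, ?_⟩
  · rintro d (hd | hd)
    exacts [h2 d hd, k2 d hd]
  · rintro y (hy | hy)
    · obtain ⟨d, hd, hdy⟩ := h3 y hy
      exact ⟨d, Or.inl hd, hdy⟩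
    · obtain ⟨d, hd, hdy⟩ := k3 y hy
      exact ⟨d, Or.inr hd, hdy⟩
  · rintro d (hd | hd)
    exacts [h4 d hd, k4 d hd]

theorem CompactElt.compactSat_Ici {d : X} (hd : CompactElt d) : CompactSat (Set.Ici d) :=
  fun _ hx => ⟨{d}, Set.finite_singleton d, by rintro _ rfl; exact hd, fun _ hy => ⟨d, rfl, hy⟩,
    by rintro _ rfl; exact hx⟩

theorem CompactSat.preimage_R (e : EP X Y) {Q : Set X} (hQ : CompactSat Q) :
    CompactSat {y | e.R y ∈ Q} := by
  intro y hy
  obtain ⟨F, h1, h2, h3, h4⟩ := hQ _ hy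
  refine ⟨e.L.1 '' F, h1.image _, ?_, fun z hz => ?_, ?_⟩
  · rintro _ ⟨d, hd, rfl⟩
    exact e.compactElt_L (h2 d hd)
  · obtain ⟨d, hd, hdz⟩ := h3 _ hz
    exact ⟨_, ⟨d, hd, rfl⟩, e.L_le_iff.2 hdz⟩
  · rintro _ ⟨d, hd, rfl⟩ h
    exact h4 d hd (e.L_le_iff.1 h)

/-- Order embeddings onto an open subset that preserve compactness. -/
structure OpenEmbedding (i : X → Y) : Prop where
  le_iff : ∀ a b, i a ≤ i b ↔ a ≤ b
  up : ∀ a y, i a ≤ y → ∃ b, y = i b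
  compact : ∀ d, CompactElt d → CompactElt (i d)

theorem openEmbedding_inl : OpenEmbedding (X := X) (Y := X.sum Y) inl :=
  ⟨inl_le, inl_up, fun _ h => h.inl⟩

theorem openEmbedding_inr : OpenEmbedding (X := Y) (Y := X.sum Y) inr :=
  ⟨inr_le, inr_up, fun _ h => h.inr⟩

theorem OpenEmbedding.scottOpen_image {i : X → Y} (hi : OpenEmbedding i) {U : Set X}
    (hU : ScottOpen U) : ScottOpen (i '' U) := by
  obtain ⟨b, hb⟩ := X.exists_bot
  refine ⟨?_, ?_⟩
  · rintro _ y h ⟨x, hx, rfl⟩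
    obtain ⟨z, rfl⟩ := hi.up _ _ h
    exact ⟨z, hU.upper ((hi.le_iff _ _).1 h) hx, rfl⟩
  · rintro d hn hd _ ha ⟨a, haU, rfl⟩
    obtain ⟨x, hx, hbx⟩ := compactElt_iff.1 (hi.compact b (compactElt_of_isLeast hb)) d hn hd _ ha
      ((hi.le_iff _ _).2 (hb a))
    obtain ⟨z, rfl⟩ := hi.up _ _ hbx
    obtain ⟨w, hw, hwU⟩ := hU.inacc _ ⟨z, hx⟩ (preimage_directed hi.le_iff hi.up hd hx).1 a
      ((isLUB_preimage hi.le_iff hi.up hd hx).1 ha) haU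
    exact ⟨i w, hw, w, hwU, rfl⟩

theorem OpenEmbedding.compactSat_image {i : X → Y} (hi : OpenEmbedding i) {Q : Set X}
    (hQ : CompactSat Q) : CompactSat (i '' Q) := by
  obtain ⟨b, hb⟩ := X.exists_bot
  intro y hy
  by_cases h : ∃ x, i x = y
  · obtain ⟨x, rfl⟩ := h
    obtain ⟨F, h1, h2, h3, h4⟩ := hQ x fun hx => hy ⟨x, hx, rfl⟩
    refine ⟨i '' F, h1.image _, ?_, ?_, ?_⟩
    · rintro _ ⟨d, hd, rfl⟩
      exact hi.compact d (h2 d hd)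
    · rintro _ ⟨z, hz, rfl⟩
      obtain ⟨d, hd, hdz⟩ := h3 z hz
      exact ⟨_, ⟨d, hd, rfl⟩, (hi.le_iff _ _).2 hdz⟩
    · rintro _ ⟨d, hd, rfl⟩ hdx
      exact h4 d hd ((hi.le_iff _ _).1 hdx)
  · refine ⟨{i b}, Set.finite_singleton _, ?_, ?_, ?_⟩
    · rintro _ rfl
      exact hi.compact b (compactElt_of_isLeast hb)
    · rintro _ ⟨z, _, rfl⟩
      exact ⟨_, rfl, (hi.le_iff _ _).2 (hb z)⟩
    · rintro _ rfl hby
      obtain ⟨z, rfl⟩ := hi.up _ _ hby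
      exact h ⟨z, rfl⟩

end Closure

section Compactness

variable {X : Cpo}

/-- A filtered family of non-empty sets has a common limit point for the compact saturated sets and
the complements of open sets: the patch topology of a Scott domain is compact. -/
theorem IsScottDomain.exists_limit (hX : IsScottDomain X) {ι : Type} [Nonempty ι] {A : ι → Set X}
    (hA : Directed (· ⊇ ·) A) (hn : ∀ i, (A i).Nonempty) :
    ∃ x, ∀ i, (∀ Q, CompactSat Q → A i ⊆ Q → x ∈ Q) ∧
      ∀ U, ScottOpen U → x ∈ U → (A i ∩ U).Nonempty := by
  have hne : (⨅ i, Filter.principal (A i)).NeBot :=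
    Filter.iInf_neBot_of_directed' (fun i j => by
      obtain ⟨k, h1, h2⟩ := hA i j
      exact ⟨k, Filter.principal_mono.2 h1, Filter.principal_mono.2 h2⟩)
      fun i => Filter.principal_neBot_iff.2 (hn i)
  let G := Ultrafilter.of (⨅ i, Filter.principal (A i))
  have hG : ∀ i, A i ∈ G := fun i =>
    Ultrafilter.of_le _ (Filter.mem_iInf_of_mem i (Filter.mem_principal_self _))
  let D : Set X := {d | CompactElt d ∧ Set.Ici d ∈ G}
  obtain ⟨b, hb⟩ := X.exists_bot
  have hD : D.Nonempty := ⟨b, compactElt_of_isLeast hb, Filter.mem_of_superset Filter.univ_mem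
    fun x _ => hb x⟩
  have hdir : DirectedOn (· ≤ ·) D := by
    rintro d ⟨hd, hdG⟩ e ⟨he, heG⟩
    obtain ⟨x, hx⟩ := Ultrafilter.nonempty_of_mem (Filter.inter_mem hdG heG)
    obtain ⟨c, hc⟩ := hX.exists_lub {d, e} ⟨x, by
      rintro y (rfl | rfl)
      exacts [hx.1, hx.2]⟩
    refine ⟨c, ⟨hd.of_isLUB he hc, Filter.mem_of_superset (Filter.inter_mem hdG heG) fun z hz =>
      hc.2 ?_⟩, hc.1 (by simp), hc.1 (by simp)⟩
    rintro y (rfl | rfl)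
    exacts [hz.1, hz.2]
  obtain ⟨x, hx⟩ := X.exists_lub D hD hdir
  refine ⟨x, fun i => ⟨fun Q hQ hAQ => ?_, fun U hU hxU => ?_⟩⟩
  · by_contra hxQ
    obtain ⟨F, hF, hFc, hFQ, hFx⟩ := hQ x hxQ
    have : (⋃ d ∈ F, Set.Ici d) ∈ G := Filter.mem_of_superset (hG i) fun y hy => by
      obtain ⟨d, hd, hdy⟩ := hFQ y (hAQ hy)
      exact Set.mem_biUnion hd hdy
    obtain ⟨d, hd, hdG⟩ := (Ultrafilter.finite_biUnion_mem_iff hF).1 this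
    exact hFx d hd (hx.1 ⟨hFc d hd, hdG⟩)
  · obtain ⟨d, ⟨-, hdG⟩, hdU⟩ := hU.inacc D hD hdir x hx hxU
    exact Ultrafilter.nonempty_of_mem
      (Filter.inter_mem (hG i) (Filter.mem_of_superset hdG fun y hy => hU.upper hy hdU))

/-- Compact saturated sets are compact. -/
theorem IsScottDomain.exists_subset_of_directed (hX : IsScottDomain X) {ι : Type} [Nonempty ι]
    {U : ι → Set X} (hU : ∀ i, ScottOpen (U i)) (hd : Directed (· ⊆ ·) U) {Q : Set X}
    (hQ : CompactSat Q) (h : Q ⊆ ⋃ i, U i) : ∃ i, Q ⊆ U i := by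
  by_contra! hne
  obtain ⟨x, hx⟩ := hX.exists_limit (A := fun i => Q \ U i) (fun i j => by
      obtain ⟨k, h1, h2⟩ := hd i j
      exact ⟨k, Set.sdiff_subset_sdiff_right h1, Set.sdiff_subset_sdiff_right h2⟩)
    fun i => Set.sdiff_nonempty.2 (hne i)
  obtain ⟨i, hi⟩ := Set.mem_iUnion.1 (h ((hx (Classical.arbitrary ι)).1 Q hQ Set.sdiff_subset))
  obtain ⟨y, hy, hyU⟩ := (hx i).2 (U i) (hU i) hi
  exact hy.2 hyU

/-- Scott domains are well-filtered. -/
theorem IsScottDomain.exists_subset_of_antitone (hX : IsScottDomain X) {K : ℕ → Set X}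
    (hK : ∀ n, CompactSat (K n)) (hm : Antitone K) {U : Set X} (hU : ScottOpen U)
    (h : ⋂ n, K n ⊆ U) : ∃ n, K n ⊆ U := by
  by_contra! hne
  obtain ⟨x, hx⟩ := hX.exists_limit (A := fun n => K n \ U)
    (directed_of_isDirected_le fun i j hij => Set.sdiff_subset_sdiff_left (hm hij))
    fun i => Set.sdiff_nonempty.2 (hne i)
  have hxU : x ∈ U := h (Set.mem_iInter.2 fun n => (hx n).1 (K n) (hK n) Set.sdiff_subset)
  obtain ⟨y, hy, hyU⟩ := (hx 0).2 U hU hxU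
  exact hy.2 hyU

end Compactness

/-! ### Realizability implication between sets -/

section Imp

variable {X Y : Cpo}

/-- The Scott-continuous functions mapping `A` into `B`. -/
def impSet (A : Set X) (B : Set Y) : Set (X.fn Y) := {f | ∀ x ∈ A, ScottHom.toFun f x ∈ B}

theorem ScottOpen.impSet (hX : IsScottDomain X) {A : Set X} {B : Set Y} (hA : CompactSat A)
    (hB : ScottOpen B) : ScottOpen (impSet A B) := by
  refine ⟨fun f g hfg hf x hx => hB.upper (ScottHom.apply_le hfg x) (hf x hx),
    fun d hn hd a ha h => ?_⟩
  have : Nonempty d := hn.to_subtype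
  obtain ⟨f, hf⟩ := hX.exists_subset_of_directed
    (U := fun f : d => {x | ScottHom.toFun f.1 x ∈ B})
    (fun f => hB.preimage (show ScottHom X Y from f.1)) (fun f g => by
      obtain ⟨k, hk, h1, h2⟩ := hd f.1 f.2 g.1 g.2
      exact ⟨⟨k, hk⟩, fun x hx => hB.upper (ScottHom.apply_le h1 x) hx,
        fun x hx => hB.upper (ScottHom.apply_le h2 x) hx⟩) hA fun x hx => by
      obtain ⟨_, ⟨f, hf, rfl⟩, hfB⟩ := hB.inacc _ (hn.image _) (directedOn_apply hd x) _
        (isLUB_fn hn hd ha x) (h x hx)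
      exact Set.mem_iUnion.2 ⟨⟨f, hf⟩, hfB⟩
  exact ⟨f.1, f.2, hf⟩

theorem CompactSat.impSet (hX : IsScottDomain X) {A : Set X} {B : Set Y} (hA : ScottOpen A)
    (hB : CompactSat B) : CompactSat (impSet A B) := by
  intro f hf
  obtain ⟨x, hx⟩ := not_forall.1 hf
  obtain ⟨hxA, hxB⟩ := Classical.not_imp.1 hx
  obtain ⟨d, hd, hdx, hdA⟩ := hX.exists_compact A hA x hxA
  obtain ⟨F, h1, h2, h3, h4⟩ := hB (ScottHom.toFun f d)
    fun h => hxB (hB.upper (ScottHom.mono f hdx) h)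
  refine ⟨(stepHom d hd) '' F, h1.image _, ?_, fun g hg => ?_, ?_⟩
  · rintro _ ⟨e, he, rfl⟩
    exact compactElt_stepHom hd (h2 e he)
  · obtain ⟨e, he, heg⟩ := h3 _ (hg d hdA)
    exact ⟨_, ⟨e, he, rfl⟩, (stepHom_le_iff hd).2 heg⟩
  · rintro _ ⟨e, he, rfl⟩ hef
    exact h4 e he ((stepHom_le_iff hd).1 hef)

end Imp

/-! ### Principal filters of compact elements -/

/-- Empty or the principal filter of a compact element. -/
def CompactFilter {X : Cpo} (S : Set X) : Prop := S = ∅ ∨ ∃ d, CompactElt d ∧ S = Set.Ici d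

section CompactFilter

variable {X Y : Cpo}

theorem CompactFilter.univ : CompactFilter (Set.univ : Set X) := by
  obtain ⟨b, hb⟩ := X.exists_bot
  exact Or.inr ⟨b, compactElt_of_isLeast hb, (Set.eq_univ_of_forall hb).symm⟩

theorem CompactFilter.inter (hX : IsScottDomain X) {S T : Set X} (hS : CompactFilter S)
    (hT : CompactFilter T) : CompactFilter (S ∩ T) := by
  obtain rfl | ⟨d, hd, rfl⟩ := hS
  · exact Or.inl (Set.empty_inter _)
  obtain rfl | ⟨e, he, rfl⟩ := hT
  · exact Or.inl (Set.inter_empty _)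
  rcases (Set.Ici d ∩ Set.Ici e).eq_empty_or_nonempty with h | ⟨x, hx⟩
  · exact Or.inl h
  · obtain ⟨c, hc⟩ := hX.exists_lub {d, e} ⟨x, by
      rintro y (rfl | rfl)
      exacts [hx.1, hx.2]⟩
    refine Or.inr ⟨c, hd.of_isLUB he hc, Set.Subset.antisymm (fun z hz => hc.2 ?_) fun z hz =>
      ⟨(hc.1 (by simp)).trans hz, (hc.1 (by simp)).trans hz⟩⟩
    rintro y (rfl | rfl)
    exacts [hz.1, hz.2]

theorem CompactFilter.preimage_R (e : EP X Y) {S : Set X} (hS : CompactFilter S) :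
    CompactFilter {y | e.R y ∈ S} := by
  obtain rfl | ⟨d, hd, rfl⟩ := hS
  · exact Or.inl rfl
  · exact Or.inr ⟨e.L d, e.compactElt_L hd, Set.ext fun y => e.L_le_iff.symm⟩

theorem CompactFilter.image {i : X → Y} (hi : OpenEmbedding i) {S : Set X}
    (hS : CompactFilter S) : CompactFilter (i '' S) := by
  obtain rfl | ⟨d, hd, rfl⟩ := hS
  · exact Or.inl (Set.image_empty i)
  · refine Or.inr ⟨i d, hi.compact d hd, Set.Subset.antisymm ?_ fun y hy => ?_⟩
    · rintro _ ⟨x, hx, rfl⟩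
      exact (hi.le_iff _ _).2 hx
    · obtain ⟨x, rfl⟩ := hi.up _ _ hy
      exact ⟨x, (hi.le_iff _ _).1 hy, rfl⟩

theorem CompactFilter.impSet {A : Set X} {B : Set Y} (hA : CompactFilter A)
    (hB : CompactFilter B) : CompactFilter (impSet A B) := by
  obtain rfl | ⟨d, hd, rfl⟩ := hA
  · rw [show RefLogic.impSet (∅ : Set X) B = Set.univ from
      Set.eq_univ_of_forall fun f x hx => hx.elim]
    exact CompactFilter.univ
  obtain rfl | ⟨e, he, rfl⟩ := hB
  · exact Or.inl (Set.eq_empty_of_forall_notMem fun f hf => hf d le_rfl)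
  · exact Or.inr ⟨stepHom d hd e, compactElt_stepHom hd he, Set.ext fun f =>
      ⟨fun hf => (stepHom_le_iff hd).2 (hf d le_rfl),
        fun hf x hx => ((stepHom_le_iff hd).1 hf).trans (ScottHom.mono f hx)⟩⟩

/-- A family of implications between principal filters is consistent if the values above any
point are. -/
theorem exists_mem_impSet (hY : IsScottDomain Y) {ι : Type} (I : Set ι) (A : ι → Set X)
    (B : ι → Set Y) (hA : ∀ i ∈ I, CompactFilter (A i) ∧ (A i).Nonempty)
    (hB : ∀ i ∈ I, CompactFilter (B i) ∧ (B i).Nonempty)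
    (h : ∀ x, (⋂ i ∈ {i ∈ I | x ∈ A i}, B i).Nonempty) : (⋂ i ∈ I, impSet (A i) (B i)).Nonempty := by
  have hd : ∀ {Z : Cpo} (S : ι → Set Z), (∀ i ∈ I, CompactFilter (S i) ∧ (S i).Nonempty) →
      ∀ i : I, ∃ d, CompactElt d ∧ S i = Set.Ici d := by
    intro Z S hS i
    rcases (hS i i.2).1 with h | h
    · exact absurd (hS i i.2).2 (by rw [h]; exact Set.not_nonempty_empty)
    · exact h
  choose d hdc hdA using hd A hA
  choose e _ heB using hd B hB
  let F : Set (ScottHom X Y) := Set.range fun i : I => stepHom (d i) (hdc i) (e i)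
  choose s hs using fun x => hY.exists_lub ((fun f : ScottHom X Y => f x) '' F) (by
    obtain ⟨y, hy⟩ := h x
    refine ⟨y, ?_⟩
    rintro _ ⟨_, ⟨i, rfl⟩, rfl⟩
    by_cases hx : d i ≤ x
    · refine (stepHom_apply_of_le (hdc i) _ hx).trans_le ?_
      have := Set.mem_iInter₂.1 hy i ⟨i.2, by rw [hdA i]; exact hx⟩
      rwa [heB i] at this
    · exact stepHom_apply_of_not_le (hdc i) _ hx y)
  refine ⟨⟨s, scottContinuous_of_apply hs⟩, Set.mem_iInter₂.2 fun i hi x hx => ?_⟩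
  rw [hdA ⟨i, hi⟩] at hx
  rw [heB ⟨i, hi⟩]
  refine (stepHom_apply_of_le (hdc ⟨i, hi⟩) (e ⟨i, hi⟩) hx).symm.trans_le ((hs x).1 ?_)
  exact ⟨_, ⟨⟨i, hi⟩, rfl⟩, rfl⟩

end CompactFilter

/-! ### Semantic modalities -/

noncomputable def EP.prodLeft (X Y : Cpo) : EP X (X.prod Y) where
  L := ScottHom.pairLeft Y.exists_bot.choose
  R := ScottHom.fst X Y
  RL _ := rfl
  LR y := ⟨le_refl (Prod.fst (α := X) (β := Y) y), Y.exists_bot.choose_spec _⟩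

noncomputable def EP.prodRight (X Y : Cpo) : EP Y (X.prod Y) where
  L := ScottHom.pairRight X.exists_bot.choose
  R := ScottHom.snd X Y
  RL _ := rfl
  LR y := ⟨X.exists_bot.choose_spec _, le_refl (Prod.snd (α := X) (β := Y) y)⟩

namespace Modality

/-- A modality is the inverse image under a projection or the direct image under an injection. -/
theorem sem_cases : ∀ {σ τ : Ty 0} (m : Modality σ τ),
    (∃ e : EP σ.dom τ.dom, ∀ S, m.sem S = {y | e.R y ∈ S}) ∨
      ¬ m.NotInj ∧ ∃ i : σ.dom → τ.dom, OpenEmbedding i ∧ ∀ S, m.sem S = i '' S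
  | _, _, pi1 (σ := σ) (τ := τ) => Or.inl ⟨EP.prodLeft σ.dom τ.dom, fun _ => rfl⟩
  | _, _, pi2 (σ := σ) (τ := τ) => Or.inl ⟨EP.prodRight σ.dom τ.dom, fun _ => rfl⟩
  | _, _, inj1 => Or.inr ⟨id, _, openEmbedding_inl, fun _ => rfl⟩
  | _, _, inj2 => Or.inr ⟨id, _, openEmbedding_inr, fun _ => rfl⟩
  | _, _, fold (τ := τ) => by
    obtain ⟨e, he⟩ := τ.exists_unfold_eq_R
    exact Or.inl ⟨e, fun S => by rw [he]; rfl⟩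

/-- A modality is the inverse image under a partial function. -/
theorem exists_partial {σ τ : Ty 0} (m : Modality σ τ) : ∃ p : τ.dom → σ.dom → Prop,
    (∀ x y z, p x y → p x z → y = z) ∧ (m.NotInj → ∀ x, ∃ y, p x y) ∧
      ∀ S x, x ∈ m.sem S ↔ ∃ y, p x y ∧ y ∈ S := by
  obtain ⟨e, h⟩ | ⟨hm, i, hi, h⟩ := m.sem_cases
  · refine ⟨fun x y => e.R x = y, ?_, fun _ x => ⟨_, rfl⟩, fun S x => ?_⟩
    · rintro x y z rfl rfl
      rfl
    · rw [h]
      exact ⟨fun hx => ⟨_, rfl, hx⟩, by rintro ⟨_, rfl, hx⟩; exact hx⟩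
  · refine ⟨fun x y => i y = x, fun x y z hy hz => ?_, fun h => absurd h hm, fun S x => ?_⟩
    · have := hy.trans hz.symm
      exact le_antisymm ((hi.le_iff _ _).1 this.le) ((hi.le_iff _ _).1 this.ge)
    · rw [h]
      exact ⟨fun ⟨y, hy, hyx⟩ => ⟨y, hyx, hy⟩, fun ⟨y, hyx, hy⟩ => ⟨y, hy, hyx⟩⟩

variable {σ τ : Ty 0} (m : Modality σ τ)

theorem sem_mono {S T : Set σ.dom} (h : S ⊆ T) : m.sem S ⊆ m.sem T := by
  obtain ⟨p, -, -, hp⟩ := m.exists_partial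
  intro x hx
  obtain ⟨y, hxy, hy⟩ := (hp S x).1 hx
  exact (hp T x).2 ⟨y, hxy, h hy⟩

theorem sem_univ (hm : m.NotInj) : m.sem Set.univ = Set.univ := by
  obtain ⟨p, -, h, hp⟩ := m.exists_partial
  refine Set.eq_univ_of_forall fun x => (hp _ x).2 ?_
  obtain ⟨y, hy⟩ := h hm x
  exact ⟨y, hy, trivial⟩

theorem sem_empty : m.sem ∅ = ∅ := by
  obtain ⟨p, -, -, hp⟩ := m.exists_partial
  refine Set.eq_empty_of_forall_notMem fun x hx => ?_
  obtain ⟨y, -, hy⟩ := (hp _ x).1 hx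
  exact hy

theorem sem_iUnion {ι : Type} (S : ι → Set σ.dom) : m.sem (⋃ i, S i) = ⋃ i, m.sem (S i) := by
  obtain ⟨p, -, -, hp⟩ := m.exists_partial
  ext x
  simp only [hp, Set.mem_iUnion]
  exact ⟨fun ⟨y, hy, i, hi⟩ => ⟨i, y, hy, hi⟩, fun ⟨i, y, hy, hi⟩ => ⟨y, hy, i, hi⟩⟩

theorem sem_iInter {ι : Type} [Nonempty ι] (S : ι → Set σ.dom) :
    m.sem (⋂ i, S i) = ⋂ i, m.sem (S i) := by
  obtain ⟨p, hf, -, hp⟩ := m.exists_partial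
  ext x
  simp only [hp, Set.mem_iInter]
  refine ⟨fun ⟨y, hy, h⟩ i => ⟨y, hy, h i⟩, fun h => ?_⟩
  obtain ⟨y, hy, -⟩ := h (Classical.arbitrary ι)
  refine ⟨y, hy, fun i => ?_⟩
  obtain ⟨z, hz, hzi⟩ := h i
  exact hf x y z hy hz ▸ hzi

theorem sem_union (S T : Set σ.dom) : m.sem (S ∪ T) = m.sem S ∪ m.sem T := by
  rw [Set.union_eq_iUnion, sem_iUnion, Set.union_eq_iUnion]
  exact Set.iUnion_congr fun b => by cases b <;> rfl

theorem sem_inter (S T : Set σ.dom) : m.sem (S ∩ T) = m.sem S ∩ m.sem T := by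
  rw [Set.inter_eq_iInter, sem_iInter, Set.inter_eq_iInter]
  exact Set.iInter_congr fun b => by cases b <;> rfl

theorem scottOpen_sem {S : Set σ.dom} (hS : ScottOpen S) : ScottOpen (m.sem S) := by
  obtain ⟨e, h⟩ | ⟨-, i, hi, h⟩ := m.sem_cases
  · rw [h]; exact hS.preimage e.R
  · rw [h]; exact hi.scottOpen_image hS

theorem compactSat_sem {S : Set σ.dom} (hS : CompactSat S) : CompactSat (m.sem S) := by
  obtain ⟨e, h⟩ | ⟨-, i, hi, h⟩ := m.sem_cases
  · rw [h]; exact hS.preimage_R e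
  · rw [h]; exact hi.compactSat_image hS

theorem compactFilter_sem {S : Set σ.dom} (hS : CompactFilter S) : CompactFilter (m.sem S) := by
  obtain ⟨e, h⟩ | ⟨-, i, hi, h⟩ := m.sem_cases
  · rw [h]; exact hS.preimage_R e
  · rw [h]; exact hS.image hi

theorem nonempty_sem {S : Set σ.dom} (hS : S.Nonempty) : (m.sem S).Nonempty := by
  obtain ⟨e, h⟩ | ⟨-, i, hi, h⟩ := m.sem_cases
  · obtain ⟨x, hx⟩ := hS
    rw [h]
    exact ⟨e.L x, show e.R (e.L x) ∈ S by rw [e.RL]; exact hx⟩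
  · rw [h]; exact hS.image i

end Modality

/-! ### Substitution lemmas -/

theorem ITerm.eval_subst (s : ℕ → ITerm) (ν : ℕ → ℕ) :
    ∀ t : ITerm, (t.subst s).eval ν = t.eval fun k => (s k).eval ν
  | var _ => rfl
  | zero => rfl
  | succ t => congrArg (· + 1) (eval_subst s ν t)

theorem ITerm.eval_shift (t : ITerm) (n : ℕ) (ν : ℕ → ℕ) : t.shift.eval (iCons n ν) = t.eval ν :=
  eval_subst _ _ t

theorem ITerm.eval_congr {ν ν' : ℕ → ℕ} :
    ∀ t : ITerm, (∀ k, t.Free k → ν k = ν' k) → t.eval ν = t.eval ν'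
  | var k, h => h k rfl
  | zero, _ => rfl
  | succ t, h => congrArg (· + 1) (eval_congr t h)

theorem ITerm.eval_mono {ν ν' : ℕ → ℕ} (h : ∀ k, ν k ≤ ν' k) : ∀ t : ITerm, t.eval ν ≤ t.eval ν'
  | var k => h k
  | zero => le_rfl
  | succ t => Nat.succ_le_succ (eval_mono h t)

theorem ITerm.eval_lift (s : ℕ → ITerm) (n : ℕ) (ν : ℕ → ℕ) :
    (fun k => (lift s k).eval (iCons n ν)) = iCons n fun k => (s k).eval ν := by
  funext k
  cases k with
  | zero => rfl
  | succ k => exact eval_shift _ _ _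

theorem ITerm.eval_inst (t : ITerm) (ν : ℕ → ℕ) :
    (fun k => (t.inst k).eval ν) = iCons (t.eval ν) ν := by
  funext k
  cases k <;> rfl

namespace Form

theorem sem_isubst {Γ : Ctx} {τ : Ty 0} (φ : Form Γ τ) (s : ℕ → ITerm) (ρ : FVal Γ) (ν : ℕ → ℕ) :
    (φ.isubst s).sem ρ ν = φ.sem ρ fun k => (s k).eval ν := by
  induction φ generalizing s ν with
  | tru | fls | unit | var => rfl
  | and _ _ h₁ h₂ => simp only [isubst, sem, h₁, h₂]
  | or _ _ h₁ h₂ => simp only [isubst, sem, h₁, h₂]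
  | mod _ _ h => simp only [isubst, sem, h]
  | mu _ _ h => simp only [isubst, sem, h, ITerm.eval_subst]
  | nu _ _ h => simp only [isubst, sem, h, ITerm.eval_subst]
  | ex _ h => simp only [isubst, sem, h, ITerm.eval_lift]
  | all _ h => simp only [isubst, sem, h, ITerm.eval_lift]
  | imp _ _ h₁ h₂ => simp only [isubst, sem, h₁, h₂]

theorem sem_shift {Γ : Ctx} {τ : Ty 0} (φ : Form Γ τ) (ρ : FVal Γ) (n : ℕ) (ν : ℕ → ℕ) :
    φ.shift.sem ρ (iCons n ν) = φ.sem ρ ν := sem_isubst _ _ _ _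

theorem sem_inst {Γ : Ctx} {τ : Ty 0} (φ : Form Γ τ) (t : ITerm) (ρ : FVal Γ) (ν : ℕ → ℕ) :
    (φ.inst t).sem ρ ν = φ.sem ρ (iCons (t.eval ν) ν) := by
  rw [inst, sem_isubst, ITerm.eval_inst]

theorem sem_frename {Γ Δ : Ctx} {τ : Ty 0} (φ : Form Γ τ) (r : ∀ σ, Var Γ σ → Var Δ σ)
    (ρ : FVal Δ) (ν : ℕ → ℕ) : (φ.frename r).sem ρ ν = φ.sem (fun σ x => ρ σ (r σ x)) ν := by
  have key : ∀ {Γ Δ : Ctx} (r : ∀ σ, Var Γ σ → Var Δ σ) (ρ : FVal Δ) {σ : Ty 0} (S : Set σ.dom),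
      (fun τ x => FVal.cons S ρ τ (liftRen r σ τ x)) = FVal.cons S fun τ x => ρ τ (r τ x) := by
    intro Γ Δ r ρ σ S
    funext τ x
    cases x <;> rfl
  induction φ generalizing Δ ν with
  | tru | fls | unit | var => rfl
  | and _ _ h₁ h₂ => simp only [frename, sem, h₁, h₂]
  | or _ _ h₁ h₂ => simp only [frename, sem, h₁, h₂]
  | mod _ _ h => simp only [frename, sem, h]
  | mu _ _ h => simp only [frename, sem, h, key]
  | nu _ _ h => simp only [frename, sem, h, key]
  | ex _ h => simp only [frename, sem, h]
  | all _ h => simp only [frename, sem, h]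
  | imp _ _ h₁ h₂ => rfl

theorem sem_fsubst {Γ Δ : Ctx} {τ : Ty 0} (φ : Form Γ τ) (s : ∀ σ, Var Γ σ → Form Δ σ)
    (ρ : FVal Δ) (ν : ℕ → ℕ) : (φ.fsubst s).sem ρ ν = φ.sem (fun σ x => (s σ x).sem ρ ν) ν := by
  have key : ∀ {Γ Δ : Ctx} (s : ∀ σ, Var Γ σ → Form Δ σ) (ρ : FVal Δ) (ν : ℕ → ℕ) {σ : Ty 0}
      (S : Set σ.dom), (fun τ x => (liftSub s σ τ x).sem (FVal.cons S ρ) ν) =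
        FVal.cons S fun τ x => (s τ x).sem ρ ν := by
    intro Γ Δ s ρ ν σ S
    funext τ x
    cases x with
    | here => rfl
    | there x => exact sem_frename _ _ _ _
  induction φ generalizing Δ ν with
  | tru | fls | unit | var => rfl
  | and _ _ h₁ h₂ => simp only [fsubst, sem, h₁, h₂]
  | or _ _ h₁ h₂ => simp only [fsubst, sem, h₁, h₂]
  | mod _ _ h => simp only [fsubst, sem, h]
  | mu _ _ h => simp only [fsubst, sem, h, key]
  | nu _ _ h => simp only [fsubst, sem, h, key]
  | ex _ h => simp only [fsubst, sem, h, sem_shift]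
  | all _ h => simp only [fsubst, sem, h, sem_shift]
  | imp _ _ h₁ h₂ => rfl

theorem sem_finst {Γ : Ctx} {σ τ : Ty 0} (φ : Form (σ :: Γ) τ) (ψ : Form Γ σ) (ρ : FVal Γ)
    (ν : ℕ → ℕ) : (φ.finst ψ).sem ρ ν = φ.sem (FVal.cons (ψ.sem ρ ν) ρ) ν := by
  rw [finst, sem_fsubst]
  congr 1
  funext τ x
  cases x <;> rfl

theorem sem_congr {Γ : Ctx} {τ : Ty 0} (φ : Form Γ τ) (ρ : FVal Γ) {ν ν' : ℕ → ℕ}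
    (h : ∀ k, φ.Free k → ν k = ν' k) : φ.sem ρ ν = φ.sem ρ ν' := by
  have key : ∀ {P : ℕ → Prop} {ν ν' : ℕ → ℕ} (n : ℕ), (∀ k, P (k + 1) → ν k = ν' k) →
      ∀ k, P k → iCons n ν k = iCons n ν' k := by
    intro P ν ν' n h k hk
    cases k with
    | zero => rfl
    | succ k => exact h k hk
  induction φ generalizing ν ν' with
  | tru | fls | unit | var => rfl
  | and _ _ h₁ h₂ | or _ _ h₁ h₂ =>
    simp only [sem, h₁ ρ fun k hk => h k (Or.inl hk), h₂ ρ fun k hk => h k (Or.inr hk)]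
  | mod _ _ ih => simp only [sem, ih ρ h]
  | mu t _ ih | nu t _ ih =>
    simp only [sem, ih _ fun k hk => h k (Or.inr hk), t.eval_congr fun k hk => h k (Or.inl hk)]
  | ex _ ih => exact Set.iUnion_congr fun n => ih ρ (key n h)
  | all _ ih => exact Set.iInter_congr fun n => ih ρ (key n h)
  | imp _ _ h₁ h₂ =>
    simp only [sem, h₁ _ fun k hk => h k (Or.inl hk), h₂ _ fun k hk => h k (Or.inr hk)]

/-! ### Monotonicity -/

theorem cons_mono {Γ : Ctx} {σ : Ty 0} {S T : Set σ.dom} {ρ ρ' : FVal Γ} (h : S ⊆ T)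
    (hρ : ∀ τ x, ρ τ x ⊆ ρ' τ x) : ∀ τ x, FVal.cons S ρ τ x ⊆ FVal.cons T ρ' τ x
  | _, Var.here => h
  | _, Var.there x => hρ _ x

theorem sem_mono {Γ : Ctx} {τ : Ty 0} (φ : Form Γ τ) {ρ ρ' : FVal Γ}
    (h : ∀ τ x, ρ τ x ⊆ ρ' τ x) (ν : ℕ → ℕ) : φ.sem ρ ν ⊆ φ.sem ρ' ν := by
  induction φ generalizing ν with
  | tru | fls | unit | imp => exact subset_rfl
  | and _ _ h₁ h₂ => exact Set.inter_subset_inter (h₁ h ν) (h₂ h ν)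
  | or _ _ h₁ h₂ => exact Set.union_subset_union (h₁ h ν) (h₂ h ν)
  | mod m _ ih => exact m.sem_mono (ih h ν)
  | var x => exact h _ x
  | mu t _ ih | nu t _ ih =>
    exact Monotone.iterate_le_of_le (fun _ _ hS => ih (cons_mono hS fun _ _ => subset_rfl) ν)
      (fun _ => ih (cons_mono subset_rfl h) ν) _ _
  | ex _ ih => exact Set.iUnion_mono fun n => ih h _
  | all _ ih => exact Set.iInter_mono fun n => ih h _

/-- The map iterated in the interpretation of `mu` and `nu`. -/
def step {Γ : Ctx} {τ : Ty 0} (φ : Form (τ :: Γ) τ) (ρ : FVal Γ) (ν : ℕ → ℕ) :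
    Set τ.dom → Set τ.dom := fun S => φ.sem (FVal.cons S ρ) ν

theorem step_mono {Γ : Ctx} {τ : Ty 0} (φ : Form (τ :: Γ) τ) (ρ : FVal Γ) (ν : ℕ → ℕ) :
    Monotone (φ.step ρ ν) := fun _ _ h => φ.sem_mono (cons_mono h fun _ _ => subset_rfl) ν

theorem sem_mu {Γ : Ctx} {τ : Ty 0} (t : ITerm) (φ : Form (τ :: Γ) τ) (ρ : FVal Γ) (ν : ℕ → ℕ) :
    (mu t φ).sem ρ ν = (φ.step ρ ν)^[t.eval ν] ∅ := rfl

theorem sem_nu {Γ : Ctx} {τ : Ty 0} (t : ITerm) (φ : Form (τ :: Γ) τ) (ρ : FVal Γ) (ν : ℕ → ℕ) :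
    (nu t φ).sem ρ ν = (φ.step ρ ν)^[t.eval ν] Set.univ := rfl

theorem monotone_iterate_empty {Γ : Ctx} {τ : Ty 0} (φ : Form (τ :: Γ) τ) (ρ : FVal Γ)
    (ν : ℕ → ℕ) : Monotone fun n => (φ.step ρ ν)^[n] ∅ :=
  (φ.step_mono ρ ν).monotone_iterate_of_le_map (Set.empty_subset _)

theorem antitone_iterate_univ {Γ : Ctx} {τ : Ty 0} (φ : Form (τ :: Γ) τ) (ρ : FVal Γ)
    (ν : ℕ → ℕ) : Antitone fun n => (φ.step ρ ν)^[n] Set.univ :=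
  (φ.step_mono ρ ν).antitone_iterate_of_map_le (Set.subset_univ _)

end Form

/-- `ν'` arises from `ν` by increasing the value of `k`. -/
structure IncAt (k : ℕ) (ν ν' : ℕ → ℕ) : Prop where
  eq : ∀ l, l ≠ k → ν l = ν' l
  le : ν k ≤ ν' k

theorem IncAt.iCons {k : ℕ} {ν ν' : ℕ → ℕ} (h : IncAt k ν ν') (n : ℕ) :
    IncAt (k + 1) (iCons n ν) (iCons n ν') :=
  ⟨fun l hl => by
    cases l with
    | zero => rfl
    | succ l => exact h.eq l fun e => hl (congrArg (· + 1) e), h.le⟩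

theorem incAt_zero {m n : ℕ} (h : m ≤ n) (ν : ℕ → ℕ) : IncAt 0 (iCons m ν) (iCons n ν) :=
  ⟨fun l hl => by
    cases l with
    | zero => exact absurd rfl hl
    | succ l => rfl, h⟩

theorem IncAt.all_le {k : ℕ} {ν ν' : ℕ → ℕ} (h : IncAt k ν ν') (l : ℕ) : ν l ≤ ν' l := by
  by_cases hl : l = k
  · exact hl ▸ h.le
  · exact (h.eq l hl).le

theorem IncAt.eval_eq {k : ℕ} {ν ν' : ℕ → ℕ} (h : IncAt k ν ν') {t : ITerm} (ht : ¬ t.Free k) :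
    t.eval ν = t.eval ν' :=
  t.eval_congr fun l hl => h.eq l fun e => ht (e ▸ hl)

theorem IncAt.sem_eq {k : ℕ} {ν ν' : ℕ → ℕ} (h : IncAt k ν ν') {Γ : Ctx} {τ : Ty 0} {φ : Form Γ τ}
    (hφ : ¬ φ.Free k) (ρ : FVal Γ) : φ.sem ρ ν = φ.sem ρ ν' :=
  φ.sem_congr ρ fun l hl => h.eq l fun e => hφ (e ▸ hl)

mutual

theorem Pos.sem_subset : ∀ {Γ : Ctx} {τ : Ty 0} {k : ℕ} {φ : Form Γ τ}, Pos k φ →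
    ∀ (ρ : FVal Γ) {ν ν' : ℕ → ℕ}, IncAt k ν ν' → φ.sem ρ ν ⊆ φ.sem ρ ν'
  | _, _, _, _, .notFree hφ, ρ, _, _, h => (h.sem_eq hφ ρ).subset
  | _, _, _, _, .and h₁ h₂, ρ, _, _, h =>
    Set.inter_subset_inter (h₁.sem_subset ρ h) (h₂.sem_subset ρ h)
  | _, _, _, _, .or h₁ h₂, ρ, _, _, h =>
    Set.union_subset_union (h₁.sem_subset ρ h) (h₂.sem_subset ρ h)
  | _, _, _, _, .mod (m := m) h₁, ρ, _, _, h => m.sem_mono (h₁.sem_subset ρ h)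
  | _, _, _, _, .imp h₁ h₂, _, _, _, h => fun _ hf x hx =>
    h₂.sem_subset _ h (hf x (h₁.sem_subset _ h hx))
  | _, _, _, _, .ex h₁, ρ, _, _, h => Set.iUnion_mono fun n => h₁.sem_subset ρ (h.iCons n)
  | _, _, _, _, .mu (t := t) (φ := φ) h₁, ρ, ν, _, h =>
    (φ.monotone_iterate_empty ρ ν (t.eval_mono h.all_le)).trans
      (Monotone.iterate_le_of_le (φ.step_mono ρ ν) (fun _ => h₁.sem_subset _ h) _ _)
  | _, _, _, _, .nu (t := t) (φ := φ) h₁ ht, ρ, ν, ν', h => by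
    rw [Form.sem_nu, Form.sem_nu, h.eval_eq ht]
    exact Monotone.iterate_le_of_le (φ.step_mono ρ ν) (fun _ => h₁.sem_subset _ h) _ _

theorem Neg.sem_subset : ∀ {Γ : Ctx} {τ : Ty 0} {k : ℕ} {φ : Form Γ τ}, Neg k φ →
    ∀ (ρ : FVal Γ) {ν ν' : ℕ → ℕ}, IncAt k ν ν' → φ.sem ρ ν' ⊆ φ.sem ρ ν
  | _, _, _, _, .notFree hφ, ρ, _, _, h => (h.sem_eq hφ ρ).symm.subset
  | _, _, _, _, .and h₁ h₂, ρ, _, _, h =>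
    Set.inter_subset_inter (h₁.sem_subset ρ h) (h₂.sem_subset ρ h)
  | _, _, _, _, .or h₁ h₂, ρ, _, _, h =>
    Set.union_subset_union (h₁.sem_subset ρ h) (h₂.sem_subset ρ h)
  | _, _, _, _, .mod (m := m) h₁, ρ, _, _, h => m.sem_mono (h₁.sem_subset ρ h)
  | _, _, _, _, .imp h₁ h₂, _, _, _, h => fun _ hf x hx =>
    h₂.sem_subset _ h (hf x (h₁.sem_subset _ h hx))
  | _, _, _, _, .all h₁, ρ, _, _, h => Set.iInter_mono fun n => h₁.sem_subset ρ (h.iCons n)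
  | _, _, _, _, .nu (t := t) (φ := φ) h₁, ρ, ν, ν', h =>
    (φ.antitone_iterate_univ ρ ν' (t.eval_mono h.all_le)).trans
      (Monotone.iterate_le_of_le (φ.step_mono ρ ν') (fun _ => h₁.sem_subset _ h) _ _)
  | _, _, _, _, .mu (t := t) (φ := φ) h₁ ht, ρ, ν, ν', h => by
    rw [Form.sem_mu, Form.sem_mu, h.eval_eq ht]
    exact Monotone.iterate_le_of_le (φ.step_mono ρ ν') (fun _ => h₁.sem_subset _ h) _ _

end

theorem Pos.monotone {Γ : Ctx} {τ : Ty 0} {φ : Form Γ τ} (h : Pos 0 φ) (ρ : FVal Γ) (ν : ℕ → ℕ) :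
    Monotone fun n => φ.sem ρ (iCons n ν) := fun _ _ hmn => h.sem_subset ρ (incAt_zero hmn ν)

theorem Neg.antitone {Γ : Ctx} {τ : Ty 0} {φ : Form Γ τ} (h : Neg 0 φ) (ρ : FVal Γ) (ν : ℕ → ℕ) :
    Antitone fun n => φ.sem ρ (iCons n ν) := fun _ _ hmn => h.sem_subset ρ (incAt_zero hmn ν)

/-! ### Topological properties of formulae -/

theorem iterate_induction {α : Type} {P : α → Prop} {f : α → α} (hf : ∀ a, P a → P (f a))
    {a : α} (ha : P a) : ∀ n, P (f^[n] a)
  | 0 => ha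
  | n + 1 => by
    rw [Function.iterate_succ_apply']
    exact hf _ (iterate_induction hf ha n)

theorem FVal.forall_cons {Γ : Ctx} {σ : Ty 0} {P : ∀ τ : Ty 0, Set τ.dom → Prop} {S : Set σ.dom}
    {ρ : FVal Γ} (hS : P σ S) (hρ : ∀ τ x, P τ (ρ τ x)) : ∀ τ x, P τ (FVal.cons S ρ τ x)
  | _, Var.here => hS
  | _, Var.there x => hρ _ x

theorem Lang.scottOpen_and_compactSat {s : Sign} {Γ : Ctx} {τ : Ty 0} {φ : Form Γ τ}
    (h : Lang s φ) : ∀ (ρ : FVal Γ) (ν : ℕ → ℕ),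
    (s ≠ .neg → (∀ τ x, ScottOpen (ρ τ x)) → ScottOpen (φ.sem ρ ν)) ∧
      (s ≠ .pos → (∀ τ x, CompactSat (ρ τ x)) → CompactSat (φ.sem ρ ν)) := by
  induction h with
  | tru => exact fun ρ ν => ⟨fun _ _ => .univ, fun _ _ => .univ⟩
  | fls => exact fun ρ ν => ⟨fun _ _ => .empty, fun _ _ => .empty⟩
  | and _ _ h₁ h₂ =>
    exact fun ρ ν => ⟨fun hs hρ => ((h₁ ρ ν).1 hs hρ).inter ((h₂ ρ ν).1 hs hρ),
      fun hs hρ => ((h₁ ρ ν).2 hs hρ).inter ((h₂ ρ ν).2 hs hρ)⟩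
  | or _ _ h₁ h₂ =>
    exact fun ρ ν => ⟨fun hs hρ => ((h₁ ρ ν).1 hs hρ).union ((h₂ ρ ν).1 hs hρ),
      fun hs hρ => ((h₁ ρ ν).2 hs hρ).union ((h₂ ρ ν).2 hs hρ)⟩
  | unit =>
    intro ρ ν
    have h : ({true} : Set Bool) = Set.Ici true := by ext b; cases b <;> simp
    have hc := compactElt_two true
    exact ⟨fun _ _ => (congrArg (ScottOpen (X := Cpo.two)) h).mpr hc,
      fun _ _ => (congrArg (CompactSat (X := Cpo.two)) h).mpr hc.compactSat_Ici⟩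
  | mod _ ih =>
    exact fun ρ ν => ⟨fun hs hρ => Modality.scottOpen_sem _ ((ih ρ ν).1 hs hρ),
      fun hs hρ => Modality.compactSat_sem _ ((ih ρ ν).2 hs hρ)⟩
  | var => exact fun ρ ν => ⟨fun _ hρ => hρ _ _, fun _ hρ => hρ _ _⟩
  | mu _ ih =>
    exact fun ρ ν => ⟨fun hs hρ => iterate_induction (P := ScottOpen)
        (fun S hS => (ih _ ν).1 hs (FVal.forall_cons (P := fun _ => ScottOpen) hS hρ)) .empty _,
      fun hs hρ => iterate_induction (P := CompactSat)
        (fun S hS => (ih _ ν).2 hs (FVal.forall_cons (P := fun _ => CompactSat) hS hρ)) .empty _⟩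
  | nu _ ih =>
    exact fun ρ ν => ⟨fun hs hρ => iterate_induction (P := ScottOpen)
        (fun S hS => (ih _ ν).1 hs (FVal.forall_cons (P := fun _ => ScottOpen) hS hρ)) .univ _,
      fun hs hρ => iterate_induction (P := CompactSat)
        (fun S hS => (ih _ ν).2 hs (FVal.forall_cons (P := fun _ => CompactSat) hS hρ)) .univ _⟩
  | ex _ _ ih =>
    exact fun ρ ν => ⟨fun hs hρ => ScottOpen.iUnion fun n => (ih ρ _).1 hs hρ,
      fun hs => absurd rfl hs⟩
  | all _ _ ih =>
    exact fun ρ ν => ⟨fun hs => absurd rfl hs,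
      fun hs hρ => CompactSat.iInter fun n => (ih ρ _).2 hs hρ⟩
  | @imp _ σ τ s _ _ _ _ h₁ h₂ =>
    refine fun ρ ν => ⟨fun hs _ => ScottOpen.impSet σ.isScottDomain_dom
        ((h₁ _ ν).2 ?_ fun _ x => nomatch x) ((h₂ _ ν).1 hs fun _ x => nomatch x),
      fun hs _ => CompactSat.impSet σ.isScottDomain_dom
        ((h₁ _ ν).1 ?_ fun _ x => nomatch x) ((h₂ _ ν).2 hs fun _ x => nomatch x)⟩ <;>
    cases s <;> simp_all [Sign.opp]

theorem Lang.scottOpen {s : Sign} (hs : s ≠ .neg) {τ : Ty 0} {φ : Form [] τ} (h : Lang s φ)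
    (ν : ℕ → ℕ) : ScottOpen (φ.sem FVal.nil ν) :=
  (h.scottOpen_and_compactSat _ ν).1 hs fun _ x => nomatch x

theorem Lang.compactSat {s : Sign} (hs : s ≠ .pos) {τ : Ty 0} {φ : Form [] τ} (h : Lang s φ)
    (ν : ℕ → ℕ) : CompactSat (φ.sem FVal.nil ν) :=
  (h.scottOpen_and_compactSat _ ν).2 hs fun _ x => nomatch x

theorem Lang.isUpperSet {s : Sign} {τ : Ty 0} {φ : Form [] τ} (h : Lang s φ) (ν : ℕ → ℕ) :
    IsUpperSet (φ.sem FVal.nil ν) := by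
  by_cases hs : s = .neg
  · exact (h.compactSat (by simp [hs]) ν).upper
  · exact (h.scottOpen hs ν).upper

theorem LangAnd.compactFilter {τ : Ty 0} {δ : Form [] τ} (h : LangAnd δ) (ν : ℕ → ℕ) :
    CompactFilter (δ.sem FVal.nil ν) := by
  induction h with
  | tru => exact .univ
  | fls => exact Or.inl rfl
  | @and τ _ _ _ _ h₁ h₂ => exact h₁.inter τ.isScottDomain_dom h₂
  | unit =>
    have h : ({true} : Set Bool) = Set.Ici true := by ext b; cases b <;> simp
    exact Or.inr ⟨true, compactElt_two true, h⟩
  | mod _ ih => exact Modality.compactFilter_sem _ ih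
  | imp _ _ h₁ h₂ => exact h₁.impSet h₂

/-! ### Continuity in the fixpoint variables -/

theorem iterate_subset_iUnion {α : Type} {F : ℕ → Set α → Set α} {G : Set α → Set α}
    (hF : ∀ i j S T, i ≤ j → S ⊆ T → F i S ⊆ F j T) (hG : Monotone G)
    (hGF : ∀ A : ℕ → Set α, Monotone A → G (⋃ n, A n) ⊆ ⋃ n, F n (A n)) (S : Set α) (m : ℕ) :
    G^[m] S ⊆ ⋃ n, (F n)^[m] S := by
  induction m with
  | zero => exact fun x hx => Set.mem_iUnion.2 ⟨0, hx⟩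
  | succ m ih =>
    simp only [Function.iterate_succ_apply']
    exact (hG ih).trans (hGF _ fun i j hij => Monotone.iterate_le_of_le
      (fun _ _ => hF i i _ _ le_rfl) (fun T => hF i j T T hij subset_rfl) m S)

theorem iInter_subset_iterate {α : Type} {F : ℕ → Set α → Set α} {G : Set α → Set α}
    (hF : ∀ i j S T, i ≤ j → S ⊆ T → F j S ⊆ F i T) (hG : Monotone G)
    (hGF : ∀ A : ℕ → Set α, Antitone A → ⋂ n, F n (A n) ⊆ G (⋂ n, A n)) (S : Set α) (m : ℕ) :
    ⋂ n, (F n)^[m] S ⊆ G^[m] S := by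
  induction m with
  | zero => exact fun x hx => Set.mem_iInter.1 hx 0
  | succ m ih =>
    simp only [Function.iterate_succ_apply']
    exact (hGF _ fun i j hij => Monotone.iterate_le_of_le
      (fun _ _ => hF j j _ _ le_rfl) (fun T => hF i j T T hij subset_rfl) m S).trans (hG ih)

theorem iInter_union_subset {α : Type} {A B : ℕ → Set α} (hA : Antitone A) (hB : Antitone B) :
    ⋂ n, (A n ∪ B n) ⊆ (⋂ n, A n) ∪ ⋂ n, B n := by
  intro x hx
  by_contra h
  obtain ⟨h1, h2⟩ := not_or.1 h
  obtain ⟨i, hi⟩ := not_forall.1 (Set.mem_iInter.not.1 h1)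
  obtain ⟨j, hj⟩ := not_forall.1 (Set.mem_iInter.not.1 h2)
  rcases Set.mem_iInter.1 hx (max i j) with h | h
  · exact hi (hA (le_max_left i j) h)
  · exact hj (hB (le_max_right i j) h)

namespace FVal

/-- Pointwise union and intersection of a sequence of valuations. -/
def iUnion {Γ : Ctx} (ρ : ℕ → FVal Γ) : FVal Γ := fun τ x => ⋃ n, ρ n τ x

def iInter {Γ : Ctx} (ρ : ℕ → FVal Γ) : FVal Γ := fun τ x => ⋂ n, ρ n τ x

theorem cons_iUnion {Γ : Ctx} {σ : Ty 0} (S : ℕ → Set σ.dom) (ρ : ℕ → FVal Γ) :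
    cons (⋃ n, S n) (iUnion ρ) = iUnion fun n => cons (S n) (ρ n) := by
  funext τ x
  cases x <;> rfl

theorem cons_iInter {Γ : Ctx} {σ : Ty 0} (S : ℕ → Set σ.dom) (ρ : ℕ → FVal Γ) :
    cons (⋂ n, S n) (iInter ρ) = iInter fun n => cons (S n) (ρ n) := by
  funext τ x
  cases x <;> rfl

theorem iUnion_const {Γ : Ctx} (ρ : FVal Γ) : iUnion (fun _ => ρ) = ρ := by
  funext τ x
  exact Set.iUnion_const _

theorem iInter_const {Γ : Ctx} (ρ : FVal Γ) : iInter (fun _ => ρ) = ρ := by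
  funext τ x
  exact Set.iInter_const _

end FVal

theorem Lang.sem_iUnion {s : Sign} {Γ : Ctx} {τ : Ty 0} {φ : Form Γ τ} (h : Lang s φ)
    (hs : s ≠ .neg) (ρ : ℕ → FVal Γ) (hρ : ∀ i j, i ≤ j → ∀ τ x, ρ i τ x ⊆ ρ j τ x)
    (ν : ℕ → ℕ) : φ.sem (FVal.iUnion ρ) ν ⊆ ⋃ n, φ.sem (ρ n) ν := by
  have hstep : ∀ {Γ : Ctx} {τ : Ty 0} {φ : Form (τ :: Γ) τ} (ρ : ℕ → FVal Γ)
      (_ : ∀ i j, i ≤ j → ∀ τ x, ρ i τ x ⊆ ρ j τ x) (ν : ℕ → ℕ),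
      (∀ ρ' : ℕ → FVal (τ :: Γ), (∀ i j, i ≤ j → ∀ τ x, ρ' i τ x ⊆ ρ' j τ x) →
        φ.sem (FVal.iUnion ρ') ν ⊆ ⋃ n, φ.sem (ρ' n) ν) → ∀ S m,
      (φ.step (FVal.iUnion ρ) ν)^[m] S ⊆ ⋃ n, (φ.step (ρ n) ν)^[m] S := by
    intro Γ τ φ ρ hρ ν ih S m
    refine iterate_subset_iUnion (F := fun n => φ.step (ρ n) ν)
      (fun i j S T hij hST => φ.sem_mono (Form.cons_mono hST (hρ i j hij)) ν)
      (φ.step_mono _ ν) (fun A hA => ?_) S m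
    change φ.sem (FVal.cons (⋃ n, A n) (FVal.iUnion ρ)) ν ⊆ _
    rw [FVal.cons_iUnion]
    exact ih _ fun i j hij => Form.cons_mono (hA hij) (hρ i j hij)
  induction h generalizing ν with
  | tru => exact fun x _ => Set.mem_iUnion.2 ⟨0, trivial⟩
  | fls => exact fun x hx => hx.elim
  | @and _ _ _ φ ψ _ _ h₁ h₂ =>
    rintro x ⟨hx, hx'⟩
    obtain ⟨i, hi⟩ := Set.mem_iUnion.1 (h₁ hs ρ hρ ν hx)
    obtain ⟨j, hj⟩ := Set.mem_iUnion.1 (h₂ hs ρ hρ ν hx')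
    exact Set.mem_iUnion.2 ⟨max i j, φ.sem_mono (hρ i _ (le_max_left i j)) ν hi,
      ψ.sem_mono (hρ j _ (le_max_right i j)) ν hj⟩
  | or _ _ h₁ h₂ =>
    rintro x (hx | hx)
    · obtain ⟨i, hi⟩ := Set.mem_iUnion.1 (h₁ hs ρ hρ ν hx)
      exact Set.mem_iUnion.2 ⟨i, Or.inl hi⟩
    · obtain ⟨i, hi⟩ := Set.mem_iUnion.1 (h₂ hs ρ hρ ν hx)
      exact Set.mem_iUnion.2 ⟨i, Or.inr hi⟩
  | unit => exact fun x hx => Set.mem_iUnion.2 ⟨0, hx⟩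
  | mod _ ih =>
    refine (Modality.sem_mono _ (ih hs ρ hρ ν)).trans ?_
    rw [Modality.sem_iUnion]
    exact subset_rfl
  | var => exact subset_rfl
  | mu _ ih => exact hstep ρ hρ ν (fun ρ' hρ' => ih hs ρ' hρ' ν) _ _
  | nu _ ih => exact hstep ρ hρ ν (fun ρ' hρ' => ih hs ρ' hρ' ν) _ _
  | ex _ _ ih =>
    intro x hx
    obtain ⟨n, hn⟩ := Set.mem_iUnion.1 hx
    obtain ⟨i, hi⟩ := Set.mem_iUnion.1 (ih hs ρ hρ _ hn)
    exact Set.mem_iUnion.2 ⟨i, Set.mem_iUnion.2 ⟨n, hi⟩⟩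
  | all => exact absurd rfl hs
  | imp => exact fun x hx => Set.mem_iUnion.2 ⟨0, hx⟩

theorem Lang.sem_iInter {s : Sign} {Γ : Ctx} {τ : Ty 0} {φ : Form Γ τ} (h : Lang s φ)
    (hs : s ≠ .pos) (ρ : ℕ → FVal Γ) (hρ : ∀ i j, i ≤ j → ∀ τ x, ρ j τ x ⊆ ρ i τ x)
    (ν : ℕ → ℕ) : ⋂ n, φ.sem (ρ n) ν ⊆ φ.sem (FVal.iInter ρ) ν := by
  have hstep : ∀ {Γ : Ctx} {τ : Ty 0} {φ : Form (τ :: Γ) τ} (ρ : ℕ → FVal Γ)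
      (_ : ∀ i j, i ≤ j → ∀ τ x, ρ j τ x ⊆ ρ i τ x) (ν : ℕ → ℕ),
      (∀ ρ' : ℕ → FVal (τ :: Γ), (∀ i j, i ≤ j → ∀ τ x, ρ' j τ x ⊆ ρ' i τ x) →
        ⋂ n, φ.sem (ρ' n) ν ⊆ φ.sem (FVal.iInter ρ') ν) → ∀ S m,
      ⋂ n, (φ.step (ρ n) ν)^[m] S ⊆ (φ.step (FVal.iInter ρ) ν)^[m] S := by
    intro Γ τ φ ρ hρ ν ih S m
    refine iInter_subset_iterate (F := fun n => φ.step (ρ n) ν)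
      (fun i j S T hij hST => φ.sem_mono (Form.cons_mono hST (hρ i j hij)) ν)
      (φ.step_mono _ ν) (fun A hA => ?_) S m
    change _ ⊆ φ.sem (FVal.cons (⋂ n, A n) (FVal.iInter ρ)) ν
    rw [FVal.cons_iInter]
    exact ih _ fun i j hij => Form.cons_mono (hA hij) (hρ i j hij)
  induction h generalizing ν with
  | tru => exact fun x _ => trivial
  | fls => exact fun x hx => (Set.mem_iInter.1 hx 0).elim
  | and _ _ h₁ h₂ =>
    exact fun x hx => ⟨h₁ hs ρ hρ ν (Set.mem_iInter.2 fun n => (Set.mem_iInter.1 hx n).1),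
      h₂ hs ρ hρ ν (Set.mem_iInter.2 fun n => (Set.mem_iInter.1 hx n).2)⟩
  | @or _ _ _ φ ψ _ _ h₁ h₂ =>
    exact (iInter_union_subset (fun i j hij => φ.sem_mono (hρ i j hij) ν)
      fun i j hij => ψ.sem_mono (hρ i j hij) ν).trans
        (Set.union_subset_union (h₁ hs ρ hρ ν) (h₂ hs ρ hρ ν))
  | unit => exact fun x hx => Set.mem_iInter.1 hx 0
  | mod _ ih =>
    refine subset_trans ?_ (Modality.sem_mono _ (ih hs ρ hρ ν))
    rw [Modality.sem_iInter]
    exact subset_rfl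
  | var => exact subset_rfl
  | mu _ ih => exact hstep ρ hρ ν (fun ρ' hρ' => ih hs ρ' hρ' ν) _ _
  | nu _ ih => exact hstep ρ hρ ν (fun ρ' hρ' => ih hs ρ' hρ' ν) _ _
  | ex => exact absurd rfl hs
  | all _ _ ih =>
    exact fun x hx => Set.mem_iInter.2 fun n => ih hs ρ hρ _ (Set.mem_iInter.2 fun i =>
      Set.mem_iInter.1 (Set.mem_iInter.1 hx i) n)
  | imp => exact fun x hx => Set.mem_iInter.1 hx 0

/-! ### Soundness of the rules -/

theorem Form.mem_sem_bigAnd {Γ : Ctx} {τ : Ty 0} {ρ : FVal Γ} {ν : ℕ → ℕ} {x : τ.dom} :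
    ∀ {l : List (Form Γ τ)}, x ∈ (Form.bigAnd l).sem ρ ν ↔ ∀ φ ∈ l, x ∈ φ.sem ρ ν
  | [] => by simp [bigAnd, sem]
  | φ :: l => by
    have := mem_sem_bigAnd (ρ := ρ) (ν := ν) (x := x) (l := l)
    simp [bigAnd, sem, this]

theorem LangAnd.bigAnd {τ : Ty 0} : ∀ {l : List (Form [] τ)}, (∀ φ ∈ l, LangAnd φ) →
    LangAnd (Form.bigAnd l)
  | [], _ => .tru
  | _ :: _, h => .and (h _ (by simp)) (LangAnd.bigAnd fun φ hφ => h φ (by simp [hφ]))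

theorem Cons.langAnd {τ : Ty 0} {δ : Form [] τ} (h : Cons δ) : LangAnd δ := by
  induction h using Cons.rec (motive_1 := fun _ _ _ => True) with
  | unit => exact .unit
  | fold _ ih => exact .mod ih
  | pair _ _ h₁ h₂ => exact .and (.mod h₁) (.mod h₂)
  | inj1 _ ih => exact .mod ih
  | inj2 _ ih => exact .mod ih
  | tru => exact .tru
  | up _ _ h => exact h
  | imp l A _ _ _ _ h₁ h₂ =>
    refine LangAnd.bigAnd fun φ hφ => ?_
    obtain ⟨p, hp, rfl⟩ := List.mem_map.1 hφ
    exact .imp (h₁ p hp) (h₂ p hp)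
  | _ => trivial

/-! Inversion of membership in the languages. -/

theorem Lang.of_ex {s : Sign} {Γ : Ctx} {τ : Ty 0} {φ : Form Γ τ} (h : Lang s φ.ex) :
    s = .pos ∧ Lang .pos φ ∧ Pos 0 φ := by
  cases h with
  | ex h₁ h₂ => exact ⟨rfl, h₁, h₂⟩

theorem Lang.of_all {s : Sign} {Γ : Ctx} {τ : Ty 0} {φ : Form Γ τ} (h : Lang s φ.all) :
    s = .neg ∧ Lang .neg φ ∧ Neg 0 φ := by
  cases h with
  | all h₁ h₂ => exact ⟨rfl, h₁, h₂⟩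

theorem Lang.of_imp {s : Sign} {Γ : Ctx} {σ τ : Ty 0} {ψ : Form [] σ} {φ : Form [] τ}
    (h : Lang s (Form.imp (Γ := Γ) ψ φ)) : Lang s.opp ψ ∧ Lang s φ := by
  cases h with
  | imp h₁ h₂ => exact ⟨h₁, h₂⟩

theorem Lang.of_or {s : Sign} {Γ : Ctx} {τ : Ty 0} {φ ψ : Form Γ τ} (h : Lang s (φ.or ψ)) :
    Lang s φ ∧ Lang s ψ := by
  cases h with
  | or h₁ h₂ => exact ⟨h₁, h₂⟩

theorem Lang.of_mu {s : Sign} {Γ : Ctx} {τ : Ty 0} {t : ITerm} {φ : Form (τ :: Γ) τ}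
    (h : Lang s (Form.mu t φ)) : Lang s φ := by
  cases h with
  | mu h => exact h

theorem Lang.of_nu {s : Sign} {Γ : Ctx} {τ : Ty 0} {t : ITerm} {φ : Form (τ :: Γ) τ}
    (h : Lang s (Form.nu t φ)) : Lang s φ := by
  cases h with
  | nu h => exact h

theorem Pos.of_ex {Γ : Ctx} {τ : Ty 0} {k : ℕ} {φ : Form Γ τ} (h : Pos k φ.ex) :
    Pos (k + 1) φ := by
  cases h with
  | notFree h => exact .notFree h
  | ex h => exact h

theorem Neg.of_all {Γ : Ctx} {τ : Ty 0} {k : ℕ} {φ : Form Γ τ} (h : Neg k φ.all) :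
    Neg (k + 1) φ := by
  cases h with
  | notFree h => exact .notFree h
  | all h => exact h

section Rules

variable {Γ : Ctx} {σ τ : Ty 0}

theorem sem_exM {φ : Form Γ τ} (h : Lang .pos φ.ex.ex) (ρ : FVal Γ) (ν : ℕ → ℕ) :
    φ.ex.ex.sem ρ ν ⊆ (φ.inst (.var 0)).ex.sem ρ ν := by
  obtain ⟨-, h₁, hk⟩ := h.of_ex
  obtain ⟨-, -, hl⟩ := h₁.of_ex
  intro x hx
  obtain ⟨m, hm⟩ := Set.mem_iUnion.1 hx
  obtain ⟨n, hn⟩ := Set.mem_iUnion.1 hm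
  refine Set.mem_iUnion.2 ⟨max m n, ?_⟩
  rw [Form.sem_inst]
  exact hl.sem_subset ρ (incAt_zero (le_max_right m n) _)
    (hk.of_ex.sem_subset ρ ((incAt_zero (le_max_left m n) ν).iCons n) hn)

theorem sem_allM {φ : Form Γ τ} (h : Lang .neg φ.all.all) (ρ : FVal Γ) (ν : ℕ → ℕ) :
    (φ.inst (.var 0)).all.sem ρ ν ⊆ φ.all.all.sem ρ ν := by
  obtain ⟨-, h₁, hk⟩ := h.of_all
  obtain ⟨-, -, hl⟩ := h₁.of_all
  refine fun x hx => Set.mem_iInter.2 fun m => Set.mem_iInter.2 fun n => ?_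
  have := Set.mem_iInter.1 hx (max m n)
  rw [Form.sem_inst] at this
  exact hk.of_all.sem_subset ρ ((incAt_zero (le_max_left m n) ν).iCons n)
    (hl.sem_subset ρ (incAt_zero (le_max_right m n) _) this)

theorem iterate_step_ex_subset {φ : Form (τ :: Γ) τ} (h : Lang .pos φ.ex) (ρ : FVal Γ)
    (ν : ℕ → ℕ) (S : Set τ.dom) (m : ℕ) :
    (φ.ex.step ρ ν)^[m] S ⊆ ⋃ n, (φ.step ρ (iCons n ν))^[m] S := by
  obtain ⟨-, hφ, hk⟩ := h.of_ex
  have hF : ∀ i j S T, i ≤ j → S ⊆ T → φ.step ρ (iCons i ν) S ⊆ φ.step ρ (iCons j ν) T :=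
    fun i j S T hij hST => (φ.step_mono ρ _ hST).trans (hk.monotone _ ν hij)
  refine iterate_subset_iUnion hF (φ.ex.step_mono ρ ν) (fun A hA x hx => ?_) S m
  obtain ⟨n, hn⟩ := Set.mem_iUnion.1 hx
  rw [← FVal.iUnion_const ρ, FVal.cons_iUnion] at hn
  obtain ⟨i, hi⟩ := Set.mem_iUnion.1 (hφ.sem_iUnion (by simp) _
    (fun i j hij => Form.cons_mono (hA hij) fun _ _ => subset_rfl) _ hn)
  exact Set.mem_iUnion.2 ⟨max n i, hF n _ _ _ (le_max_left n i) (hA (le_max_right n i)) hi⟩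

theorem iInter_subset_iterate_step_all {φ : Form (τ :: Γ) τ} (h : Lang .neg φ.all) (ρ : FVal Γ)
    (ν : ℕ → ℕ) (S : Set τ.dom) (m : ℕ) :
    ⋂ n, (φ.step ρ (iCons n ν))^[m] S ⊆ (φ.all.step ρ ν)^[m] S := by
  obtain ⟨-, hφ, hk⟩ := h.of_all
  have hF : ∀ i j S T, i ≤ j → S ⊆ T → φ.step ρ (iCons j ν) S ⊆ φ.step ρ (iCons i ν) T :=
    fun i j S T hij hST => (φ.step_mono ρ _ hST).trans (hk.antitone _ ν hij)
  refine iInter_subset_iterate hF (φ.all.step_mono ρ ν) (fun A hA x hx => ?_) S m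
  refine Set.mem_iInter.2 fun n => ?_
  rw [← FVal.iInter_const ρ, FVal.cons_iInter]
  refine hφ.sem_iInter (by simp) _
    (fun i j hij => Form.cons_mono (hA hij) fun _ _ => subset_rfl) _ (Set.mem_iInter.2 fun i => ?_)
  exact hF n _ _ _ (le_max_left n i) (hA (le_max_right n i)) (Set.mem_iInter.1 hx (max n i))

theorem sem_wf {ψ : Form [] σ} {φ : Form [] τ} (hψ : Lang .neg ψ.all) (hφ : Lang .pos φ)
    (ρ : FVal Γ) (ν : ℕ → ℕ) :
    (Form.imp (Γ := Γ) ψ.all φ).sem ρ ν ⊆ (Form.imp (Γ := Γ) ψ φ.shift).ex.sem ρ ν := by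
  obtain ⟨-, h₁, hk⟩ := hψ.of_all
  intro f hf
  obtain ⟨n, hn⟩ := σ.isScottDomain_dom.exists_subset_of_antitone
    (fun n => h₁.compactSat (by simp) (iCons n ν)) (hk.antitone _ ν)
    ((hφ.scottOpen (by simp) ν).preimage (show ScottHom σ.dom τ.dom from f)) fun x hx => hf x hx
  refine Set.mem_iUnion.2 ⟨n, fun x hx => ?_⟩
  rw [Form.sem_shift]
  exact hn hx

theorem sem_cc {ψ : Form [] σ} {φ : Form [] τ} (hψ : Lang .neutral ψ) (hφ : Lang .pos φ.ex)
    (ρ : FVal Γ) (ν : ℕ → ℕ) :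
    (Form.imp (Γ := Γ) ψ φ.ex).sem ρ ν ⊆ (Form.imp (Γ := Γ) ψ.shift φ).ex.sem ρ ν := by
  obtain ⟨-, h₁, hk⟩ := hφ.of_ex
  intro f hf
  obtain ⟨n, hn⟩ := σ.isScottDomain_dom.exists_subset_of_directed
    (U := fun n => {x | ScottHom.toFun f x ∈ φ.sem FVal.nil (iCons n ν)})
    (fun n => (h₁.scottOpen (by simp) (iCons n ν)).preimage (show ScottHom σ.dom τ.dom from f))
    (directed_of_isDirected_le fun i j hij x hx => hk.monotone _ ν hij hx)
    (hψ.compactSat (by simp) ν) fun x hx => by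
      obtain ⟨n, hn⟩ := Set.mem_iUnion.1 (hf x hx)
      exact Set.mem_iUnion.2 ⟨n, hn⟩
  refine Set.mem_iUnion.2 ⟨n, fun x hx => ?_⟩
  rw [Form.sem_shift] at hx
  exact hn hx

theorem sem_impOr {δ : Form [] σ} {φ₁ φ₂ : Form [] τ} (hδ : LangAnd δ) {s : Sign}
    (h₁ : Lang s φ₁) (h₂ : Lang s φ₂) (ρ : FVal Γ) (ν : ℕ → ℕ) :
    (Form.imp (Γ := Γ) δ (φ₁.or φ₂)).sem ρ ν ⊆
      ((Form.imp (Γ := Γ) δ φ₁).or (Form.imp δ φ₂)).sem ρ ν := by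
  intro f hf
  obtain h | ⟨d, -, h⟩ := hδ.compactFilter ν
  · exact Or.inl fun x hx => absurd (h ▸ hx) (Set.notMem_empty x)
  · have hle : ∀ x ∈ δ.sem FVal.nil ν, d ≤ x := fun x hx => by rwa [h] at hx
    rcases hf d (h ▸ le_refl d) with hd | hd
    · exact Or.inl fun x hx => h₁.isUpperSet ν (ScottHom.mono f (hle x hx)) hd
    · exact Or.inr fun x hx => h₂.isUpperSet ν (ScottHom.mono f (hle x hx)) hd

theorem nonempty_sem_bigAnd_imp {l : List (Form [] σ × Form [] τ)} {ν : ℕ → ℕ}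
    (h₁ : ∀ p ∈ l, LangAnd p.1 ∧ (p.1.sem FVal.nil ν).Nonempty)
    (h₂ : ∀ p ∈ l, LangAnd p.2 ∧ (p.2.sem FVal.nil ν).Nonempty)
    (h : ∀ l', List.Sublist l' l → ((Form.bigAnd (l'.map Prod.fst)).sem FVal.nil ν).Nonempty →
      ((Form.bigAnd (l'.map Prod.snd)).sem FVal.nil ν).Nonempty) :
    ((Form.bigAnd (l.map fun p => Form.imp p.1 p.2)).sem FVal.nil ν).Nonempty := by
  classical
  obtain ⟨f, hf⟩ := exists_mem_impSet τ.isScottDomain_dom {p | p ∈ l}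
    (fun p => p.1.sem FVal.nil ν) (fun p => p.2.sem FVal.nil ν)
    (fun p hp => ⟨(h₁ p hp).1.compactFilter ν, (h₁ p hp).2⟩)
    (fun p hp => ⟨(h₂ p hp).1.compactFilter ν, (h₂ p hp).2⟩) fun x => by
      obtain ⟨y, hy⟩ := h (l.filter fun p => x ∈ p.1.sem FVal.nil ν) List.filter_sublist
        ⟨x, Form.mem_sem_bigAnd.2 fun φ hφ => by
          obtain ⟨p, hp, rfl⟩ := List.mem_map.1 hφ
          exact of_decide_eq_true (List.mem_filter.1 hp).2⟩
      refine ⟨y, Set.mem_iInter₂.2 fun p hp => Form.mem_sem_bigAnd.1 hy p.2 ?_⟩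
      exact List.mem_map.2 ⟨p, List.mem_filter.2 ⟨hp.1, decide_eq_true hp.2⟩, rfl⟩
  refine ⟨f, Form.mem_sem_bigAnd.2 fun φ hφ => ?_⟩
  obtain ⟨p, hp, rfl⟩ := List.mem_map.1 hφ
  exact Set.mem_iInter₂.1 hf p hp

end Rules

mutual

theorem Ded.sound : ∀ {Γ : Ctx} {τ : Ty 0} {ψ φ : Form Γ τ}, Ded ψ φ →
    ∀ (ρ : FVal Γ) (ν : ℕ → ℕ), ψ.sem ρ ν ⊆ φ.sem ρ ν
  | _, _, _, _, .refl _, _, _ => subset_rfl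
  | _, _, _, _, .cut _ h₁ h₂, ρ, ν => (h₁.sound ρ ν).trans (h₂.sound ρ ν)
  | _, _, _, _, .distr _, _, _ => (Set.inter_union_distrib_left _ _ _).subset
  | _, _, _, _, .andR _ h₁ h₂, ρ, ν => Set.subset_inter (h₁.sound ρ ν) (h₂.sound ρ ν)
  | _, _, _, _, .andL₁ _ h, ρ, ν => Set.inter_subset_left.trans (h.sound ρ ν)
  | _, _, _, _, .andL₂ _ h, ρ, ν => Set.inter_subset_right.trans (h.sound ρ ν)
  | _, _, _, _, .truR _, _, _ => Set.subset_univ _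
  | _, _, _, _, .orR₁ _ h, ρ, ν => (h.sound ρ ν).trans Set.subset_union_left
  | _, _, _, _, .orR₂ _ h, ρ, ν => (h.sound ρ ν).trans Set.subset_union_right
  | _, _, _, _, .orL _ h₁ h₂, ρ, ν => Set.union_subset (h₁.sound ρ ν) (h₂.sound ρ ν)
  | _, _, _, _, .flsL _, _, _ => Set.empty_subset _
  | _, _, _, _, .injDisj _, _, _ => by
    rintro _ ⟨⟨x, _, rfl⟩, y, _, hy⟩
    cases hy
  | _, _, _, _, .modMono (m := m) _ h, ρ, ν => m.sem_mono (h.sound ρ ν)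
  | _, _, _, _, .impMono _ h₁ h₂, _, ν => fun _ hf x hx =>
    h₂.sound _ ν (hf x (h₁.sound _ ν hx))
  | _, _, _, _, .modAnd (m := m) _, _, _ => (m.sem_inter _ _).symm.subset
  | _, _, _, _, .modTru (m := m) hm _, _, _ => (m.sem_univ hm).symm.subset
  | _, _, _, _, .modAll (m := m) _, _, _ => (m.sem_iInter _).symm.subset
  | _, _, _, _, .modOr (m := m) _, _, _ => (m.sem_union _ _).subset
  | _, _, _, _, .modFls (m := m) _, _, _ => m.sem_empty.subset
  | _, _, _, _, .modEx (m := m) _, _, _ => (m.sem_iUnion _).subset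
  | _, _, _, _, .exR (t := t) _ h, ρ, ν => fun x hx => by
    have := h.sound ρ ν hx
    rw [Form.sem_inst] at this
    exact Set.mem_iUnion.2 ⟨_, this⟩
  | _, _, _, _, .exL _ h, ρ, ν => by
    rintro x ⟨hx, hx'⟩
    obtain ⟨n, hn⟩ := Set.mem_iUnion.1 hx'
    have := h.sound ρ (iCons n ν) ⟨by rwa [Form.sem_shift], hn⟩
    rwa [Form.sem_shift] at this
  | _, _, _, _, .exM hs, ρ, ν => by
    obtain ⟨s, h, -⟩ := hs
    obtain ⟨rfl, -, -⟩ := h.of_ex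
    exact sem_exM h ρ ν
  | _, _, _, _, .allL _ h, ρ, ν => fun x hx => by
    refine h.sound ρ ν ?_
    rw [Form.sem_inst]
    exact Set.mem_iInter.1 hx _
  | _, _, _, _, .allR (φ := φ) (θ := θ) _ h, ρ, ν => fun x hx => by
    refine or_iff_not_imp_right.2 fun hθ => Set.mem_iInter.2 fun n => ?_
    have := h.sound ρ (iCons n ν) (by rwa [Form.sem_shift])
    refine Or.resolve_right this ?_
    rwa [Form.sem_shift]
  | _, _, _, _, .allM hs, ρ, ν => by
    obtain ⟨s, -, h⟩ := hs
    obtain ⟨rfl, -, -⟩ := h.of_all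
    exact sem_allM h ρ ν
  | _, _, _, _, .muEx hs, ρ, ν => by
    obtain ⟨s, h, h'⟩ := hs
    obtain ⟨rfl, -, -⟩ := h'.of_ex
    refine (iterate_step_ex_subset h.of_mu ρ ν _ _).trans (Set.iUnion_mono fun n => ?_)
    rw [Form.sem_mu, ITerm.eval_shift]
  | _, _, _, _, .nuEx hs, ρ, ν => by
    obtain ⟨s, h, h'⟩ := hs
    obtain ⟨rfl, -, -⟩ := h'.of_ex
    refine (iterate_step_ex_subset h.of_nu ρ ν _ _).trans (Set.iUnion_mono fun n => ?_)
    rw [Form.sem_nu, ITerm.eval_shift]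
  | _, _, _, _, .allMu hs, ρ, ν => by
    obtain ⟨s, h', h⟩ := hs
    obtain ⟨rfl, -, -⟩ := h'.of_all
    refine (Set.iInter_mono fun n => ?_).trans (iInter_subset_iterate_step_all h.of_mu ρ ν _ _)
    rw [Form.sem_mu, ITerm.eval_shift]
  | _, _, _, _, .allNu hs, ρ, ν => by
    obtain ⟨s, h', h⟩ := hs
    obtain ⟨rfl, -, -⟩ := h'.of_all
    refine (Set.iInter_mono fun n => ?_).trans (iInter_subset_iterate_step_all h.of_nu ρ ν _ _)
    rw [Form.sem_nu, ITerm.eval_shift]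
  | _, _, _, _, .muZero _, _, _ => subset_rfl
  | _, _, _, _, .muSuccL (t := t) (φ := φ) _ h, ρ, ν => by
    rw [Form.sem_finst, Form.sem_mu, ITerm.eval, Function.iterate_succ_apply']
    exact φ.step_mono ρ ν (h.sound ρ ν)
  | _, _, _, _, .muSuccR (t := t) (φ := φ) _, ρ, ν => by
    rw [Form.sem_finst, Form.sem_mu t.succ, ITerm.eval, Function.iterate_succ_apply']
    exact subset_rfl
  | _, _, _, _, .muMono (ψ := ψ) _ h, ρ, ν =>
    Monotone.iterate_le_of_le (ψ.step_mono ρ ν) (fun _ => h.sound _ ν) _ _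
  | _, _, _, _, .nuZero _, _, _ => subset_rfl
  | _, _, _, _, .nuSuccR (t := t) (φ := φ) _ h, ρ, ν => by
    rw [Form.sem_finst, Form.sem_nu, ITerm.eval, Function.iterate_succ_apply']
    exact φ.step_mono ρ ν (h.sound ρ ν)
  | _, _, _, _, .nuSuccL (t := t) (φ := φ) _, ρ, ν => by
    rw [Form.sem_finst, Form.sem_nu t.succ, ITerm.eval, Function.iterate_succ_apply']
    exact subset_rfl
  | _, _, _, _, .nuMono (ψ := ψ) _ h, ρ, ν =>
    Monotone.iterate_le_of_le (ψ.step_mono ρ ν) (fun _ => h.sound _ ν) _ _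
  | _, _, _, _, .wf hs, ρ, ν => by
    obtain ⟨s, h, h'⟩ := hs
    obtain ⟨rfl, -, -⟩ := h'.of_ex
    exact sem_wf h.of_imp.1 h.of_imp.2 ρ ν
  | _, _, _, _, .cc hψ hs, ρ, ν => by
    obtain ⟨s, h, h'⟩ := hs
    obtain ⟨rfl, -, -⟩ := h'.of_ex
    exact sem_cc hψ h.of_imp.2 ρ ν
  | _, _, _, _, .exImp (φ := φ) _, _, ν => fun f hf x hx => by
    obtain ⟨n, hn⟩ := Set.mem_iUnion.1 hx
    have := Set.mem_iInter.1 hf n x hn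
    rwa [φ.sem_shift] at this
  | _, _, _, _, .impAll (ψ := ψ) _, _, ν => fun f hf x hx => Set.mem_iInter.2 fun n =>
    Set.mem_iInter.1 hf n x (by rwa [ψ.sem_shift])
  | _, _, _, _, .impAnd _, _, _ => fun _ hf x hx => ⟨hf.1 x hx, hf.2 x hx⟩
  | _, _, _, _, .impTru _, _, _ => fun _ _ _ _ => trivial
  | _, _, _, _, .orImp _, _, _ => fun _ hf x hx => hx.elim (hf.1 x) (hf.2 x)
  | _, _, _, _, .flsImp _, _, _ => fun _ _ _ hx => hx.elim
  | _, _, _, _, .impOr hδ hs, ρ, ν => by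
    obtain ⟨s, h, -⟩ := hs
    exact sem_impOr hδ h.of_imp.2.of_or.1 h.of_imp.2.of_or.2 ρ ν
  | _, _, _, _, .impFls hc _ _, _, ν => fun f hf => by
    obtain ⟨x, hx⟩ := hc.sound ν
    exact hf x hx

theorem Cons.sound : ∀ {τ : Ty 0} {δ : Form [] τ}, Cons δ →
    ∀ ν : ℕ → ℕ, (δ.sem FVal.nil ν).Nonempty
  | _, _, .unit, _ => ⟨true, rfl⟩
  | _, _, .fold h, ν => Modality.nonempty_sem _ (h.sound ν)
  | _, _, .pair h₁ h₂, ν => by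
    obtain ⟨x, hx⟩ := h₁.sound ν
    obtain ⟨y, hy⟩ := h₂.sound ν
    exact ⟨(x, y), hx, hy⟩
  | _, _, .inj1 h, ν => Modality.nonempty_sem _ (h.sound ν)
  | _, _, .inj2 h, ν => Modality.nonempty_sem _ (h.sound ν)
  | τ, _, .tru, _ => τ.dom.exists_bot.imp fun _ _ => trivial
  | _, _, .up h hd _, ν => (h.sound ν).mono (hd.sound _ ν)
  | _, _, .imp l A h₁ h₂ h₃ h₄, ν =>
    nonempty_sem_bigAnd_imp (fun p hp => ⟨(h₁ p hp).langAnd, (h₁ p hp).sound ν⟩)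
      (fun p hp => ⟨(h₂ p hp).langAnd, (h₂ p hp).sound ν⟩) fun l' hl ⟨x, hx⟩ =>
        (h₄ l' hl fun hA => (h₃ l' hl hA).sound _ ν hx).sound ν

end

end RefLogic

theorem mainTheorem4 :
    (∀ (τ : RefLogic.Ty 0) (δ : RefLogic.Form [] τ), RefLogic.LangAnd δ → RefLogic.Cons δ →
      ∀ ν : ℕ → ℕ, (δ.sem RefLogic.FVal.nil ν).Nonempty) ∧
    (∀ (s : RefLogic.Sign) (Γ : RefLogic.Ctx) (τ : RefLogic.Ty 0) (ψ φ : RefLogic.Form Γ τ),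
      RefLogic.Lang s ψ → RefLogic.Lang s φ → RefLogic.Ded ψ φ →
      ∀ (ρ : RefLogic.FVal Γ) (ν : ℕ → ℕ), ψ.sem ρ ν ⊆ φ.sem ρ ν) :=
  ⟨fun _ _ _ h => h.sound, fun _ _ _ _ _ _ _ h => h.sound⟩
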